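/- Let $\alpha=(\alpha^{ij})$ be a constant Poisson structure on $\mathbb R^d$ (an antisymmetric real matrix), let $D\subset\mathbb C$ be the closed unit disk, and let $\partial_2M=\{e^{\mathrm is}: s\in[a,b]\}\subset\partial D$ with $a<b<a+2\pi$, positively oriented. Let $\mu$ be a normalised ($\int_D\mu=1$) smooth top form on $D$ (e.g. a volume form), and let $\zeta$ be a propagator for the $\frac{\delta}{\delta\mathbb X}$-polarization: a smooth $1$-form on $\{(u,v)\in D\times D: u\neq v\}$ with $|\zeta(u,v)|\le C/|u-v|$ (which holds for every form that extends smoothly to the compactified configuration space), whose pullback to $\{u\in\partial D\}$ vanishes, with $\mathrm d\zeta=-\pi_1^*\mu$ and with integral tending to $1$ over small positively oriented circles of $u$ around an interior point $v$. On $\partial_2M$ put $$\widehat\zeta^\partial(u_2,u_3)=\int_{u_1\in D}\zeta_{12}\wedge\zeta_{13},\qquad \tau(u_2)=\int_{u_1\in D}\mu(u_1)\wedge\zeta_{12}.$$ The boundary field is $\mathbb E_i=E_i+\mathrm dt\,e_i$ ($i=1,\dots,d$), with $E_i$ an odd function on $\partial_2M$ vanishing at the end points and $\mathrm dt\, e_i$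 a $1$-form with even coefficient. The residual fields are even coordinates $z^i$ for the class $1\in H^0(D)$ and odd coordinates $z_i^\dagger$ for the class $[\mu]\in H^2(D,\partial D)$, so that $(z,z^\dagger)$ are coordinates on $H^\bullet(D)\otimes\mathbb R^d\oplus H^\bullet(D,\partial D)\otimes\mathbb R^d[1]$; $x\in\mathbb R^d$ is the background point and $\mathrm d=\mathrm dx^i\,\partial/\partial x^i$. All signs are Koszul signs for the total degree, and integration over $\partial_2M$ picks the coefficient of $\mathrm dt$ written on the left. With the torsion factor $T_{L_1}=1$, the state for $L_1$ in the $\frac{\delta}{\delta\mathbb X}$-polarization is the superfunction $$\widehat\psi_{L_1}=\exp\frac{\mathrm i}{\hbar}\Big(\tfrac12\alpha^{ij}\int_{C_2(\partial_2M)}\pi_1^*\mathbb E_i\wedge\widehat\zeta^\partial\wedge\pi_2^*\mathbb E_j+\int_{\partial_2M}z^i\mathbb E_i+z_i^\dagger\,\mathrm dx^i+\alpha^{ij}\int_{\partial_2M}z_i^\dagger\,\mathbb E_j\wedge\tau\Big),$$ and $$\triangle=\sum_{i=1}^d\frac{\partial}{\partial z^i}\frac{\partial}{\partial z_i^\dagger},\qquad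 \Omega^{(1)}=\int_{\partial_2M}\Big(\mathrm i\hbar\,\mathrm d\mathbb E_i\frac{\delta}{\delta\mathbb E_i}+\mathbb E_i\wedge\mathrm dx^i+\tfrac12\alpha^{ij}\,\mathbb E_i\wedge\mathbb E_j\Big),$$ where $\int_{\partial_2M}\mathrm d\mathbb E_i\frac{\delta}{\delta\mathbb E_i}$ is the odd derivation with $\mathbb E_i\mapsto\mathrm d\mathbb E_i$. Then, for every $\hbar\neq0$: 1. $\mathrm d\widehat\zeta^\partial=\pi_1^*\tau-\pi_2^*\tau$ on $C_2(\partial_2M)$, i.e. at all pairs of distinct points. 2. The exponential series of $\widehat\psi_{L_1}$ converges and $\widehat\psi_{L_1}$ is a superfunction: smooth in the even fields, alternating multilinear in the odd ones. 3. With $B=-\tfrac12\alpha^{ij}\big(\int_{C_2(\partial_2M)}\pi_1^*\mathbb E_i\wedge\pi_1^*\tau\wedge\pi_2^*\mathbb E_j-\int_{C_2(\partial_2M)}\pi_1^*\mathbb E_i\wedge\pi_2^*\tau\wedge\pi_2^*\mathbb E_j\big)$, the boundary term produced by $\mathrm d\widehat\zeta^\partial$, $$\mathrm i\hbar\int_{\partial_2M}\mathrm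 d\mathbb E_i\frac{\delta}{\delta\mathbb E_i}\widehat\psi_{L_1}=\Big(-\tfrac12\alpha^{ij}\int_{\partial_2M}\mathbb E_i\wedge\mathbb E_j+B\Big)\widehat\psi_{L_1},\qquad \hbar^2\triangle\widehat\psi_{L_1}=\Big(-\int_{\partial_2M}\mathbb E_i\wedge\mathrm dx^i-B\Big)\widehat\psi_{L_1},$$ so the BV Laplacian term cancels $B$. 4. (The modified differential quantum master equation.) $$\Big(\mathrm d+\mathrm i\hbar\triangle+\frac{\mathrm i}{\hbar}\Omega^{(1)}\Big)\widehat\psi_{L_1}=0.$$ -/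

import Mathlib

open scoped ContDiff

noncomputable section

namespace PSMDisk

/-! ## Superfunctions

The fields of the theory form a super vector space with even part `V₀` and odd part `V₁`. A
superfunction on it is a family `ψ = (ψ₀, ψ₁, …)` where `ψ k` depends smoothly on the even fields
and is an alternating `k`-linear form in the odd ones: the odd coordinates are the linear functionals
on `V₁`, and they anticommute. The operators below are written on all families `ψ`; the condition
that a family is a genuine superfunction is `IsSuperfunction`. -/

section Super

variable (V₀ V₁ : Type*)

/-- Families of complex valued functions of an even field and of `k` odd fields, `k = 0, 1, …`. -/
abbrev SFun := ∀ k : ℕ, V₀ → (Fin k → V₁) → ℂ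

variable {V₀ V₁}

/-- The superfunction `1`. -/
def oneSF : SFun V₀ V₁
  | 0 => fun _ _ => 1
  | _ + 1 => fun _ _ => 0

/-- Multiplication by a function of the even fields. -/
def mulEven (f : V₀ → ℂ) : Module.End ℂ (SFun V₀ V₁) where
  toFun ψ := fun k p ξ => f p * ψ k p ξ
  map_add' ψ φ := by funext k p ξ; simp [mul_add]
  map_smul' c ψ := by funext k p ξ; simp only [Pi.smul_apply, smul_eq_mul, RingHom.id_apply]; ring

/-- Left multiplication by an odd superfunction that is linear in the odd fields:
`(l · ψ)(ξ₀, …, ξₖ) = ∑ⱼ (-1)ʲ l(ξⱼ) ψ(ξ₀, …, ξⱼ omitted, …, ξₖ)`. -/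
def mulOdd (l : V₀ → V₁ → ℂ) : Module.End ℂ (SFun V₀ V₁) where
  toFun ψ := fun k => match k with
    | 0 => fun _ _ => 0
    | k + 1 => fun p ξ =>
        ∑ j : Fin (k + 1), (-1 : ℂ) ^ (j : ℕ) * l p (ξ j) * ψ k p (j.removeNth ξ)
  map_add' ψ φ := by
    funext k p ξ
    cases k <;> simp [mul_add, Finset.sum_add_distrib]
  map_smul' c ψ := by
    funext k p ξ
    cases k with
    | zero => simp
    | succ k =>
      simp only [Pi.smul_apply, smul_eq_mul, RingHom.id_apply, Finset.mul_sum]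
      exact Finset.sum_congr rfl fun j _ => by ring

/-- The left derivative with respect to the odd field in the direction `c`. -/
def oddDeriv (c : V₁) (ψ : SFun V₀ V₁) : SFun V₀ V₁ :=
  fun k p ξ => ψ (k + 1) p (Fin.cons c ξ)

variable [AddCommGroup V₀] [Module ℝ V₀] [AddCommGroup V₁] [Module ℝ V₁]

/-- The directional (Gateaux) derivative of a function of the even fields. -/
def dirDeriv (f : V₀ → ℂ) (p η : V₀) : ℂ := deriv (fun t : ℝ => f (p + t • η)) 0

/-- The derivative with respect to the even field in the direction `η`. -/
def evenDeriv (η : V₀) (ψ : SFun V₀ V₁) : SFun V₀ V₁ :=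
  fun k p ξ => dirDeriv (fun q => ψ k q ξ) p η

/-- The odd vector field which differentiates an even coordinate `y` to the odd coordinate
`y ∘ A`: the derivative with respect to the even fields in the direction `A ξ`, with the odd
coordinates `ξ` multiplied from the left. -/
def oddField (A : V₁ → V₀) (ψ : SFun V₀ V₁) : SFun V₀ V₁
  | 0 => fun _ _ => 0
  | k + 1 => fun p ξ => ∑ j : Fin (k + 1), (-1 : ℂ) ^ (j : ℕ) *
      dirDeriv (fun q => ψ k q (j.removeNth ξ)) p (A (ξ j))

/-- Smoothness of a function on an infinite dimensional space: it is smooth on every finite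
dimensional affine subspace. -/
def GateauxSmooth (f : V₀ → ℂ) : Prop :=
  ∀ (n : ℕ) (p : V₀) (η : Fin n → V₀),
    ContDiff ℝ ∞ (fun y : Fin n → ℝ => f (p + ∑ i, y i • η i))

/-- `ψ` is a superfunction. -/
def IsSuperfunction (ψ : SFun V₀ V₁) : Prop :=
  ∀ k : ℕ, (∀ p : V₀, ∃ A : V₁ [⋀^Fin k]→ₗ[ℝ] ℂ, ∀ ξ, A ξ = ψ k p ξ) ∧
    ∀ ξ : Fin k → V₁, GateauxSmooth fun p => ψ k p ξ

end Super

/-- The `n`-th term of the exponential series `exp S = ∑ₙ (1/n!) Sⁿ` of an even superfunction `S`,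
which is represented by the operator of multiplication by `S`. -/
def expTerm {V₀ V₁ : Type*} (S : Module.End ℂ (SFun V₀ V₁)) (n : ℕ) : SFun V₀ V₁ :=
  (n.factorial : ℂ)⁻¹ • (S ^ n) oneSF

/-- The superfunction `exp S`. -/
def expSF {V₀ V₁ : Type*} (S : Module.End ℂ (SFun V₀ V₁)) : SFun V₀ V₁ :=
  fun k p ξ => ∑' n, expTerm S n k p ξ

/-! ## Propagators on the disk -/

/-- The closed unit disk `D`, as a subset of `ℂ = ℝ²`. -/
def disk : Set ℂ := Metric.closedBall 0 1

/-- Pairs of distinct points of `D`. -/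
def conf : Set (ℂ × ℂ) := {q | q.1 ∈ disk ∧ q.2 ∈ disk ∧ q.1 ≠ q.2}

/-- The area form `dx ∧ dy` of `ℂ = ℝ²`. -/
def area (a b : ℂ) : ℝ := a.re * b.im - a.im * b.re

/-- `m dx ∧ dy` is a smooth normalised top form on `D` (for example a normalised volume form);
it represents the generator of `H²(D, ∂D)`. -/
structure IsNormalisedTopForm (m : ℂ → ℝ) : Prop where
  smooth : ContDiffOn ℝ ∞ m disk
  integral_eq_one : ∫ u in disk, m u = 1

/-- Propagators for the `δ/δ𝕏`-polarization, where the fluctuation of the field `η` vanishes on the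
whole boundary of `D`, with the cohomology represented by `1` and by `μ = m dx ∧ dy`. Such a
propagator is a smooth `1`-form `ζ` on the configuration space of pairs `u ≠ v` in `D` (`u` is the
end of `η`, `v` the end of `X`), which pulls back to zero on `{u ∈ ∂D}`, satisfies
`dζ = -π₁^*μ`, and has integral `1` over small positively oriented circles of `u` around `v`.
The bound on `ζ` near the diagonal holds for all forms that extend smoothly to the compactified
configuration space. -/
structure IsPropagator (m : ℂ → ℝ) (ζ : ℂ × ℂ → (ℂ × ℂ →L[ℝ] ℝ)) : Prop where
  smooth : ContDiffOn ℝ ∞ ζ conf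
  ext_deriv : ∀ q ∈ conf, ∀ a b : ℂ × ℂ,
    fderivWithin ℝ ζ conf q a b - fderivWithin ℝ ζ conf q b a = -(m q.1 * area a.1 b.1)
  boundary : ∀ q ∈ conf, ‖q.1‖ = 1 → ∀ (c : ℝ) (w : ℂ), ζ q (c • (Complex.I * q.1), w) = 0
  normalised : ∀ v : ℂ, ‖v‖ < 1 →
    Filter.Tendsto (fun r : ℝ => ∫ θ in (0 : ℝ)..(2 * Real.pi),
        ζ (circleMap v r θ, v) (deriv (circleMap v r) θ, 0))
      (nhdsWithin 0 (Set.Ioi 0)) (nhds 1)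
  bound : ∃ C : ℝ, ∀ q ∈ conf, ‖ζ q‖ ≤ C / ‖q.1 - q.2‖

/-- The point of `∂D` with parameter `s`, in the positive orientation. -/
def bdryPt (s : ℝ) : ℂ := circleMap 0 1 s

/-- The function `ζ̂(u₂, u₃) = ∫_D ζ₁₂ ∧ ζ₁₃` of the boundary points `u₂`, `u₃` with parameters `s`,
`t` (integration over the bulk vertex `u₁ = u`). -/
def zetaHat (ζ : ℂ × ℂ → (ℂ × ℂ →L[ℝ] ℝ)) (s t : ℝ) : ℝ :=
  ∫ u in disk,
    (ζ (u, bdryPt s) (1, 0) * ζ (u, bdryPt t) (Complex.I, 0) -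
      ζ (u, bdryPt s) (Complex.I, 0) * ζ (u, bdryPt t) (1, 0))

/-- The coefficient of `ds` in the boundary `1`-form `τ = ∫_D μ(u₁) ∧ ζ₁₂`. -/
def tau (m : ℂ → ℝ) (ζ : ℂ × ℂ → (ℂ × ℂ →L[ℝ] ℝ)) (s : ℝ) : ℝ :=
  ∫ u in disk, m u * ζ (u, bdryPt s) (0, deriv bdryPt s)

/-! ## Fields

The free boundary interval `∂₂M` is the arc with parameters in `[a, b]`. A form on it is given by
its coefficient, a smooth function on `[a, b]`, extended by zero to `ℝ`. -/

/-- Smooth `1`-forms on `[a, b]` with values in `ℝᵈ`. -/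
def Form1 (d : ℕ) (a b : ℝ) : Submodule ℝ (ℝ → Fin d → ℝ) where
  carrier := {f | ContDiffOn ℝ ∞ f (Set.Icc a b) ∧ ∀ t ∉ Set.Icc a b, f t = 0}
  add_mem' := by
    rintro f g ⟨hf, hf'⟩ ⟨hg, hg'⟩
    exact ⟨hf.add hg, fun t ht => by simp [hf' t ht, hg' t ht]⟩
  zero_mem' := ⟨contDiffOn_const, fun _ _ => rfl⟩
  smul_mem' := by
    rintro c f ⟨hf, hf'⟩
    exact ⟨hf.const_smul c, fun t ht => by simp [hf' t ht]⟩

/-- Smooth functions on `[a, b]` with values in `ℝᵈ` that vanish at the end points. -/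
def Form0 (d : ℕ) (a b : ℝ) : Submodule ℝ (ℝ → Fin d → ℝ) where
  carrier := {f | ContDiffOn ℝ ∞ f (Set.Icc a b) ∧ (∀ t ∉ Set.Icc a b, f t = 0) ∧
    f a = 0 ∧ f b = 0}
  add_mem' := by
    rintro f g ⟨hf, hf', hfa, hfb⟩ ⟨hg, hg', hga, hgb⟩
    exact ⟨hf.add hg, fun t ht => by simp [hf' t ht, hg' t ht], by simp [hfa, hga],
      by simp [hfb, hgb]⟩
  zero_mem' := ⟨contDiffOn_const, fun _ _ => rfl, rfl, rfl⟩
  smul_mem' := by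
    rintro c f ⟨hf, hf', hfa, hfb⟩
    exact ⟨hf.const_smul c, fun t ht => by simp [hf' t ht], by simp [hfa], by simp [hfb]⟩

/-- The de Rham differential on `[a, b]`. -/
def dInterval (d : ℕ) (a b : ℝ) (f : Form0 d a b) : Form1 d a b :=
  ⟨fun t => derivWithin f.1 (Set.Icc a b) t, by
    refine ⟨?_, fun t ht => derivWithin_zero_of_notMem_closure (by simpa using ht)⟩
    rcases lt_or_ge a b with h | h
    · exact f.2.1.derivWithin (uniqueDiffOn_Icc h) (by simp)
    · intro t ht
      have hs : Set.Icc a b ⊆ {t} := fun s hs => by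
        have h1 := hs.1; have h2 := hs.2; have h3 := ht.1; have h4 := ht.2
        simp only [Set.mem_singleton_iff]; linarith
      exact (contDiffWithinAt_singleton).mono hs⟩

/-- The even fields: the coefficient `e` of the `1`-form component of the boundary field `𝔼`, the
coordinates `z` of the residual field `z · 1` (class `1 ∈ H⁰(D)`), and the point `x ∈ ℝᵈ` of the
target. -/
abbrev EvenFields (d : ℕ) (a b : ℝ) := Form1 d a b × (Fin d → ℝ) × (Fin d → ℝ)

/-- The odd fields: the `0`-form component of the boundary field `𝔼`, the coordinates `z†` of the
residual field `z† · μ` (class `[μ] ∈ H²(D, ∂D)`), and tangent vectors of the target, on which the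
odd coordinates are the `1`-forms `dxⁱ`. -/
abbrev OddFields (d : ℕ) (a b : ℝ) := Form0 d a b × (Fin d → ℝ) × (Fin d → ℝ)

/-! ## The effective action, the state and the operators

The boundary field is `𝔼ᵢ = Eᵢ + dt eᵢ`, with `Eᵢ` odd, `eᵢ` even, and `dt` anticommuting with the
odd fields; integration over the interval picks the coefficient of `dt`. -/

section Theory

variable {d : ℕ} {a b : ℝ}

/-- The odd coordinate `z†ᵢ`. -/
def zDagger (i : Fin d) : EvenFields d a b → OddFields d a b → ℂ := fun _ ξ => (ξ.2.1 i : ℝ)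

/-- The odd coordinate `dxⁱ`. -/
def dxCoord (i : Fin d) : EvenFields d a b → OddFields d a b → ℂ := fun _ ξ => (ξ.2.2 i : ℝ)

/-- `½ αⁱʲ ∫_{C₂(∂₂M)} π₁^*𝔼ᵢ ∧ ζ̂ ∧ π₂^*𝔼ⱼ`. -/
def actionPert (α : Matrix (Fin d) (Fin d) ℝ) (ζ : ℂ × ℂ → (ℂ × ℂ →L[ℝ] ℝ)) :
    Module.End ℂ (SFun (EvenFields d a b) (OddFields d a b)) :=
  mulEven fun p =>
    ((1 / 2 * ∑ i, ∑ j, α i j *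
      ∫ s in a..b, ∫ t in a..b, p.1.1 s i * zetaHat ζ s t * p.1.1 t j : ℝ) : ℂ)

/-- `∫_{∂₂M} zⁱ 𝔼ᵢ + z†ᵢ dxⁱ`. -/
def actionFree : Module.End ℂ (SFun (EvenFields d a b) (OddFields d a b)) :=
  mulEven (fun p => ((∑ i, ∫ t in a..b, p.2.1 i * p.1.1 t i : ℝ) : ℂ)) +
    ∑ i, mulOdd (zDagger i) * mulOdd (dxCoord i)

/-- `αⁱʲ ∫_{∂₂M} z†ᵢ 𝔼ⱼ ∧ τ`; here `z†ᵢ Eⱼ ∧ dt τ = dt z†ᵢ Eⱼ τ`. -/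
def actionResidual (α : Matrix (Fin d) (Fin d) ℝ) (m : ℂ → ℝ) (ζ : ℂ × ℂ → (ℂ × ℂ →L[ℝ] ℝ)) :
    Module.End ℂ (SFun (EvenFields d a b) (OddFields d a b)) :=
  ∑ i, ∑ j, (α i j : ℂ) • (mulOdd (zDagger i) *
    mulOdd fun _ ξ => ((∫ t in a..b, ξ.1.1 t j * tau m ζ t : ℝ) : ℂ))

/-- The exponent `(i/ħ)` times the effective action. -/
def stateExponent (α : Matrix (Fin d) (Fin d) ℝ) (m : ℂ → ℝ) (ζ : ℂ × ℂ → (ℂ × ℂ →L[ℝ] ℝ))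
    (ħ : ℂ) : Module.End ℂ (SFun (EvenFields d a b) (OddFields d a b)) :=
  (Complex.I / ħ) • (actionPert α ζ + actionFree + actionResidual α m ζ)

/-- The state for `L₁` in the `δ/δ𝕏`-polarization (the torsion factor is `1` in the basis `1`, `μ`
of the cohomology). -/
def state (a b : ℝ) (α : Matrix (Fin d) (Fin d) ℝ) (m : ℂ → ℝ) (ζ : ℂ × ℂ → (ℂ × ℂ →L[ℝ] ℝ))
    (ħ : ℂ) : SFun (EvenFields d a b) (OddFields d a b) :=
  expSF (stateExponent α m ζ ħ)

/-- The de Rham differential `dxⁱ ∂/∂xⁱ` of the target. -/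
def dTarget (ψ : SFun (EvenFields d a b) (OddFields d a b)) :
    SFun (EvenFields d a b) (OddFields d a b) :=
  oddField (fun ξ => (0, 0, ξ.2.2)) ψ

/-- The BV Laplacian `∑ᵢ ∂/∂zⁱ ∂/∂z†ᵢ`. -/
def bvLaplacian (ψ : SFun (EvenFields d a b) (OddFields d a b)) :
    SFun (EvenFields d a b) (OddFields d a b) :=
  ∑ i, evenDeriv (0, Pi.single i 1, 0) (oddDeriv (0, Pi.single i 1, 0) ψ)

/-- `∫_{∂₂M} d𝔼ᵢ δ/δ𝔼ᵢ`: the odd derivation, anticommuting with `dt`, that maps `𝔼ᵢ` to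
`d𝔼ᵢ = dt ∂ₜEᵢ`; hence it maps `eᵢ` to `-∂ₜEᵢ` and `Eᵢ` to `0`. -/
def boundaryDiff (ψ : SFun (EvenFields d a b) (OddFields d a b)) :
    SFun (EvenFields d a b) (OddFields d a b) :=
  oddField (fun ξ => (-dInterval d a b ξ.1, 0, 0)) ψ

/-- Multiplication by `∫_{∂₂M} 𝔼ᵢ ∧ dxⁱ`. -/
def mulEdx : Module.End ℂ (SFun (EvenFields d a b) (OddFields d a b)) :=
  mulOdd fun p ξ => ((∑ i, ∫ t in a..b, p.1.1 t i * ξ.2.2 i : ℝ) : ℂ)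

/-- Multiplication by `½ αⁱʲ ∫_{∂₂M} 𝔼ᵢ ∧ 𝔼ⱼ`; here `(Eᵢ + dt eᵢ)(Eⱼ + dt eⱼ)` has `dt`-part
`dt (eᵢ Eⱼ - Eᵢ eⱼ)`. -/
def mulEE (α : Matrix (Fin d) (Fin d) ℝ) :
    Module.End ℂ (SFun (EvenFields d a b) (OddFields d a b)) :=
  mulOdd fun p ξ =>
    ((1 / 2 * ∑ i, ∑ j, α i j *
      ∫ t in a..b, (p.1.1 t i * ξ.1.1 t j - ξ.1.1 t i * p.1.1 t j) : ℝ) : ℂ)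

/-- Multiplication by the boundary term
`-½ αⁱʲ (∫_{C₂} π₁^*𝔼ᵢ ∧ π₁^*τ ∧ π₂^*𝔼ⱼ - ∫_{C₂} π₁^*𝔼ᵢ ∧ π₂^*τ ∧ π₂^*𝔼ⱼ)`; here
`Eᵢ(s) ds τ(s) dt eⱼ(t) = ds dt Eᵢ(s) τ(s) eⱼ(t)` and
`ds eᵢ(s) dt τ(t) Eⱼ(t) = ds dt eᵢ(s) τ(t) Eⱼ(t)`. -/
def mulBoundaryTerm (α : Matrix (Fin d) (Fin d) ℝ) (m : ℂ → ℝ)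
    (ζ : ℂ × ℂ → (ℂ × ℂ →L[ℝ] ℝ)) :
    Module.End ℂ (SFun (EvenFields d a b) (OddFields d a b)) :=
  mulOdd fun p ξ =>
    ((-(1 / 2) * ∑ i, ∑ j, α i j *
      ((∫ s in a..b, ∫ t in a..b, ξ.1.1 s i * tau m ζ s * p.1.1 t j) -
        ∫ s in a..b, ∫ t in a..b, p.1.1 s i * tau m ζ t * ξ.1.1 t j) : ℝ) : ℂ)

/-- The boundary BFV operator
`Ω⁽¹⁾ = ∫_{∂₂M} (iħ d𝔼ᵢ δ/δ𝔼ᵢ + 𝔼ᵢ ∧ dxⁱ + ½ αⁱʲ 𝔼ᵢ ∧ 𝔼ⱼ)`. -/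
def bfvOperator (α : Matrix (Fin d) (Fin d) ℝ) (ħ : ℂ)
    (ψ : SFun (EvenFields d a b) (OddFields d a b)) :
    SFun (EvenFields d a b) (OddFields d a b) :=
  (Complex.I * ħ) • boundaryDiff ψ + mulEdx ψ + mulEE α ψ

/-- The quantum Grothendieck connection `d + iħ Δ + (i/ħ) Ω⁽¹⁾`. -/
def quantumGrothendieck (α : Matrix (Fin d) (Fin d) ℝ) (ħ : ℂ)
    (ψ : SFun (EvenFields d a b) (OddFields d a b)) :
    SFun (EvenFields d a b) (OddFields d a b) :=
  dTarget ψ + (Complex.I * ħ) • bvLaplacian ψ + (Complex.I / ħ) • bfvOperator α ħ ψ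

end Theory

end PSMDisk

end

open scoped ContDiff

noncomputable section

namespace PSMDisk

/-! ### Superalgebra: odd multiplications and odd derivatives -/

section SuperAlgebra

variable {V₀ V₁ : Type*}

/-! Everything rests on an explicit formula for the boundary function: for `t < s < t + 2π`, `ζ̂(s,
t) = ∫ₜˢ τ - 1/2` (`zetaHat_eq_of_lt`). With `F` a primitive of `τ`, the kernel on `[a, b]` is
therefore `F(s) - F(t) - ½ sgn(s - t)`. The smooth part gives `dζ̂ = π₁^*τ - π₂^*τ`; the unit jump
across the diagonal is what produces the term `½ αⁱʲ ∫ 𝔼ᵢ ∧ 𝔼ⱼ` of the master equation.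

To get the derivative in `s`, the mixed component of `dζ = -π₁^*μ` turns `∂ₛ ζ₁₂` into the
`u`-differential of the component `v` of `ζ` along the boundary vertex. Stokes in `u` together with
`dζ₁₃ = -μ` leaves `τ(s)` and a boundary contribution. Since `ζ` has poles on the circle, Stokes is
applied after multiplication by a cutoff of width `ε` (`integral_curl`). The differential of the
cutoff is radial and of size `1/ε`, so it meets only the tangential component of `ζ₁₃`, which
vanishes on the circle, as does `v`. When the two boundary points are apart, one of the two factors
is `O(1 - |u|)`. This absorbs `1/ε`, and what remains is the mass of `1/|u - v|` in a thin annulus,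
which tends to zero uniformly in `v` by rotation invariance (`exists_abs_cutError_le`).

The constant `1/2` comes from `∮ τ = 1`: shrinking the loop of the boundary vertex while `u` starts
to circle shows that `ζ(u, ·)` has circulation `1` around every interior `u` (`integral_vForm`), and
`μ` has total mass `1`. Antisymmetry and periodicity of `ζ̂` then fix the constant.

On the algebraic side, the action is a quadratic form `Q` in the even fields plus `∑ z†ᵢ κᵢ` with
`κᵢ = dxⁱ + αⁱʲ ∫ Eⱼ τ`. Hence the state is `exp((i/ħ) Q)` times an odd factor independent of the
even fields (`state_eq`). Even derivatives multiply by `(i/ħ)(Q(p, η) + Q(η, p))` and `∂/∂z†ᵢ`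
multiplies by `(i/ħ) κᵢ`. For `η = -dE`, integration by parts against the explicit kernel yields the
`𝔼𝔼` term and `B` (`actionForm_left_form`). The Laplacian yields `-∑ κᵢ ∫ eᵢ`, in which antisymmetry
of `α` recognises `-∫ 𝔼ᵢ dxⁱ - B` (`sum_totalIntegral_mul_oddCoeff`). Nothing depends on `x`, so `d`
contributes zero and the sum vanishes. -/

theorem mulEven_apply (f : V₀ → ℂ) (ψ : SFun V₀ V₁) (k : ℕ) (p : V₀) (ξ : Fin k → V₁) :
    mulEven f ψ k p ξ = f p * ψ k p ξ := rfl

theorem mulOdd_apply_zero (l : V₀ → V₁ → ℂ) (ψ : SFun V₀ V₁) (p : V₀) (ξ : Fin 0 → V₁) :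
    mulOdd l ψ 0 p ξ = 0 := rfl

theorem mulOdd_apply_succ (l : V₀ → V₁ → ℂ) (ψ : SFun V₀ V₁) (k : ℕ) (p : V₀)
    (ξ : Fin (k + 1) → V₁) :
    mulOdd l ψ (k + 1) p ξ =
      ∑ j : Fin (k + 1), (-1 : ℂ) ^ (j : ℕ) * l p (ξ j) * ψ k p (j.removeNth ξ) := rfl

theorem mulOdd_add (l l' : V₀ → V₁ → ℂ) : mulOdd (l + l') = mulOdd l + mulOdd l' := by
  ext ψ k p ξ
  cases k with
  | zero => simp [mulOdd_apply_zero]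
  | succ k =>
    simp only [mulOdd_apply_succ, LinearMap.add_apply, Pi.add_apply, ← Finset.sum_add_distrib]
    exact Finset.sum_congr rfl fun j _ => by ring

theorem mulOdd_smul (c : ℂ) (l : V₀ → V₁ → ℂ) : mulOdd (c • l) = c • mulOdd l := by
  ext ψ k p ξ
  cases k with
  | zero => simp [mulOdd_apply_zero]
  | succ k =>
    simp only [mulOdd_apply_succ, LinearMap.smul_apply, Pi.smul_apply, smul_eq_mul,
      Finset.mul_sum]
    exact Finset.sum_congr rfl fun j _ => by ring

theorem mulOdd_sum {ι : Type*} (s : Finset ι) (l : ι → V₀ → V₁ → ℂ) :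
    mulOdd (∑ i ∈ s, l i) = ∑ i ∈ s, mulOdd (l i) := by
  classical
  induction s using Finset.induction_on with
  | empty => simpa using mulOdd_smul (0 : ℂ) (0 : V₀ → V₁ → ℂ)
  | insert i s hi ih => rw [Finset.sum_insert hi, Finset.sum_insert hi, mulOdd_add, ih]

theorem mulEven_commute_mulOdd (f : V₀ → ℂ) (l : V₀ → V₁ → ℂ) :
    Commute (mulEven f) (mulOdd l) := by
  ext ψ k p ξ
  cases k with
  | zero => simp [mulEven_apply, mulOdd_apply_zero]
  | succ k =>
    simp only [Module.End.mul_apply, mulEven_apply, mulOdd_apply_succ, Finset.mul_sum]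
    exact Finset.sum_congr rfl fun j _ => by ring

/-- The term `j = 0` feeds `c` to `l`; in every other term `c` remains an argument of `ψ`, and the
shift of the index by one gives the sign. So the odd derivative is an antiderivation. -/
theorem oddDeriv_mulOdd (c : V₁) (l : V₀ → V₁ → ℂ) (ψ : SFun V₀ V₁) :
    oddDeriv c (mulOdd l ψ) = mulEven (fun p => l p c) ψ - mulOdd l (oddDeriv c ψ) := by
  funext k p ξ
  simp only [oddDeriv, mulOdd_apply_succ, Fin.sum_univ_succ, Pi.sub_apply, mulEven_apply]
  cases k with
  | zero =>
    have : Fin.removeNth 0 (Fin.cons c ξ : Fin 1 → V₁) = ξ := Subsingleton.elim _ _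
    simp [mulOdd_apply_zero, this]
  | succ k =>
    have h0 : Fin.removeNth 0 (Fin.cons c ξ : Fin (k + 2) → V₁) = ξ := by
      funext i; simp [Fin.removeNth]
    simp only [h0, Fin.val_zero, pow_zero, one_mul, Fin.cons_zero, Fin.val_succ, Fin.cons_succ,
      mulOdd_apply_succ, sub_eq_add_neg, ← Finset.sum_neg_distrib]
    congr 1
    refine Finset.sum_congr rfl fun j _ => ?_
    have : j.succ.removeNth (Fin.cons c ξ : Fin (k + 2) → V₁) = Fin.cons c (j.removeNth ξ) :=
      Fin.cons_comp_succ_succAbove ..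
    rw [this]
    simp only [oddDeriv]
    ring

theorem oddDeriv_mulEven (c : V₁) (f : V₀ → ℂ) (ψ : SFun V₀ V₁) :
    oddDeriv c (mulEven f ψ) = mulEven f (oddDeriv c ψ) := rfl

/-- A component of positive degree is recovered from the derivative in the direction of its first
odd argument. By the antiderivation rule the derivative of the anticommutator is the anticommutator
applied to the derivative of `ψ`, since the cross terms cancel; this allows induction on the degree,
for families that need not be alternating. -/
theorem mulOdd_anticommute (l l' : V₀ → V₁ → ℂ) (ψ : SFun V₀ V₁) :
    mulOdd l (mulOdd l' ψ) = -mulOdd l' (mulOdd l ψ) := by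
  rw [eq_neg_iff_add_eq_zero]
  funext k
  induction k generalizing ψ with
  | zero => funext p ξ; simp [mulOdd_apply_zero]
  | succ k ih =>
    funext p ξ
    have key : oddDeriv (ξ 0) (mulOdd l (mulOdd l' ψ) + mulOdd l' (mulOdd l ψ)) =
        mulOdd l (mulOdd l' (oddDeriv (ξ 0) ψ)) + mulOdd l' (mulOdd l (oddDeriv (ξ 0) ψ)) := by
      have hadd : ∀ φ χ : SFun V₀ V₁, oddDeriv (ξ 0) (φ + χ) =
        oddDeriv (ξ 0) φ + oddDeriv (ξ 0) χ := fun _ _ => rfl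
      have hc : ∀ (f : V₀ → ℂ) (l : V₀ → V₁ → ℂ) (φ : SFun V₀ V₁),
        mulEven f (mulOdd l φ) = mulOdd l (mulEven f φ) := fun f l φ =>
          LinearMap.congr_fun (mulEven_commute_mulOdd f l) φ
      simp only [hadd, oddDeriv_mulOdd, map_sub, hc]
      abel
    have := congrFun (congrFun (congrFun key k) p) (Fin.tail ξ)
    rw [ih] at this
    simpa [oddDeriv, Fin.cons_self_tail] using this

end SuperAlgebra

/-! ### Exponentials of even superfunctions -/

section SuperExp

variable {V₀ V₁ : Type*}

theorem mulEven_pow (f : V₀ → ℂ) (n : ℕ) :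
    (mulEven f ^ n : Module.End ℂ (SFun V₀ V₁)) = mulEven (f ^ n) := by
  induction n with
  | zero => ext ψ k p ξ; simp [mulEven_apply]
  | succ n ih =>
    ext ψ k p ξ
    rw [pow_succ', ih]
    change f p * (f p ^ n * ψ k p ξ) = f p ^ (n + 1) * ψ k p ξ
    ring

/-- The operator `N` raises the degree in the odd fields, so that `exp N` is a finite sum in each
degree. -/
def RaisesDegree (N : Module.End ℂ (SFun V₀ V₁)) : Prop :=
  ∀ j k : ℕ, k < j → (N ^ j) oneSF k = 0

theorem expTerm_apply (N : Module.End ℂ (SFun V₀ V₁)) (n k : ℕ) (p : V₀) (ξ : Fin k → V₁) :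
    expTerm N n k p ξ = (n.factorial : ℂ)⁻¹ * (N ^ n) oneSF k p ξ := rfl

theorem RaisesDegree.expTerm_eq_zero {N : Module.End ℂ (SFun V₀ V₁)} (hN : RaisesDegree N)
    {n k : ℕ} (h : k < n) (p : V₀) (ξ : Fin k → V₁) : expTerm N n k p ξ = 0 := by
  rw [expTerm_apply, hN n k h]
  simp

theorem RaisesDegree.expSF_eq_sum {N : Module.End ℂ (SFun V₀ V₁)} (hN : RaisesDegree N)
    {n k : ℕ} (h : k < n) : expSF N k = (∑ j ∈ Finset.range n, expTerm N j) k := by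
  funext p ξ
  simp only [Finset.sum_apply]
  exact tsum_eq_sum fun j hj => hN.expTerm_eq_zero
    (h.trans_le (by simpa using hj)) p ξ

/-- Since the two summands commute, the binomial theorem makes the exponential series the Cauchy
product of the numerical series of `exp (f p)` and a series that is finite in each odd degree; both
converge absolutely. -/
theorem hasSum_expTerm_mulEven_add {f : V₀ → ℂ} {N : Module.End ℂ (SFun V₀ V₁)}
    (hN : RaisesDegree N) (hc : Commute (mulEven f) N) (k : ℕ) (p : V₀) (ξ : Fin k → V₁) :
    HasSum (fun n => expTerm (mulEven f + N) n k p ξ) (Complex.exp (f p) * expSF N k p ξ) := by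
  have h1 : Summable fun n : ℕ => ‖(n.factorial : ℂ)⁻¹ * f p ^ n‖ := by
    simpa [div_eq_inv_mul] using Real.summable_pow_div_factorial ‖f p‖
  have h2 : Summable fun n : ℕ => ‖expTerm N n k p ξ‖ :=
    summable_of_ne_finset_zero (s := Finset.range (k + 1)) fun n hn => by
      rw [hN.expTerm_eq_zero (by simpa using hn), norm_zero]
  have h3 : ∑' n : ℕ, (n.factorial : ℂ)⁻¹ * f p ^ n = Complex.exp (f p) := by
    rw [Complex.exp_eq_exp_ℂ, NormedSpace.exp_eq_tsum_div]
    simp [div_eq_inv_mul]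
  have h4 : ∀ n, expTerm (mulEven f + N) n k p ξ =
      ∑ q ∈ Finset.HasAntidiagonal.antidiagonal n, (q.1.factorial : ℂ)⁻¹ * f p ^ q.1 * expTerm N q.2 k p ξ := by
    intro n
    rw [expTerm_apply, hc.add_pow', LinearMap.sum_apply]
    simp only [Finset.sum_apply, Finset.mul_sum]
    refine Finset.sum_congr rfl fun q hq => ?_
    obtain rfl := Finset.HasAntidiagonal.mem_antidiagonal.1 hq
    have hq' := Nat.add_choose_mul_factorial_mul_factorial q.1 q.2
    rw [← Nat.choose_symm_add] at hq'
    rw [mulEven_pow, LinearMap.smul_apply, ← Nat.cast_smul_eq_nsmul ℂ]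
    simp only [Pi.smul_apply, smul_eq_mul, Module.End.mul_apply, mulEven_apply, Pi.pow_apply,
      expTerm_apply]
    rw [← hq']
    have ha : (q.1.factorial : ℂ) ≠ 0 := by exact_mod_cast q.1.factorial_ne_zero
    have hb : (q.2.factorial : ℂ) ≠ 0 := by exact_mod_cast q.2.factorial_ne_zero
    have hd : ((q.1 + q.2).choose q.1 : ℂ) ≠ 0 := by
      exact_mod_cast (Nat.choose_pos (Nat.le_add_right _ _)).ne'
    push_cast
    field_simp
  simp only [h4]
  rw [← h3, expSF, tsum_mul_tsum_eq_tsum_sum_antidiagonal_of_summable_norm h1 h2]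
  exact (summable_norm_sum_mul_antidiagonal_of_summable_norm h1 h2).of_norm.hasSum

theorem expSF_mulEven_add {f : V₀ → ℂ} {N : Module.End ℂ (SFun V₀ V₁)}
    (hN : RaisesDegree N) (hc : Commute (mulEven f) N) :
    expSF (mulEven f + N) = mulEven (fun p => Complex.exp (f p)) (expSF N) := by
  funext k p ξ
  exact (hasSum_expTerm_mulEven_add hN hc k p ξ).tsum_eq

theorem mulOdd_apply_eq_zero {n : ℕ} {φ : SFun V₀ V₁} (h : ∀ k < n, φ k = 0)
    (l : V₀ → V₁ → ℂ) : ∀ k < n + 1, mulOdd l φ k = 0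
  | 0, _ => rfl
  | k + 1, hk => by
    funext p ξ
    simp [mulOdd_apply_succ, h k (by omega)]

variable {ι : Type*} [Fintype ι]

/-- Each factor raises the odd degree by two, so the `j`-th power starts in degree `2 * j`, more
than is needed. -/
theorem raisesDegree_quadratic (l κ : ι → V₀ → V₁ → ℂ) :
    RaisesDegree (∑ i, mulOdd (l i) * mulOdd (κ i)) := by
  have key : ∀ j k : ℕ, k < 2 * j →
      ((∑ i, mulOdd (l i) * mulOdd (κ i) : Module.End ℂ (SFun V₀ V₁)) ^ j) oneSF k = 0 := by
    intro j
    induction j with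
    | zero => intro k hk; omega
    | succ j ih =>
      intro k hk
      rw [pow_succ', Module.End.mul_apply, LinearMap.sum_apply, Finset.sum_apply]
      exact Finset.sum_eq_zero fun i _ =>
        mulOdd_apply_eq_zero (mulOdd_apply_eq_zero ih (κ i)) (l i) k (by omega)
  exact fun j k h => key j k (by omega)

theorem mulEven_commute_quadratic (f : V₀ → ℂ) (l κ : ι → V₀ → V₁ → ℂ) :
    Commute (mulEven f) (∑ i, mulOdd (l i) * mulOdd (κ i)) :=
  Commute.sum_right _ _ _ fun i _ =>
    (mulEven_commute_mulOdd f (l i)).mul_right (mulEven_commute_mulOdd f (κ i))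

/-- Moving an odd factor past a product of two odd factors costs two signs. -/
theorem quadratic_commute_mulOdd (l κ : ι → V₀ → V₁ → ℂ) (l' : V₀ → V₁ → ℂ) :
    Commute (∑ i, mulOdd (l i) * mulOdd (κ i)) (mulOdd l') := by
  refine Commute.sum_left _ _ _ fun i _ => LinearMap.ext fun ψ => ?_
  simp only [Module.End.mul_apply]
  rw [mulOdd_anticommute (κ i) l', map_neg, mulOdd_anticommute (l i) l', neg_neg]

theorem oddDeriv_sum {ι' : Type*} (s : Finset ι') (c : V₁) (ψ : ι' → SFun V₀ V₁) :
    oddDeriv c (∑ i ∈ s, ψ i) = ∑ i ∈ s, oddDeriv c (ψ i) := by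
  funext k p ξ
  simp [oddDeriv]

theorem oddDeriv_oneSF (c : V₁) : oddDeriv c (oneSF : SFun V₀ V₁) = 0 := rfl

variable [DecidableEq ι]

theorem oddDeriv_quadratic {l κ : ι → V₀ → V₁ → ℂ} {c : V₁} {i₀ : ι}
    (hl : ∀ i p, l i p c = if i = i₀ then 1 else 0) (hκ : ∀ i p, κ i p c = 0)
    (ψ : SFun V₀ V₁) :
    oddDeriv c ((∑ i, mulOdd (l i) * mulOdd (κ i)) ψ) =
      mulOdd (κ i₀) ψ + (∑ i, mulOdd (l i) * mulOdd (κ i)) (oddDeriv c ψ) := by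
  rw [LinearMap.sum_apply, oddDeriv_sum]
  have h : ∀ i, oddDeriv c ((mulOdd (l i) * mulOdd (κ i)) ψ) =
      (if i = i₀ then mulOdd (κ i₀) ψ else 0) +
        (mulOdd (l i) * mulOdd (κ i)) (oddDeriv c ψ) := by
    intro i
    have h0 : mulEven (fun p => κ i p c) ψ = 0 := by
      funext k p ξ; simp [mulEven_apply, hκ]
    have h1 : mulEven (fun p => l i p c) (mulOdd (κ i) ψ) =
        if i = i₀ then mulOdd (κ i₀) ψ else 0 := by
      funext k p ξ
      by_cases hi : i = i₀
      · subst hi; simp [mulEven_apply, hl]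
      · simp [mulEven_apply, hl, hi]
    change oddDeriv c (mulOdd (l i) (mulOdd (κ i) ψ)) = _
    rw [oddDeriv_mulOdd, oddDeriv_mulOdd, h0, h1, zero_sub, map_neg, sub_neg_eq_add]
    rfl
  rw [Finset.sum_congr rfl fun i _ => h i, Finset.sum_add_distrib, Finset.sum_ite_eq',
    if_pos (Finset.mem_univ _), LinearMap.sum_apply]

/-- The derivative of the quadratic exponent `N` in the direction `c` is `κ i₀`, which commutes with
`N`; hence the usual rule `∂ exp N = (∂N) exp N` holds term by term. This is how `∂/∂z†` acts on the
state. -/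
theorem oddDeriv_expSF_quadratic {l κ : ι → V₀ → V₁ → ℂ} {c : V₁} {i₀ : ι}
    (hl : ∀ i p, l i p c = if i = i₀ then 1 else 0) (hκ : ∀ i p, κ i p c = 0) :
    oddDeriv c (expSF (∑ i, mulOdd (l i) * mulOdd (κ i)) : SFun V₀ V₁) =
      mulOdd (κ i₀) (expSF (∑ i, mulOdd (l i) * mulOdd (κ i))) := by
  set N : Module.End ℂ (SFun V₀ V₁) := ∑ i, mulOdd (l i) * mulOdd (κ i) with hNdef
  have hN : RaisesDegree N := raisesDegree_quadratic l κ
  have hpow : ∀ j : ℕ, oddDeriv c ((N ^ (j + 1)) oneSF) =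
      ((j + 1 : ℕ) : ℂ) • mulOdd (κ i₀) ((N ^ j) oneSF) := by
    intro j
    induction j with
    | zero =>
      rw [pow_succ', Module.End.mul_apply, hNdef, oddDeriv_quadratic hl hκ]
      simp [oddDeriv_oneSF]
    | succ j ih =>
      have hcomm := LinearMap.congr_fun (quadratic_commute_mulOdd l κ (κ i₀)) ((N ^ j) oneSF)
      rw [← hNdef] at hcomm
      simp only [Module.End.mul_apply] at hcomm
      rw [pow_succ' N (j + 1), Module.End.mul_apply, oddDeriv_quadratic hl hκ, ih, map_smul,
        ← hNdef, hcomm, pow_succ' N j, Module.End.mul_apply]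
      push_cast
      module
  have hterm : ∀ j : ℕ, oddDeriv c (expTerm N (j + 1)) = mulOdd (κ i₀) (expTerm N j) := by
    intro j
    have : oddDeriv c (expTerm N (j + 1)) =
        (((j + 1).factorial : ℕ) : ℂ)⁻¹ • oddDeriv c ((N ^ (j + 1)) oneSF) := rfl
    rw [this, hpow, expTerm, map_smul, smul_smul, Nat.factorial_succ]
    congr 1
    have : ((j + 1 : ℕ) : ℂ) ≠ 0 := by exact_mod_cast j.succ_ne_zero
    push_cast at this ⊢
    field_simp
  funext k
  -- The derivative reads the exponential in degree `k + 1`, hence `k + 2` terms; the multiplication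
  -- reads it in degree at most `k - 1`, for which `k + 1` terms suffice. The zeroth term has
  -- derivative zero, so the two sums match after a shift.
  have h1 : oddDeriv c (expSF N) k = oddDeriv c (∑ j ∈ Finset.range (k + 2), expTerm N j) k := by
    funext p ξ
    simp only [oddDeriv]
    rw [hN.expSF_eq_sum (Nat.lt_succ_self (k + 1))]
  have h2 : mulOdd (κ i₀) (expSF N) k =
      mulOdd (κ i₀) (∑ j ∈ Finset.range (k + 1), expTerm N j) k := by
    cases k with
    | zero => rfl
    | succ k =>
      funext p ξ
      simp only [mulOdd_apply_succ]
      rw [hN.expSF_eq_sum (show k < k + 1 + 1 by omega)]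
  rw [h1, h2, oddDeriv_sum, Finset.sum_range_succ', map_sum]
  have h3 : oddDeriv c (expTerm N 0) = 0 := by
    funext k p ξ
    simp [expTerm, oddDeriv, oneSF]
  rw [h3, add_zero]
  exact congrFun (Finset.sum_congr rfl fun j _ => hterm j) k

end SuperExp

/-! ### Alternating families independent of the even fields -/

section Alternating

variable {V₀ V₁ : Type*} [AddCommGroup V₁] [Module ℝ V₁]

/-- `ψ` is alternating multilinear in the odd fields and independent of the even ones. -/
def IsConstAlternating (ψ : SFun V₀ V₁) : Prop :=
  ∀ k : ℕ, ∃ A : V₁ [⋀^Fin k]→ₗ[ℝ] ℂ, ∀ p ξ, ψ k p ξ = A ξ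

theorem isConstAlternating_oneSF : IsConstAlternating (oneSF : SFun V₀ V₁)
  | 0 => ⟨AlternatingMap.constOfIsEmpty ℝ V₁ (Fin 0) 1, fun _ _ => rfl⟩
  | _ + 1 => ⟨0, fun _ _ => rfl⟩

theorem IsConstAlternating.smul {ψ : SFun V₀ V₁} (h : IsConstAlternating ψ) (c : ℂ) :
    IsConstAlternating (c • ψ) := fun k => by
  obtain ⟨A, hA⟩ := h k
  exact ⟨c • A, fun p ξ => by simp [hA]⟩

theorem IsConstAlternating.sum {ι : Type*} {s : Finset ι} {ψ : ι → SFun V₀ V₁}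
    (h : ∀ i ∈ s, IsConstAlternating (ψ i)) : IsConstAlternating (∑ i ∈ s, ψ i) := fun k => by
  classical
  choose! A hA using fun i hi => h i hi k
  refine ⟨∑ i ∈ s, A i, fun p ξ => ?_⟩
  rw [Finset.sum_apply, Finset.sum_apply, Finset.sum_apply, Finset.sum_congr rfl
    fun i hi => hA i hi p ξ]
  exact (map_sum (⟨⟨fun B : V₁ [⋀^Fin k]→ₗ[ℝ] ℂ => B ξ, rfl⟩, fun _ _ => rfl⟩ :
    (V₁ [⋀^Fin k]→ₗ[ℝ] ℂ) →+ ℂ) A s).symm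

/-- The sign conventions are those of alternatization: the product is the alternatization of `ξ ↦ l
ξ • A`. -/
theorem IsConstAlternating.mulOdd {ψ : SFun V₀ V₁} (h : IsConstAlternating ψ)
    (l : V₁ →ₗ[ℝ] ℂ) : IsConstAlternating (mulOdd (fun _ => l) ψ)
  | 0 => ⟨0, fun _ _ => rfl⟩
  | k + 1 => by
    obtain ⟨A, hA⟩ := h k
    refine ⟨AlternatingMap.alternatizeUncurryFin
      ((LinearMap.toSpanSingleton ℂ _ A).restrictScalars ℝ ∘ₗ l), fun p ξ => ?_⟩
    rw [AlternatingMap.alternatizeUncurryFin_apply, mulOdd_apply_succ]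
    refine Finset.sum_congr rfl fun j _ => ?_
    simp [hA, mul_assoc]

/-- In each degree the exponential is a finite sum of products of linear functionals. That it is
constant in the even fields is what lets even derivatives of the state act on the scalar factor
alone. -/
theorem isConstAlternating_expSF_quadratic {ι : Type*} [Fintype ι] (l κ : ι → V₁ →ₗ[ℝ] ℂ) :
    IsConstAlternating
      (expSF (∑ i, PSMDisk.mulOdd (fun _ => l i) * PSMDisk.mulOdd (fun _ => κ i)) :
        SFun V₀ V₁) := by
  intro k
  set N : Module.End ℂ (SFun V₀ V₁) :=
    ∑ i, PSMDisk.mulOdd (fun _ => l i) * PSMDisk.mulOdd (fun _ => κ i) with hNdef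
  have hN : RaisesDegree N := raisesDegree_quadratic _ _
  rw [hN.expSF_eq_sum (Nat.lt_succ_self k)]
  have hpow : ∀ j, IsConstAlternating ((N ^ j) oneSF) := by
    intro j
    induction j with
    | zero => exact isConstAlternating_oneSF
    | succ j ih =>
      rw [pow_succ', Module.End.mul_apply, hNdef, LinearMap.sum_apply]
      exact IsConstAlternating.sum fun i _ => (ih.mulOdd (κ i)).mulOdd (l i)
  exact IsConstAlternating.sum (fun j _ => (hpow j).smul _) k

end Alternating

open MeasureTheory Filter Topology Metric

/-! ### The singular kernel on the disk and thin annuli -/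

section Boundary

theorem norm_bdryPt (s : ℝ) : ‖bdryPt s‖ = 1 := by simp [bdryPt]

theorem hasDerivAt_bdryPt (s : ℝ) : HasDerivAt bdryPt (Complex.I * bdryPt s) s := by
  have := hasDerivAt_circleMap 0 1 s
  rwa [mul_comm] at this

theorem deriv_bdryPt (s : ℝ) : deriv bdryPt s = Complex.I * bdryPt s :=
  (hasDerivAt_bdryPt s).deriv

theorem continuous_bdryPt : Continuous bdryPt := continuous_circleMap 0 1

theorem bdryPt_periodic : Function.Periodic bdryPt (2 * Real.pi) := periodic_circleMap 0 1

theorem bdryPt_mem_disk (s : ℝ) : bdryPt s ∈ disk := by simp [disk, norm_bdryPt]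

theorem bdryPt_ne {s t : ℝ} (h : s ≠ t) (h' : |s - t| < 2 * Real.pi) : bdryPt s ≠ bdryPt t :=
  fun he => h (eq_of_circleMap_eq one_ne_zero h' he)

theorem ball_subset_disk : ball (0 : ℂ) 1 ⊆ disk := ball_subset_closedBall

theorem disk_ae_eq_ball : disk =ᵐ[volume] ball (0 : ℂ) 1 := by
  rw [disk, ← ball_union_sphere]
  refine union_ae_eq_left_of_ae_eq_empty ?_
  exact ae_eq_empty.2 (Measure.addHaar_sphere _ _ _)

theorem ne_bdryPt {u : ℂ} (hu : u ∈ ball (0 : ℂ) 1) (s : ℝ) : u ≠ bdryPt s := by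
  rintro rfl
  simp [norm_bdryPt] at hu

theorem mem_conf_bdryPt {u : ℂ} (hu : u ∈ ball (0 : ℂ) 1) (s : ℝ) : (u, bdryPt s) ∈ conf :=
  ⟨ball_subset_disk hu, bdryPt_mem_disk s, ne_bdryPt hu s⟩

theorem norm_sub_bdryPt_pos {u : ℂ} (hu : u ∈ ball (0 : ℂ) 1) (s : ℝ) : 0 < ‖u - bdryPt s‖ :=
  norm_pos_iff.2 (sub_ne_zero.2 (ne_bdryPt hu s))

theorem one_sub_norm_le (u : ℂ) (s : ℝ) : 1 - ‖u‖ ≤ ‖u - bdryPt s‖ := by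
  have := norm_sub_norm_le (bdryPt s) u
  rwa [norm_bdryPt, norm_sub_rev] at this

/-- The order `1` of the pole is less than the dimension `2`; the general pole follows by
translation. -/
theorem integrableOn_inv_norm_sub (v : ℂ) :
    IntegrableOn (fun u : ℂ => ‖u - v‖⁻¹) (ball 0 1) := by
  have h : LocallyIntegrable (fun u : ℂ => ‖u‖⁻¹) := by
    refine locallyIntegrable_of_norm_le_rpow (C := 1) (α := 1) (by simp) ?_ ?_ ?_
    · simp
    · exact Eventually.of_forall fun u => by rw [Real.rpow_neg_one]; simp
    · exact (measurable_norm.inv).aestronglyMeasurable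
  have h2 : IntegrableOn (fun u : ℂ => ‖u‖⁻¹) ((fun u => u - v) '' closedBall 0 1) :=
    h.integrableOn_isCompact ((isCompact_closedBall 0 1).image (by fun_prop))
  have h3 := (MeasurePreserving.integrableOn_image (measurePreserving_sub_right volume v)
    (MeasurableEquiv.subRight v).measurableEmbedding).1 h2
  exact h3.mono_set ball_subset_closedBall

/-- The part of the open unit disk that is close to the boundary. -/
def annulus (ε : ℝ) : Set ℂ := {u | ‖u‖ < 1 ∧ 1 - 2 * ε ≤ ‖u‖ ^ 2}

theorem measurableSet_annulus (ε : ℝ) : MeasurableSet (annulus ε) :=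
  (measurableSet_lt measurable_norm measurable_const).inter
    (measurableSet_le measurable_const (measurable_norm.pow_const 2))

theorem annulus_subset_ball (ε : ℝ) : annulus ε ⊆ ball 0 1 := fun u hu => by
  simpa using hu.1

/-- The integral of the singular kernel over the annulus, which is the same for all boundary
points. -/
def annulusMass (ε : ℝ) : ℝ := ∫ u in annulus ε, ‖u - bdryPt 0‖⁻¹

theorem measurePreserving_mul_bdryPt (s : ℝ) :
    MeasurePreserving (fun u : ℂ => bdryPt s * u) volume volume := by
  have h := (rotation ⟨bdryPt s, by simp [Submonoid.unitSphere, norm_bdryPt]⟩ :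
    ℂ ≃ₗᵢ[ℝ] ℂ).measurePreserving
  have he : ⇑(rotation ⟨bdryPt s, by simp [Submonoid.unitSphere, norm_bdryPt]⟩) =
      fun u : ℂ => bdryPt s * u := funext fun u => rotation_apply _ _
  rw [he] at h
  exact h

theorem measurableEmbedding_mul_bdryPt (s : ℝ) :
    MeasurableEmbedding (fun u : ℂ => bdryPt s * u) := by
  have h : bdryPt s ≠ 0 := by rw [← norm_ne_zero_iff, norm_bdryPt]; exact one_ne_zero
  exact (Homeomorph.mulLeft₀ _ h).measurableEmbedding

theorem norm_bdryPt_mul_sub (s : ℝ) (u : ℂ) :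
    ‖bdryPt s * u - bdryPt s‖ = ‖u - bdryPt 0‖ := by
  have : bdryPt s * u - bdryPt s = bdryPt s * (u - bdryPt 0) := by
    simp [bdryPt, circleMap, mul_sub]
  rw [this, norm_mul, norm_bdryPt, one_mul]

/-- Rotation by `bdryPt s` preserves area and carries the pole at `bdryPt 0` to the pole at `bdryPt
s`. All later estimates are uniform in the boundary point for this reason. -/
theorem setIntegral_inv_norm_sub_bdryPt (A : Set ℂ) (s : ℝ)
    (hA : (fun u => bdryPt s * u) ⁻¹' A = A) :
    ∫ u in A, ‖u - bdryPt s‖⁻¹ = ∫ u in A, ‖u - bdryPt 0‖⁻¹ := by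
  rw [← (measurePreserving_mul_bdryPt s).setIntegral_preimage_emb
    (measurableEmbedding_mul_bdryPt s), hA]
  simp only [norm_bdryPt_mul_sub]

theorem setIntegral_annulus (ε s : ℝ) :
    ∫ u in annulus ε, ‖u - bdryPt s‖⁻¹ = annulusMass ε :=
  setIntegral_inv_norm_sub_bdryPt _ s (by ext u; simp [annulus, norm_bdryPt])

theorem setIntegral_ball_inv_norm_sub (s : ℝ) :
    ∫ u in ball (0 : ℂ) 1, ‖u - bdryPt s‖⁻¹ = ∫ u in ball (0 : ℂ) 1, ‖u - bdryPt 0‖⁻¹ :=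
  setIntegral_inv_norm_sub_bdryPt _ s (by ext u; simp [norm_bdryPt])

/-- The widths of the annuli. -/
def width (n : ℕ) : ℝ := 1 / ((n : ℝ) + 1)

theorem width_pos (n : ℕ) : 0 < width n := Nat.one_div_pos_of_nat

theorem tendsto_width : Tendsto width atTop (𝓝 0) := tendsto_one_div_add_atTop_nhds_zero_nat

/-- The annuli decrease to the empty set, because the circle itself is excluded, and the kernel is
integrable. -/
theorem tendsto_annulusMass : Tendsto (fun n => annulusMass (width n)) atTop (𝓝 0) := by
  have h := Antitone.tendsto_setIntegral (μ := volume) (s := fun n => annulus (width n))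
    (f := fun u => ‖u - bdryPt 0‖⁻¹)
    (fun n => measurableSet_annulus _) (fun i j hij u hu => ⟨hu.1, ?_⟩)
    ((integrableOn_inv_norm_sub _).mono_set (annulus_subset_ball _))
  · have he : ⋂ n, annulus (width n) = ∅ := by
      refine Set.eq_empty_iff_forall_notMem.2 fun u hu => ?_
      rw [Set.mem_iInter] at hu
      have h1 : (1 : ℝ) ≤ ‖u‖ ^ 2 := by
        have : Tendsto (fun n => 1 - 2 * width n) atTop (𝓝 (1 - 2 * 0)) :=
          tendsto_const_nhds.sub (tendsto_width.const_mul 2)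
        simpa using le_of_tendsto' this fun n => (hu n).2
      have h2 := (hu 0).1
      nlinarith [norm_nonneg u]
    simpa only [he, setIntegral_empty] using! h
  · have : width j ≤ width i := one_div_le_one_div_of_le (by positivity) (by gcongr)
    linarith [hu.2]

end Boundary

/-! ### Smooth cutoffs and integration by parts in the open disk -/

section Cutoff

/-- A smooth function which is `1` away from the annulus of width `ε` and vanishes close to the
unit circle. -/
def cutoff (ε : ℝ) (u : ℂ) : ℝ := Real.smoothTransition ((1 - ‖u‖ ^ 2) / ε - 1)

theorem contDiff_cutoff (ε : ℝ) : ContDiff ℝ ∞ (cutoff ε) := by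
  have h : ContDiff ℝ ∞ fun u : ℂ => (1 - ‖u‖ ^ 2) / ε - 1 :=
    ((contDiff_const.sub (contDiff_norm_sq ℝ)).div_const _).sub contDiff_const
  exact Real.smoothTransition.contDiff.comp h

theorem continuous_cutoff (ε : ℝ) : Continuous (cutoff ε) := (contDiff_cutoff ε).continuous

theorem continuous_fderiv_cutoff (ε : ℝ) (e : ℂ) : Continuous fun u => fderiv ℝ (cutoff ε) u e :=
  ((contDiff_cutoff ε).continuous_fderiv (by simp)).clm_apply continuous_const

theorem cutoff_nonneg (ε : ℝ) (u : ℂ) : 0 ≤ cutoff ε u := Real.smoothTransition.nonneg _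

theorem cutoff_le_one (ε : ℝ) (u : ℂ) : cutoff ε u ≤ 1 := Real.smoothTransition.le_one _

variable {ε : ℝ}

theorem cutoff_eq_zero (hε : 0 < ε) {u : ℂ} (h : 1 - ε ≤ ‖u‖ ^ 2) : cutoff ε u = 0 :=
  Real.smoothTransition.zero_of_nonpos <| by
    rw [sub_nonpos, div_le_one hε]; linarith

theorem cutoff_eq_one (hε : 0 < ε) {u : ℂ} (h : ‖u‖ ^ 2 ≤ 1 - 2 * ε) : cutoff ε u = 1 :=
  Real.smoothTransition.one_of_one_le <| by
    rw [le_sub_iff_add_le, le_div_iff₀ hε]; linarith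

/-- The factor `inner ℝ u e` shows that the differential is radial, hence blind to tangential
directions; the price is a factor `1/ε`. -/
theorem fderiv_cutoff (ε : ℝ) (u e : ℂ) :
    fderiv ℝ (cutoff ε) u e =
      deriv Real.smoothTransition ((1 - ‖u‖ ^ 2) / ε - 1) * (-(2 * inner ℝ u e) / ε) := by
  have h1 : HasFDerivAt (fun u : ℂ => (1 - ‖u‖ ^ 2) / ε - 1)
      (ε⁻¹ • (-(2 • innerSL ℝ u : ℂ →L[ℝ] ℝ))) u := by
    have := ((hasStrictFDerivAt_norm_sq u).hasFDerivAt.const_sub 1).mul_const ε⁻¹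
    exact this.sub_const 1
  have h2 : HasDerivAt Real.smoothTransition
      (deriv Real.smoothTransition ((1 - ‖u‖ ^ 2) / ε - 1)) ((1 - ‖u‖ ^ 2) / ε - 1) :=
    ((Real.smoothTransition.contDiff (n := 1)).differentiable (by simp) _).hasDerivAt
  have h3 : HasFDerivAt (cutoff ε) _ u := h2.comp_hasFDerivAt u h1
  rw [h3.fderiv]
  simp
  ring

theorem deriv_smoothTransition_of_nonpos {x : ℝ} (hx : x ≤ 0) :
    deriv Real.smoothTransition x = 0 := by
  refine IsLocalMin.deriv_eq_zero (Eventually.of_forall fun y => ?_)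
  rw [Real.smoothTransition.zero_of_nonpos hx]
  exact Real.smoothTransition.nonneg y

theorem deriv_smoothTransition_of_one_le {x : ℝ} (hx : 1 ≤ x) :
    deriv Real.smoothTransition x = 0 := by
  refine IsLocalMax.deriv_eq_zero (Eventually.of_forall fun y => ?_)
  rw [Real.smoothTransition.one_of_one_le hx]
  exact Real.smoothTransition.le_one y

theorem exists_bound_deriv_smoothTransition :
    ∃ M : ℝ, 0 ≤ M ∧ ∀ x, |deriv Real.smoothTransition x| ≤ M := by
  obtain ⟨M, hM⟩ := (isCompact_Icc (a := (0 : ℝ)) (b := 1)).exists_bound_of_continuousOn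
    ((Real.smoothTransition.contDiff (n := 1)).continuous_deriv le_rfl).continuousOn
  have hM0 : 0 ≤ M := (norm_nonneg _).trans (hM 0 (by simp))
  refine ⟨M, hM0, fun x => ?_⟩
  rcases le_total x 0 with h | h
  · simpa [deriv_smoothTransition_of_nonpos h] using hM0
  rcases le_total 1 x with h' | h'
  · simpa [deriv_smoothTransition_of_one_le h'] using hM0
  · exact hM x ⟨h, h'⟩

theorem fderiv_cutoff_eq_zero_of_le (hε : 0 < ε) {u : ℂ} (h : 1 - ε ≤ ‖u‖ ^ 2) (e : ℂ) :
    fderiv ℝ (cutoff ε) u e = 0 := by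
  rw [fderiv_cutoff, deriv_smoothTransition_of_nonpos, zero_mul]
  rw [sub_nonpos, div_le_one hε]; linarith

theorem fderiv_cutoff_eq_zero_of_ge (hε : 0 < ε) {u : ℂ} (h : ‖u‖ ^ 2 ≤ 1 - 2 * ε) (e : ℂ) :
    fderiv ℝ (cutoff ε) u e = 0 := by
  rw [fderiv_cutoff, deriv_smoothTransition_of_one_le, zero_mul]
  rw [le_sub_iff_add_le, le_div_iff₀ hε]; linarith

/-- The extension by zero of a product of a function on the disk with a function that vanishes near
the boundary. -/
theorem contDiff_mul_of_vanish {n : WithTop ℕ∞} (hε : 0 < ε) {H G : ℂ → ℝ} (hH : ContDiff ℝ n H)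
    (hH0 : ∀ u : ℂ, 1 - ε ≤ ‖u‖ ^ 2 → H u = 0) (hG : ContDiffOn ℝ n G (ball 0 1)) :
    ContDiff ℝ n fun u => H u * G u := by
  rw [contDiff_iff_contDiffAt]
  intro u
  rcases lt_or_ge (1 - ε) (‖u‖ ^ 2) with h | h
  · have : (fun u => H u * G u) =ᶠ[𝓝 u] fun _ => 0 := by
      have ho : IsOpen {u : ℂ | 1 - ε < ‖u‖ ^ 2} :=
        isOpen_lt continuous_const (continuous_norm.pow 2)
      filter_upwards [ho.mem_nhds h] with w hw
      rw [hH0 w (le_of_lt hw), zero_mul]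
    exact contDiffAt_const.congr_of_eventuallyEq this
  · have hu : u ∈ ball (0 : ℂ) 1 := by
      rw [mem_ball_zero_iff]
      nlinarith [norm_nonneg u]
    exact hH.contDiffAt.mul (hG.contDiffAt (isOpen_ball.mem_nhds hu))

theorem hasCompactSupport_mul_of_vanish (hε : 0 < ε) {H : ℂ → ℝ}
    (hH0 : ∀ u : ℂ, 1 - ε ≤ ‖u‖ ^ 2 → H u = 0) (G : ℂ → ℝ) :
    HasCompactSupport fun u => H u * G u := by
  refine HasCompactSupport.intro (isCompact_closedBall (0 : ℂ) 1) fun u hu => ?_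
  rw [hH0, zero_mul]
  have : 1 < ‖u‖ := by simpa using hu
  nlinarith

theorem integrable_mul_of_vanish (hε : 0 < ε) {H G : ℂ → ℝ} (hH : Continuous H)
    (hH0 : ∀ u : ℂ, 1 - ε ≤ ‖u‖ ^ 2 → H u = 0) (hG : ContinuousOn G (ball 0 1)) :
    Integrable fun u => H u * G u := by
  refine Continuous.integrable_of_hasCompactSupport ?_ (hasCompactSupport_mul_of_vanish hε hH0 G)
  exact (contDiff_mul_of_vanish hε (contDiff_zero.2 hH) hH0 (contDiffOn_zero.2 hG)).continuous

theorem integrable_cutoff_mul (hε : 0 < ε) {G : ℂ → ℝ} (hG : ContinuousOn G (ball 0 1)) :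
    Integrable fun u => cutoff ε u * G u :=
  integrable_mul_of_vanish hε (continuous_cutoff ε) (fun _ => cutoff_eq_zero hε) hG

theorem integrable_fderiv_cutoff_mul (hε : 0 < ε) {G : ℂ → ℝ} (hG : ContinuousOn G (ball 0 1))
    (e : ℂ) : Integrable fun u => fderiv ℝ (cutoff ε) u e * G u :=
  integrable_mul_of_vanish hε (continuous_fderiv_cutoff ε e)
    (fun _ h => fderiv_cutoff_eq_zero_of_le hε h e) hG

/-- Integration by parts against the cutoff. -/
theorem integral_fderiv_cutoff_mul (hε : 0 < ε) {G : ℂ → ℝ} (hG : ContDiffOn ℝ 1 G (ball 0 1))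
    (e : ℂ) :
    ∫ u in ball (0 : ℂ) 1, (fderiv ℝ (cutoff ε) u e * G u + cutoff ε u * fderiv ℝ G u e) = 0 := by
  have hW := contDiff_mul_of_vanish hε ((contDiff_cutoff ε).of_le (by simp))
    (fun _ => cutoff_eq_zero hε) hG
  have hS := hasCompactSupport_mul_of_vanish hε (fun _ => cutoff_eq_zero (ε := ε) hε) G
  set W : ℂ → ℝ := fun u => cutoff ε u * G u
  have hS' : HasCompactSupport fun u => fderiv ℝ W u e :=
    (hS.fderiv (𝕜 := ℝ)).comp_left (g := fun L : ℂ →L[ℝ] ℝ => L e) rfl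
  have hc : Continuous fun u => fderiv ℝ W u e :=
    (hW.continuous_fderiv (by simp)).clm_apply continuous_const
  -- The extension by zero is `C¹` with compact support; integrating by parts against the constant
  -- `1` shows that its derivative has integral zero.
  have h0 : ∫ u, fderiv ℝ W u e = 0 := by
    have := integral_mul_fderiv_eq_neg_fderiv_mul_of_integrable (μ := volume)
      (f := fun _ : ℂ => (1 : ℝ)) (g := W) (v := e) (by simp)
      (by simpa using hc.integrable_of_hasCompactSupport hS')
      (by simpa using hW.continuous.integrable_of_hasCompactSupport hS)
      (fun _ _ => differentiableAt_const _) (fun u _ => hW.differentiable (by simp) u)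
    simpa using this
  rw [← h0, ← setIntegral_eq_integral_of_forall_compl_eq_zero (s := ball (0 : ℂ) 1)
    (f := fun u => fderiv ℝ W u e)]
  · refine setIntegral_congr_fun (measurableSet_ball (x := (0 : ℂ)) (ε := 1)) fun u hu => ?_
    have h1 := ((contDiff_cutoff ε).differentiable (by simp) u).hasFDerivAt
    have h2 := ((hG.contDiffAt (isOpen_ball.mem_nhds hu)).differentiableAt (by simp)).hasFDerivAt
    have h3 : HasFDerivAt W _ u := h1.mul h2
    rw [h3.fderiv]
    simp
    ring
  · intro u hu
    have : W =ᶠ[𝓝 u] fun _ => 0 := by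
      have ho : IsOpen {u : ℂ | 1 - ε < ‖u‖ ^ 2} :=
        isOpen_lt continuous_const (continuous_norm.pow 2)
      have hu' : 1 ≤ ‖u‖ := by simpa using hu
      filter_upwards [ho.mem_nhds (show 1 - ε < ‖u‖ ^ 2 by nlinarith)] with w hw
      exact mul_eq_zero_of_left (cutoff_eq_zero hε (le_of_lt hw)) _
    rw [this.fderiv_eq]
    simp

end Cutoff

/-! ### Estimates and structure equations for the propagator -/

section Propagator

/-- This makes `fderivWithin` on `conf` well determined and continuous up to the boundary of the
disk, where `conf` is not open. It holds because `conf` is an open piece of a product of convex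
bodies. -/
theorem uniqueDiffOn_conf : UniqueDiffOn ℝ conf := by
  have h : UniqueDiffOn ℝ disk := uniqueDiffOn_convex (convex_closedBall 0 1)
    ⟨0, ball_subset_interior_closedBall (mem_ball_self one_pos)⟩
  have he : conf = (disk ×ˢ disk) ∩ {q : ℂ × ℂ | q.1 ≠ q.2} := by
    ext q; simp [conf, and_assoc]
  rw [he]
  exact (h.prod h).inter (isOpen_ne_fun continuous_fst continuous_snd)

/-- The component of the propagator along the bulk vertex, in the direction `e`. -/
def uForm (ζ : ℂ × ℂ → (ℂ × ℂ →L[ℝ] ℝ)) (e : ℂ) (s : ℝ) (u : ℂ) : ℝ := ζ (u, bdryPt s) (e, 0)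

/-- The component of the propagator along the boundary vertex. -/
def vForm (ζ : ℂ × ℂ → (ℂ × ℂ →L[ℝ] ℝ)) (s : ℝ) (u : ℂ) : ℝ :=
  ζ (u, bdryPt s) (0, Complex.I * bdryPt s)

/-- The integrand of `zetaHat`. -/
def wedge (ζ : ℂ × ℂ → (ℂ × ℂ →L[ℝ] ℝ)) (s t : ℝ) (u : ℂ) : ℝ :=
  uForm ζ 1 s u * uForm ζ Complex.I t u - uForm ζ Complex.I s u * uForm ζ 1 t u

variable {m : ℂ → ℝ} {ζ : ℂ × ℂ → (ℂ × ℂ →L[ℝ] ℝ)}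

theorem zetaHat_eq (ζ : ℂ × ℂ → (ℂ × ℂ →L[ℝ] ℝ)) (s t : ℝ) :
    zetaHat ζ s t = ∫ u in ball (0 : ℂ) 1, wedge ζ s t u :=
  setIntegral_congr_set disk_ae_eq_ball

theorem tau_eq (m : ℂ → ℝ) (ζ : ℂ × ℂ → (ℂ × ℂ →L[ℝ] ℝ)) (s : ℝ) :
    tau m ζ s = ∫ u in ball (0 : ℂ) 1, m u * vForm ζ s u := by
  rw [tau, deriv_bdryPt]
  exact setIntegral_congr_set disk_ae_eq_ball

theorem IsNormalisedTopForm.exists_bound (hm : IsNormalisedTopForm m) :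
    ∃ M, 0 ≤ M ∧ ∀ u ∈ disk, |m u| ≤ M := by
  obtain ⟨M, hM⟩ := (isCompact_closedBall (0 : ℂ) 1).exists_bound_of_continuousOn
    hm.smooth.continuousOn
  exact ⟨M, (norm_nonneg _).trans (hM 0 (by simp)), hM⟩

theorem IsPropagator.exists_bound (hζ : IsPropagator m ζ) :
    ∃ C, 0 ≤ C ∧ ∀ q ∈ conf, ‖ζ q‖ ≤ C * ‖q.1 - q.2‖⁻¹ := by
  obtain ⟨C, hC⟩ := hζ.bound
  refine ⟨|C|, abs_nonneg _, fun q hq => (hC q hq).trans ?_⟩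
  rw [div_eq_mul_inv]
  gcongr
  exact le_abs_self C

theorem IsPropagator.hasFDerivWithinAt (hζ : IsPropagator m ζ) {q : ℂ × ℂ} (hq : q ∈ conf) :
    HasFDerivWithinAt ζ (fderivWithin ℝ ζ conf q) conf q :=
  (hζ.smooth.differentiableOn (by simp) q hq).hasFDerivWithinAt

theorem IsPropagator.continuousOn_fderivWithin (hζ : IsPropagator m ζ) :
    ContinuousOn (fderivWithin ℝ ζ conf) conf :=
  hζ.smooth.continuousOn_fderivWithin uniqueDiffOn_conf (by simp)

/-- Pairs at distance at least `δ` form a compact subset of `conf`, on which the derivative is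
continuous. -/
theorem IsPropagator.exists_bound_fderivWithin (hζ : IsPropagator m ζ) {δ : ℝ} (hδ : 0 < δ) :
    ∃ K, 0 ≤ K ∧ ∀ q ∈ conf, δ ≤ ‖q.1 - q.2‖ → ‖fderivWithin ℝ ζ conf q‖ ≤ K := by
  have hc : IsCompact ((disk ×ˢ disk) ∩ {q : ℂ × ℂ | δ ≤ ‖q.1 - q.2‖}) :=
    ((isCompact_closedBall (0 : ℂ) 1).prod (isCompact_closedBall (0 : ℂ) 1)).inter_right
      (isClosed_le continuous_const (by fun_prop))
  have hsub : (disk ×ˢ disk) ∩ {q : ℂ × ℂ | δ ≤ ‖q.1 - q.2‖} ⊆ conf := fun q hq =>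
    ⟨hq.1.1, hq.1.2, fun h => by
      have h2 : δ ≤ ‖q.1 - q.2‖ := hq.2
      rw [h, sub_self, norm_zero] at h2
      exact absurd h2 (not_le.2 hδ)⟩
  obtain ⟨K, hK⟩ := hc.exists_bound_of_continuousOn
    (f := fderivWithin ℝ ζ conf) (hζ.continuousOn_fderivWithin.mono hsub)
  exact ⟨|K|, abs_nonneg K, fun q hq h =>
    (hK q ⟨⟨hq.1, hq.2.1⟩, h⟩).trans (le_abs_self K)⟩

/-- Away from the diagonal, the propagator is Lipschitz up to the boundary, so that its components
which vanish for `u` in the boundary are bounded by the distance from the boundary. -/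
theorem IsPropagator.exists_bound_near_boundary (hζ : IsPropagator m ζ) {δ : ℝ} (hδ : 0 < δ) :
    ∃ K, 0 ≤ K ∧ ∀ u ∈ ball (0 : ℂ) 1, ∀ s : ℝ, δ ≤ ‖u - bdryPt s‖ →
      |vForm ζ s u| ≤ K * (1 - ‖u‖) ∧ |uForm ζ (Complex.I * u) s u| ≤ K * (1 - ‖u‖) := by
  obtain ⟨C, hC0, hC⟩ := hζ.exists_bound
  obtain ⟨K, hK0, hK⟩ := hζ.exists_bound_fderivWithin (half_pos hδ)
  have hE0 : 0 ≤ C * δ⁻¹ * (2 / δ) := by positivity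
  refine ⟨K + C * δ⁻¹ * (2 / δ), by positivity, fun u hu s hus => ?_⟩
  have hu1 : ‖u‖ < 1 := by simpa using hu
  have hv : ‖((0 : ℂ), Complex.I * bdryPt s)‖ ≤ 1 := by simp [Prod.norm_def, norm_bdryPt]
  have hiu : ‖(Complex.I * u, (0 : ℂ))‖ ≤ 1 := by simp [Prod.norm_def, hu1.le]
  -- Far from the circle no vanishing is needed: the pole bound `C * δ⁻¹` is at most `C * δ⁻¹ * (2 /
  -- δ)` times the distance `1 - ‖u‖`.
  rcases le_or_gt (δ / 2) (1 - ‖u‖) with h | h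
  · have hb : ‖ζ (u, bdryPt s)‖ ≤ (K + C * δ⁻¹ * (2 / δ)) * (1 - ‖u‖) := by
      calc ‖ζ (u, bdryPt s)‖ ≤ C * ‖u - bdryPt s‖⁻¹ := hC _ (mem_conf_bdryPt hu s)
        _ ≤ C * δ⁻¹ := by gcongr
        _ = C * δ⁻¹ * (2 / δ) * (δ / 2) := by field_simp
        _ ≤ C * δ⁻¹ * (2 / δ) * (1 - ‖u‖) := by gcongr
        _ ≤ (K + C * δ⁻¹ * (2 / δ)) * (1 - ‖u‖) := by
          gcongr
          linarith
    constructor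
    · exact ((ζ (u, bdryPt s)).unit_le_opNorm _ hv).trans hb
    · exact ((ζ (u, bdryPt s)).unit_le_opNorm _ hiu).trans hb
  · have hlt2 : ‖u - bdryPt s‖ < 2 := by
      have := norm_sub_le u (bdryPt s)
      rw [norm_bdryPt] at this
      linarith
    have hu0 : 0 < ‖u‖ := by linarith
    -- Close to the circle, `u` is compared with its radial projection `u'`, where both components
    -- vanish (`I * u` is tangent to the circle at `u'`). The segment is shorter than `δ / 2`, so it
    -- stays at distance `δ / 2` from the boundary vertex and the mean value inequality applies with
    -- the constant `K`.
    set u' : ℂ := (‖u‖⁻¹ : ℝ) • u with hu'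
    have hn' : ‖u'‖ = 1 := by
      rw [hu', norm_smul, norm_inv, norm_norm, inv_mul_cancel₀ hu0.ne']
    have huu' : u = (‖u‖ : ℝ) • u' := by rw [hu', smul_smul, mul_inv_cancel₀ hu0.ne', one_smul]
    have hd : ‖u - u'‖ = 1 - ‖u‖ := by
      have : u - u' = (‖u‖ - 1 : ℝ) • u' := by rw [sub_smul, ← huu', one_smul]
      rw [this, norm_smul, hn', mul_one, Real.norm_eq_abs, abs_of_nonpos (by linarith)]
      ring
    have hu'd : u' ∈ disk := by simp [disk, hn']
    have hseg : ∀ x ∈ segment ℝ u u', x ∈ disk ∧ δ / 2 ≤ ‖x - bdryPt s‖ := by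
      intro x hx
      refine ⟨(convex_closedBall (0 : ℂ) 1).segment_subset (ball_subset_disk hu) hu'd hx, ?_⟩
      have h1 : ‖u - x‖ ≤ ‖u - u'‖ := by
        obtain ⟨a, b, ha, hb, hab, rfl⟩ := hx
        have : u - (a • u + b • u') = b • (u - u') := by
          rw [← eq_sub_iff_add_eq'] at hab
          subst hab
          module
        rw [this, norm_smul, Real.norm_eq_abs, abs_of_nonneg hb]
        exact mul_le_of_le_one_left (norm_nonneg _) (by linarith)
      have h2 := norm_sub_le_norm_sub_add_norm_sub u x (bdryPt s)
      linarith
    have hsub : segment ℝ u u' ×ˢ {bdryPt s} ⊆ conf := by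
      rintro ⟨x, y⟩ ⟨hx, rfl⟩
      refine ⟨(hseg x hx).1, bdryPt_mem_disk s, fun he => ?_⟩
      have := (hseg x hx).2
      simp only at he
      rw [he, sub_self, norm_zero] at this
      linarith
    have hL : ‖ζ (u, bdryPt s) - ζ (u', bdryPt s)‖ ≤ K * (1 - ‖u‖) := by
      have := ((convex_segment (𝕜 := ℝ) u u').prod
        (convex_singleton (bdryPt s))).norm_image_sub_le_of_norm_hasFDerivWithin_le
        (f := ζ) (f' := fderivWithin ℝ ζ conf) (C := K)
        (x := (u', bdryPt s)) (y := (u, bdryPt s))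
        (fun q hq => (hζ.hasFDerivWithinAt (hsub hq)).mono hsub)
        (fun q hq => hK q (hsub hq) (by
          obtain ⟨h1, h2⟩ := hq
          rw [Set.mem_singleton_iff.1 h2]
          exact (hseg q.1 h1).2))
        ⟨right_mem_segment ℝ u u', rfl⟩ ⟨left_mem_segment ℝ u u', rfl⟩
      simpa [Prod.norm_def, hd, hu1.le] using this
    have hconf' : (u', bdryPt s) ∈ conf := hsub ⟨right_mem_segment ℝ u u', rfl⟩
    have hle : K * (1 - ‖u‖) ≤ (K + C * δ⁻¹ * (2 / δ)) * (1 - ‖u‖) := by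
      gcongr
      linarith
    have hv0 : ζ (u', bdryPt s) (0, Complex.I * bdryPt s) = 0 := by
      have := hζ.boundary _ hconf' hn' 0 (Complex.I * bdryPt s)
      rwa [zero_smul] at this
    have hu0' : ζ (u', bdryPt s) (Complex.I * u, 0) = 0 := by
      have := hζ.boundary _ hconf' hn' ‖u‖ 0
      rwa [← mul_smul_comm, ← huu'] at this
    constructor
    · refine le_trans ?_ (hL.trans hle)
      have := (ζ (u, bdryPt s) - ζ (u', bdryPt s)).unit_le_opNorm _ hv
      rwa [sub_apply, hv0, sub_zero] at this
    · refine le_trans ?_ (hL.trans hle)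
      have := (ζ (u, bdryPt s) - ζ (u', bdryPt s)).unit_le_opNorm _ hiu
      rwa [sub_apply, hu0', sub_zero] at this

theorem abs_uForm_le {C : ℝ} (hC : ∀ q ∈ conf, ‖ζ q‖ ≤ C * ‖q.1 - q.2‖⁻¹) {e : ℂ} (he : ‖e‖ ≤ 1)
    (s : ℝ) {u : ℂ} (hu : u ∈ ball (0 : ℂ) 1) :
    |uForm ζ e s u| ≤ C * ‖u - bdryPt s‖⁻¹ :=
  ((ζ (u, bdryPt s)).unit_le_opNorm _ (by simpa [Prod.norm_def] using he)).trans
    (hC _ (mem_conf_bdryPt hu s))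

theorem abs_vForm_le {C : ℝ} (hC : ∀ q ∈ conf, ‖ζ q‖ ≤ C * ‖q.1 - q.2‖⁻¹)
    (s : ℝ) {u : ℂ} (hu : u ∈ ball (0 : ℂ) 1) :
    |vForm ζ s u| ≤ C * ‖u - bdryPt s‖⁻¹ :=
  ((ζ (u, bdryPt s)).unit_le_opNorm _ (by simp [Prod.norm_def, norm_bdryPt])).trans
    (hC _ (mem_conf_bdryPt hu s))

theorem IsPropagator.hasFDerivAt_fst (hζ : IsPropagator m ζ) (s : ℝ) {u : ℂ}
    (hu : u ∈ ball (0 : ℂ) 1) :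
    HasFDerivAt (fun u => ζ (u, bdryPt s))
      ((fderivWithin ℝ ζ conf (u, bdryPt s)).comp (ContinuousLinearMap.inl ℝ ℂ ℂ)) u :=
  (hζ.hasFDerivWithinAt (mem_conf_bdryPt hu s)).comp_hasFDerivAt u
    (hasFDerivAt_prodMk_left u (bdryPt s))
    (by filter_upwards [isOpen_ball.mem_nhds hu] with w hw using mem_conf_bdryPt hw s)

theorem IsPropagator.hasDerivAt_snd (hζ : IsPropagator m ζ) (s : ℝ) {u : ℂ}
    (hu : u ∈ ball (0 : ℂ) 1) :
    HasDerivAt (fun s => ζ (u, bdryPt s))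
      (fderivWithin ℝ ζ conf (u, bdryPt s) (0, Complex.I * bdryPt s)) s :=
  (hζ.hasFDerivWithinAt (mem_conf_bdryPt hu s)).comp_hasDerivAt s
    ((hasDerivAt_const s u).prodMk (hasDerivAt_bdryPt s))
    (Eventually.of_forall fun r => mem_conf_bdryPt hu r)

theorem IsPropagator.contDiffOn_fst (hζ : IsPropagator m ζ) (s : ℝ) :
    ContDiffOn ℝ ∞ (fun u => ζ (u, bdryPt s)) (ball 0 1) :=
  hζ.smooth.comp (contDiff_prodMk_left (bdryPt s)).contDiffOn
    fun _ hu => mem_conf_bdryPt hu s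

theorem IsPropagator.contDiffOn_uForm (hζ : IsPropagator m ζ) (e : ℂ) (s : ℝ) :
    ContDiffOn ℝ ∞ (uForm ζ e s) (ball 0 1) :=
  (hζ.contDiffOn_fst s).clm_apply contDiffOn_const

theorem IsPropagator.contDiffOn_vForm (hζ : IsPropagator m ζ) (s : ℝ) :
    ContDiffOn ℝ ∞ (vForm ζ s) (ball 0 1) :=
  (hζ.contDiffOn_fst s).clm_apply contDiffOn_const

theorem IsPropagator.fderiv_uForm (hζ : IsPropagator m ζ) (e : ℂ) (s : ℝ) {u : ℂ}
    (hu : u ∈ ball (0 : ℂ) 1) (w : ℂ) :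
    fderiv ℝ (uForm ζ e s) u w = fderivWithin ℝ ζ conf (u, bdryPt s) (w, 0) (e, 0) := by
  have h : HasFDerivAt (uForm ζ e s) _ u :=
    (hζ.hasFDerivAt_fst s hu).clm_apply (hasFDerivAt_const (e, (0 : ℂ)) u)
  rw [h.fderiv]
  simp

theorem IsPropagator.fderiv_vForm (hζ : IsPropagator m ζ) (s : ℝ) {u : ℂ}
    (hu : u ∈ ball (0 : ℂ) 1) (w : ℂ) :
    fderiv ℝ (vForm ζ s) u w =
      fderivWithin ℝ ζ conf (u, bdryPt s) (w, 0) (0, Complex.I * bdryPt s) := by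
  have h : HasFDerivAt (vForm ζ s) _ u :=
    (hζ.hasFDerivAt_fst s hu).clm_apply (hasFDerivAt_const ((0 : ℂ), Complex.I * bdryPt s) u)
  rw [h.fderiv]
  simp

theorem IsPropagator.abs_fderiv_vForm_le (hζ : IsPropagator m ζ) (s : ℝ) {u : ℂ}
    (hu : u ∈ ball (0 : ℂ) 1) {w : ℂ} (hw : ‖w‖ ≤ 1) :
    |fderiv ℝ (vForm ζ s) u w| ≤ ‖fderivWithin ℝ ζ conf (u, bdryPt s)‖ := by
  rw [hζ.fderiv_vForm s hu]
  have h1 : ‖(w, (0 : ℂ))‖ ≤ 1 := by simpa [Prod.norm_def] using hw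
  have h2 : ‖((0 : ℂ), Complex.I * bdryPt s)‖ ≤ 1 := by simp [Prod.norm_def, norm_bdryPt]
  have h3 := (fderivWithin ℝ ζ conf (u, bdryPt s)).unit_le_opNorm _ h1
  have h4 := (fderivWithin ℝ ζ conf (u, bdryPt s) (w, 0)).unit_le_opNorm _ h2
  exact h4.trans h3

/-- The `u`-`v` component of `dζ = -π₁^*μ`. -/
theorem IsPropagator.hasDerivAt_uForm (hζ : IsPropagator m ζ) (e : ℂ) (s : ℝ) {u : ℂ}
    (hu : u ∈ ball (0 : ℂ) 1) :
    HasDerivAt (fun s => uForm ζ e s u) (fderiv ℝ (vForm ζ s) u e) s := by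
  have h : HasDerivAt (fun s => uForm ζ e s u) _ s :=
    (hζ.hasDerivAt_snd s hu).clm_apply (hasDerivAt_const s (e, (0 : ℂ)))
  have h2 := hζ.ext_deriv _ (mem_conf_bdryPt hu s) (0, Complex.I * bdryPt s) (e, 0)
  simp only [area, Complex.zero_re, Complex.zero_im, zero_mul, sub_zero, mul_zero, neg_zero] at h2
  rw [hζ.fderiv_vForm s hu, ← sub_eq_zero.1 h2]
  simpa using h

/-- The `u`-`u` component of `dζ = -π₁^*μ`. -/
theorem IsPropagator.curl_uForm (hζ : IsPropagator m ζ) (s : ℝ) {u : ℂ}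
    (hu : u ∈ ball (0 : ℂ) 1) :
    fderiv ℝ (uForm ζ Complex.I s) u 1 - fderiv ℝ (uForm ζ 1 s) u Complex.I = -m u := by
  have h2 := hζ.ext_deriv _ (mem_conf_bdryPt hu s) (1, 0) (Complex.I, 0)
  rw [hζ.fderiv_uForm _ s hu, hζ.fderiv_uForm _ s hu, h2]
  simp [area]

theorem uForm_I_mul (ζ : ℂ × ℂ → (ℂ × ℂ →L[ℝ] ℝ)) (s : ℝ) (u : ℂ) :
    uForm ζ (Complex.I * u) s u = u.re * uForm ζ Complex.I s u - u.im * uForm ζ 1 s u := by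
  have : (Complex.I * u, (0 : ℂ)) = u.re • (Complex.I, (0 : ℂ)) - u.im • ((1 : ℂ), (0 : ℂ)) := by
    refine Prod.ext ?_ (by simp)
    apply Complex.ext <;> simp
  simp only [uForm]
  rw [this, map_sub, map_smul, map_smul, smul_eq_mul, smul_eq_mul]

end Propagator

/-! ### Differentiation of the boundary function by regularisation -/

section BoundaryFunction

variable {m : ℂ → ℝ} {ζ : ℂ × ℂ → (ℂ × ℂ →L[ℝ] ℝ)} {ε : ℝ}

theorem IsNormalisedTopForm.continuousOn_ball (hm : IsNormalisedTopForm m) :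
    ContinuousOn m (ball 0 1) := hm.smooth.continuousOn.mono ball_subset_disk

theorem IsPropagator.continuousOn_uForm (hζ : IsPropagator m ζ) (e : ℂ) (s : ℝ) :
    ContinuousOn (uForm ζ e s) (ball 0 1) := (hζ.contDiffOn_uForm e s).continuousOn

theorem IsPropagator.continuousOn_vForm (hζ : IsPropagator m ζ) (s : ℝ) :
    ContinuousOn (vForm ζ s) (ball 0 1) := (hζ.contDiffOn_vForm s).continuousOn

theorem IsPropagator.continuousOn_fderiv_vForm (hζ : IsPropagator m ζ) (s : ℝ) (e : ℂ) :
    ContinuousOn (fun u => fderiv ℝ (vForm ζ s) u e) (ball 0 1) :=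
  ((hζ.contDiffOn_vForm s).continuousOn_fderiv_of_isOpen isOpen_ball (by simp)).clm_apply
    continuousOn_const

theorem IsPropagator.continuousOn_wedge (hζ : IsPropagator m ζ) (s t : ℝ) :
    ContinuousOn (wedge ζ s t) (ball 0 1) :=
  ((hζ.continuousOn_uForm _ s).mul (hζ.continuousOn_uForm _ t)).sub
    ((hζ.continuousOn_uForm _ s).mul (hζ.continuousOn_uForm _ t))

/-- Two poles at distance at least `δ` can be separated: their product is controlled by the sum of
the single poles, each of which is integrable. -/
theorem inv_mul_inv_le {δ x y : ℝ} (hδ : 0 < δ) (hx : 0 < x) (hy : 0 < y) (h : δ ≤ x + y) :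
    x⁻¹ * y⁻¹ ≤ δ⁻¹ * (x⁻¹ + y⁻¹) := by
  have : x⁻¹ + y⁻¹ = (x + y) * (x⁻¹ * y⁻¹) := by field_simp; ring
  rw [this, ← mul_assoc]
  refine le_mul_of_one_le_left (by positivity) ?_
  rw [inv_mul_eq_div, one_le_div hδ]
  exact h

theorem norm_bdryPt_sub_le (s t : ℝ) (u : ℂ) :
    ‖bdryPt s - bdryPt t‖ ≤ ‖u - bdryPt s‖ + ‖u - bdryPt t‖ := by
  rw [norm_sub_rev u (bdryPt s)]
  exact norm_sub_le_norm_sub_add_norm_sub _ _ _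

theorem IsPropagator.integrableOn_wedge (hζ : IsPropagator m ζ) {s t : ℝ}
    (hst : bdryPt s ≠ bdryPt t) : IntegrableOn (wedge ζ s t) (ball 0 1) := by
  obtain ⟨C, hC0, hC⟩ := hζ.exists_bound
  have hδ : 0 < ‖bdryPt s - bdryPt t‖ := norm_pos_iff.2 (sub_ne_zero.2 hst)
  refine Integrable.mono' (g := fun u => 2 * C ^ 2 * ‖bdryPt s - bdryPt t‖⁻¹ *
    (‖u - bdryPt s‖⁻¹ + ‖u - bdryPt t‖⁻¹))
    (((integrableOn_inv_norm_sub _).add (integrableOn_inv_norm_sub _)).const_mul _)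
    ((hζ.continuousOn_wedge s t).aestronglyMeasurable measurableSet_ball) ?_
  filter_upwards [ae_restrict_mem measurableSet_ball] with u hu
  have h1 : ‖(1 : ℂ)‖ ≤ 1 := by simp
  have hI : ‖Complex.I‖ ≤ 1 := by simp
  have hs := norm_sub_bdryPt_pos hu s
  have ht := norm_sub_bdryPt_pos hu t
  calc ‖wedge ζ s t u‖
      ≤ |uForm ζ 1 s u| * |uForm ζ Complex.I t u| + |uForm ζ Complex.I s u| * |uForm ζ 1 t u| := by
        rw [← abs_mul, ← abs_mul]
        exact abs_sub _ _
    _ ≤ (C * ‖u - bdryPt s‖⁻¹) * (C * ‖u - bdryPt t‖⁻¹) +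
        (C * ‖u - bdryPt s‖⁻¹) * (C * ‖u - bdryPt t‖⁻¹) := by
        gcongr <;> apply abs_uForm_le hC <;> assumption
    _ = 2 * C ^ 2 * (‖u - bdryPt s‖⁻¹ * ‖u - bdryPt t‖⁻¹) := by ring
    _ ≤ 2 * C ^ 2 * (‖bdryPt s - bdryPt t‖⁻¹ * (‖u - bdryPt s‖⁻¹ + ‖u - bdryPt t‖⁻¹)) := by
        exact mul_le_mul_of_nonneg_left (inv_mul_inv_le hδ hs ht (norm_bdryPt_sub_le s t u))
          (by positivity)
    _ = _ := by ring

theorem IsPropagator.integrableOn_tau (hζ : IsPropagator m ζ) (hm : IsNormalisedTopForm m)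
    (s : ℝ) : IntegrableOn (fun u => m u * vForm ζ s u) (ball 0 1) := by
  obtain ⟨C, hC0, hC⟩ := hζ.exists_bound
  obtain ⟨M, hM0, hM⟩ := hm.exists_bound
  refine Integrable.mono' (g := fun u => M * (C * ‖u - bdryPt s‖⁻¹))
    (((integrableOn_inv_norm_sub _).const_mul _).const_mul _)
    ((hm.continuousOn_ball.mul (hζ.continuousOn_vForm s)).aestronglyMeasurable
      measurableSet_ball) ?_
  filter_upwards [ae_restrict_mem measurableSet_ball] with u hu
  rw [Real.norm_eq_abs, abs_mul]
  gcongr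
  · exact hM u (ball_subset_disk hu)
  · exact abs_vForm_le hC s hu

/-- The regularisation of `zetaHat` by a cutoff. -/
def zetaHatCut (ζ : ℂ × ℂ → (ℂ × ℂ →L[ℝ] ℝ)) (ε s t : ℝ) : ℝ :=
  ∫ u in ball (0 : ℂ) 1, cutoff ε u * wedge ζ s t u

/-- The regularisation of `tau` by a cutoff. -/
def tauCut (m : ℂ → ℝ) (ζ : ℂ × ℂ → (ℂ × ℂ →L[ℝ] ℝ)) (ε s : ℝ) : ℝ :=
  ∫ u in ball (0 : ℂ) 1, cutoff ε u * (m u * vForm ζ s u)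

/-- The contribution of the derivative of the cutoff. -/
def cutError (ζ : ℂ × ℂ → (ℂ × ℂ →L[ℝ] ℝ)) (ε s t : ℝ) : ℝ :=
  ∫ u in ball (0 : ℂ) 1, (fderiv ℝ (cutoff ε) u 1 * (vForm ζ s u * uForm ζ Complex.I t u) -
    fderiv ℝ (cutoff ε) u Complex.I * (vForm ζ s u * uForm ζ 1 t u))

/-- Since `1 - r ≥ (1 - r²) / 2`, the region where the cutoff can be nonzero stays `ε / 2` away from
every boundary vertex, so regularised integrands have no poles. -/
theorem one_sub_norm_of_cutoff {u : ℂ} (h : ‖u‖ ^ 2 ≤ 1 - ε) (s : ℝ) :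
    ε / 2 ≤ ‖u - bdryPt s‖ := by
  refine le_trans ?_ (one_sub_norm_le u s)
  nlinarith [sq_nonneg (1 - ‖u‖)]

theorem eventually_cutoff_eq_one {u : ℂ} (hu : u ∈ ball (0 : ℂ) 1) :
    ∀ᶠ n in atTop, cutoff (width n) u = 1 := by
  have h1 : ‖u‖ < 1 := by simpa using hu
  have h2 : (0 : ℝ) < (1 - ‖u‖ ^ 2) / 2 := by nlinarith [norm_nonneg u]
  filter_upwards [tendsto_width.eventually_lt_const h2] with n hn
  exact cutoff_eq_one (width_pos n) (by linarith)

theorem tendsto_cutoff_integral {G : ℂ → ℝ} (hG : IntegrableOn G (ball 0 1)) :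
    Tendsto (fun n => ∫ u in ball (0 : ℂ) 1, cutoff (width n) u * G u) atTop
      (𝓝 (∫ u in ball (0 : ℂ) 1, G u)) := by
  refine tendsto_integral_of_dominated_convergence (fun u => ‖G u‖)
    (fun n => (continuous_cutoff _).aestronglyMeasurable.mul hG.aestronglyMeasurable) hG.norm
    (fun n => Eventually.of_forall fun u => ?_) ?_
  · rw [norm_mul, Real.norm_eq_abs, abs_of_nonneg (cutoff_nonneg _ _)]
    exact mul_le_of_le_one_left (norm_nonneg _) (cutoff_le_one _ _)
  · filter_upwards [ae_restrict_mem measurableSet_ball] with u hu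
    refine tendsto_const_nhds.congr' ?_
    filter_upwards [eventually_cutoff_eq_one hu] with n hn
    rw [hn, one_mul]

theorem IsPropagator.tendsto_zetaHatCut (hζ : IsPropagator m ζ) {s t : ℝ}
    (hst : bdryPt s ≠ bdryPt t) :
    Tendsto (fun n => zetaHatCut ζ (width n) s t) atTop (𝓝 (zetaHat ζ s t)) := by
  rw [zetaHat_eq]
  exact tendsto_cutoff_integral (hζ.integrableOn_wedge hst)

theorem IsPropagator.integrableOn_cutoff_curl (hζ : IsPropagator m ζ) (hε : 0 < ε) (s t : ℝ) :
    IntegrableOn (fun u => cutoff ε u * (fderiv ℝ (vForm ζ s) u 1 * uForm ζ Complex.I t u -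
      fderiv ℝ (vForm ζ s) u Complex.I * uForm ζ 1 t u)) (ball 0 1) :=
  (integrable_cutoff_mul hε (((hζ.continuousOn_fderiv_vForm s 1).mul
    (hζ.continuousOn_uForm _ t)).sub ((hζ.continuousOn_fderiv_vForm s Complex.I).mul
      (hζ.continuousOn_uForm _ t)))).integrableOn

/-- Stokes' theorem for the form `v ζ₁₃` multiplied by the cutoff. -/
theorem IsPropagator.integral_curl (hζ : IsPropagator m ζ) (hm : IsNormalisedTopForm m)
    (hε : 0 < ε) (s t : ℝ) :
    ∫ u in ball (0 : ℂ) 1, cutoff ε u * (fderiv ℝ (vForm ζ s) u 1 * uForm ζ Complex.I t u -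
      fderiv ℝ (vForm ζ s) u Complex.I * uForm ζ 1 t u) =
    tauCut m ζ ε s - cutError ζ ε s t := by
  have hv := hζ.continuousOn_vForm s
  have hP := hζ.continuousOn_uForm 1 t
  have hQ := hζ.continuousOn_uForm Complex.I t
  have hS : ∀ e, ContDiffOn ℝ 1 (fun u => vForm ζ s u * uForm ζ e t u) (ball 0 1) := fun e =>
    ((hζ.contDiffOn_vForm s).mul (hζ.contDiffOn_uForm e t)).of_le (by simp)
  have hI : ∀ e w, IntegrableOn (fun u =>
      fderiv ℝ (cutoff ε) u w * (vForm ζ s u * uForm ζ e t u) +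
        cutoff ε u * fderiv ℝ (fun u => vForm ζ s u * uForm ζ e t u) u w) (ball 0 1) :=
    fun e w => ((integrable_fderiv_cutoff_mul hε (hS e).continuousOn w).add
      (integrable_cutoff_mul hε (((hS e).continuousOn_fderiv_of_isOpen isOpen_ball
        le_rfl).clm_apply continuousOn_const))).integrableOn
  have h1 := integral_fderiv_cutoff_mul hε (hS Complex.I) 1
  have h2 := integral_fderiv_cutoff_mul hε (hS 1) Complex.I
  have h3 := integral_sub (hI Complex.I 1) (hI 1 Complex.I)
  rw [h1, h2, sub_zero] at h3
  have hd : ∀ e w : ℂ, ∀ u ∈ ball (0 : ℂ) 1, fderiv ℝ (fun u => vForm ζ s u * uForm ζ e t u) u w =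
      fderiv ℝ (vForm ζ s) u w * uForm ζ e t u + vForm ζ s u * fderiv ℝ (uForm ζ e t) u w := by
    intro e w u hu
    have ha := (((hζ.contDiffOn_vForm s).contDiffAt (isOpen_ball.mem_nhds hu)).differentiableAt
      (by simp)).hasFDerivAt
    have hb := (((hζ.contDiffOn_uForm e t).contDiffAt (isOpen_ball.mem_nhds hu)).differentiableAt
      (by simp)).hasFDerivAt
    have hab : HasFDerivAt (fun u => vForm ζ s u * uForm ζ e t u) _ u := ha.mul hb
    rw [hab.fderiv]
    simp
    ring
  have hi1 : IntegrableOn (fun u => cutoff ε u * (m u * vForm ζ s u)) (ball 0 1) :=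
    (integrable_cutoff_mul hε (hm.continuousOn_ball.mul hv)).integrableOn
  have hi2 : IntegrableOn (fun u =>
      fderiv ℝ (cutoff ε) u 1 * (vForm ζ s u * uForm ζ Complex.I t u) -
      fderiv ℝ (cutoff ε) u Complex.I * (vForm ζ s u * uForm ζ 1 t u)) (ball 0 1) :=
    ((integrable_fderiv_cutoff_mul hε (hv.mul hQ) 1).sub
      (integrable_fderiv_cutoff_mul hε (hv.mul hP) Complex.I)).integrableOn
  have h4 := integral_sub (hζ.integrableOn_cutoff_curl hε s t) (hi1.sub hi2)
  simp only [Pi.sub_apply] at h4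
  rw [tauCut, cutError, ← integral_sub hi1 hi2, ← sub_eq_zero, ← h4, ← h3]
  refine setIntegral_congr_fun measurableSet_ball fun u hu => ?_
  have hc := hζ.curl_uForm t hu
  simp only [hd _ _ u hu]
  -- After the product rule, the only second-factor derivatives left form the curl of `ζ₁₃`, which
  -- is `-m`; this is the source of `tauCut`.
  linear_combination (-(cutoff ε u * vForm ζ s u)) * hc

/-- Differentiation under the integral: the mixed structure equation replaces the `s`-derivative of
`ζ₁₂` by the `u`-differential of `vForm`, which `integral_curl` evaluates. On the support of the
cutoff all factors are bounded independently of the moving vertex. -/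
theorem IsPropagator.hasDerivAt_zetaHatCut (hζ : IsPropagator m ζ) (hm : IsNormalisedTopForm m)
    (hε : 0 < ε) (s t : ℝ) :
    HasDerivAt (fun s => zetaHatCut ζ ε s t) (tauCut m ζ ε s - cutError ζ ε s t) s := by
  rw [← hζ.integral_curl hm hε]
  obtain ⟨C, hC0, hC⟩ := hζ.exists_bound
  obtain ⟨K, hK0, hK⟩ := hζ.exists_bound_fderivWithin (half_pos hε)
  have h1 : ‖(1 : ℂ)‖ ≤ 1 := by simp
  have hI : ‖Complex.I‖ ≤ 1 := by simp
  refine (hasDerivAt_integral_of_dominated_loc_of_deriv_le (s := Set.univ) (x₀ := s)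
    (F := fun s u => cutoff ε u * wedge ζ s t u)
    (F' := fun s u => cutoff ε u * (fderiv ℝ (vForm ζ s) u 1 * uForm ζ Complex.I t u -
      fderiv ℝ (vForm ζ s) u Complex.I * uForm ζ 1 t u))
    (bound := fun _ => 2 * K * (C * (ε / 2)⁻¹)) univ_mem ?_ ?_ ?_ ?_ ?_ ?_).2
  · exact Eventually.of_forall fun r =>
      (integrable_cutoff_mul hε (hζ.continuousOn_wedge r t)).integrableOn.aestronglyMeasurable
  · exact (integrable_cutoff_mul hε (hζ.continuousOn_wedge s t)).integrableOn
  · exact (hζ.integrableOn_cutoff_curl hε s t).aestronglyMeasurable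
  · filter_upwards [ae_restrict_mem measurableSet_ball] with u hu r _
    rcases le_or_gt (1 - ε) (‖u‖ ^ 2) with h | h
    · rw [cutoff_eq_zero hε h, zero_mul, norm_zero]
      positivity
    have hr := hK _ (mem_conf_bdryPt hu r) (one_sub_norm_of_cutoff h.le r)
    have ht : C * ‖u - bdryPt t‖⁻¹ ≤ C * (ε / 2)⁻¹ := by
      gcongr
      exact one_sub_norm_of_cutoff h.le t
    rw [norm_mul, Real.norm_eq_abs, abs_of_nonneg (cutoff_nonneg _ _), Real.norm_eq_abs]
    refine (mul_le_of_le_one_left (abs_nonneg _) (cutoff_le_one _ _)).trans ?_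
    calc |fderiv ℝ (vForm ζ r) u 1 * uForm ζ Complex.I t u -
          fderiv ℝ (vForm ζ r) u Complex.I * uForm ζ 1 t u|
        ≤ |fderiv ℝ (vForm ζ r) u 1| * |uForm ζ Complex.I t u| +
          |fderiv ℝ (vForm ζ r) u Complex.I| * |uForm ζ 1 t u| := by
          rw [← abs_mul, ← abs_mul]
          exact abs_sub _ _
      _ ≤ K * (C * (ε / 2)⁻¹) + K * (C * (ε / 2)⁻¹) := by
          gcongr
          · exact (hζ.abs_fderiv_vForm_le r hu h1).trans hr
          · exact (abs_uForm_le hC hI t hu).trans ht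
          · exact (hζ.abs_fderiv_vForm_le r hu hI).trans hr
          · exact (abs_uForm_le hC h1 t hu).trans ht
      _ = _ := by ring
  · exact integrableOn_const (by simp)
  · filter_upwards [ae_restrict_mem measurableSet_ball] with u hu r _
    exact (((hζ.hasDerivAt_uForm 1 r hu).mul_const _).sub
      ((hζ.hasDerivAt_uForm Complex.I r hu).mul_const _)).const_mul _

theorem abs_setIntegral_ball_le {G g : ℂ → ℝ} (hG : ∀ u : ℂ, ‖u‖ ^ 2 ≤ 1 - 2 * ε → G u = 0)
    (hg : IntegrableOn g (annulus ε)) (h : ∀ u ∈ annulus ε, |G u| ≤ g u) :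
    |∫ u in ball (0 : ℂ) 1, G u| ≤ ∫ u in annulus ε, g u := by
  have he : ∫ u in ball (0 : ℂ) 1, G u = ∫ u in annulus ε, G u :=
    setIntegral_eq_of_subset_of_forall_sdiff_eq_zero measurableSet_ball (annulus_subset_ball ε)
      fun u hu => hG u <| by
        have h1 : ‖u‖ < 1 := by simpa using hu.1
        by_contra h
        exact hu.2 ⟨h1, (not_le.1 h).le⟩
  rw [he]
  refine norm_integral_le_of_norm_le (f := G) hg ?_
  filter_upwards [ae_restrict_mem (measurableSet_annulus ε)] with u hu using h u hu

theorem IsPropagator.exists_abs_tauCut_sub_le (hζ : IsPropagator m ζ)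
    (hm : IsNormalisedTopForm m) :
    ∃ A, ∀ ε > 0, ∀ s, |tauCut m ζ ε s - tau m ζ s| ≤ A * annulusMass ε := by
  obtain ⟨C, hC0, hC⟩ := hζ.exists_bound
  obtain ⟨M, hM0, hM⟩ := hm.exists_bound
  refine ⟨M * C, fun ε hε s => ?_⟩
  have hi : IntegrableOn (fun u => cutoff ε u * (m u * vForm ζ s u)) (ball 0 1) :=
    (integrable_cutoff_mul hε (hm.continuousOn_ball.mul (hζ.continuousOn_vForm s))).integrableOn
  rw [tau_eq, tauCut, ← integral_sub hi (hζ.integrableOn_tau hm s), ← setIntegral_annulus ε s,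
    ← integral_const_mul]
  refine abs_setIntegral_ball_le (fun u h2 => ?_)
    (((integrableOn_inv_norm_sub _).mono_set (annulus_subset_ball ε)).const_mul _) fun u hu => ?_
  · rw [cutoff_eq_one hε h2]
    ring
  · have hu' := annulus_subset_ball ε hu
    have h1 : cutoff ε u * (m u * vForm ζ s u) - m u * vForm ζ s u =
      -((1 - cutoff ε u) * (m u * vForm ζ s u)) := by ring
    rw [h1, abs_neg, abs_mul, abs_mul, abs_of_nonneg (sub_nonneg.2 (cutoff_le_one _ _)), mul_assoc]
    refine (mul_le_of_le_one_left (by positivity) (by linarith [cutoff_nonneg ε u])).trans ?_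
    gcongr
    · exact hM u (ball_subset_disk hu')
    · exact abs_vForm_le hC s hu'

/-- The integrand lives on the annulus and has a factor `1/ε`. A point `u` cannot be within `δ` of
both boundary vertices, so one of the two components of the propagator is `O(1 - ‖u‖) = O(ε)`, and
only one integrable pole remains. -/
theorem IsPropagator.exists_abs_cutError_le (hζ : IsPropagator m ζ) {δ : ℝ} (hδ : 0 < δ) :
    ∃ A, ∀ ε > 0, ∀ s t, 2 * δ ≤ ‖bdryPt s - bdryPt t‖ →
      |cutError ζ ε s t| ≤ A * annulusMass ε := by
  obtain ⟨C, hC0, hC⟩ := hζ.exists_bound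
  obtain ⟨K, hK0, hK⟩ := hζ.exists_bound_near_boundary hδ
  obtain ⟨M, hM0, hM⟩ := exists_bound_deriv_smoothTransition
  refine ⟨2 * (4 * M * (K * C)), fun ε hε s t hst => ?_⟩
  have hprod : ∀ u ∈ ball (0 : ℂ) 1, |vForm ζ s u * uForm ζ (Complex.I * u) t u| ≤
      K * C * (1 - ‖u‖) * (‖u - bdryPt s‖⁻¹ + ‖u - bdryPt t‖⁻¹) := by
    intro u hu
    have hu1 : ‖u‖ < 1 := by simpa using hu
    have hs := inv_nonneg.2 (norm_nonneg (u - bdryPt s))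
    have ht := inv_nonneg.2 (norm_nonneg (u - bdryPt t))
    have hu0 : 0 ≤ 1 - ‖u‖ := by linarith
    have hI : ‖Complex.I * u‖ ≤ 1 := by simpa using hu1.le
    have h := norm_bdryPt_sub_le s t u
    rw [abs_mul]
    rcases le_or_gt δ ‖u - bdryPt s‖ with h1 | h1
    · calc |vForm ζ s u| * |uForm ζ (Complex.I * u) t u|
          ≤ (K * (1 - ‖u‖)) * (C * ‖u - bdryPt t‖⁻¹) := by
            gcongr
            · exact (hK u hu s h1).1
            · exact abs_uForm_le hC hI t hu
        _ = K * C * (1 - ‖u‖) * (0 + ‖u - bdryPt t‖⁻¹) := by ring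
        _ ≤ _ := by gcongr
    · have h2 : δ ≤ ‖u - bdryPt t‖ := by linarith
      calc |vForm ζ s u| * |uForm ζ (Complex.I * u) t u|
          ≤ (C * ‖u - bdryPt s‖⁻¹) * (K * (1 - ‖u‖)) := by
            gcongr
            · exact abs_vForm_le hC s hu
            · exact (hK u hu t h2).2
        _ = K * C * (1 - ‖u‖) * (‖u - bdryPt s‖⁻¹ + 0) := by ring
        _ ≤ _ := by gcongr
  -- The wedge of a radial covector with `ζ₁₃` evaluates `ζ₁₃` on the tangential vector `I * u`,
  -- precisely the component that vanishes on the circle.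
  have hform : ∀ u, fderiv ℝ (cutoff ε) u 1 * (vForm ζ s u * uForm ζ Complex.I t u) -
      fderiv ℝ (cutoff ε) u Complex.I * (vForm ζ s u * uForm ζ 1 t u) =
      -(deriv Real.smoothTransition ((1 - ‖u‖ ^ 2) / ε - 1) * (2 / ε) *
        (vForm ζ s u * uForm ζ (Complex.I * u) t u)) := by
    intro u
    rw [fderiv_cutoff, fderiv_cutoff, uForm_I_mul]
    simp only [Complex.inner, Complex.mul_re, Complex.conj_re, Complex.conj_im,
      Complex.I_re, Complex.I_im, Complex.one_re, Complex.one_im]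
    field_simp
    ring
  have hint : IntegrableOn (fun u => 4 * M * (K * C) *
      (‖u - bdryPt s‖⁻¹ + ‖u - bdryPt t‖⁻¹)) (annulus ε) :=
    (((integrableOn_inv_norm_sub _).add (integrableOn_inv_norm_sub _)).mono_set
      (annulus_subset_ball ε)).const_mul _
  have hmass : ∫ u in annulus ε, 4 * M * (K * C) * (‖u - bdryPt s‖⁻¹ + ‖u - bdryPt t‖⁻¹) =
      2 * (4 * M * (K * C)) * annulusMass ε := by
    rw [integral_const_mul, integral_add
      ((integrableOn_inv_norm_sub _).mono_set (annulus_subset_ball ε))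
      ((integrableOn_inv_norm_sub _).mono_set (annulus_subset_ball ε)),
      setIntegral_annulus, setIntegral_annulus]
    ring
  rw [cutError, ← hmass]
  refine abs_setIntegral_ball_le (fun u h2 => ?_) hint fun u hu => ?_
  · rw [fderiv_cutoff_eq_zero_of_ge hε h2, fderiv_cutoff_eq_zero_of_ge hε h2]
    ring
  · have hu' := annulus_subset_ball ε hu
    -- From `1 - 2 * ε ≤ ‖u‖² ≤ ‖u‖`; together with the factor `2 / ε` of the cutoff this gives the
    -- constant `4`.
    have hu1 : 1 - ‖u‖ ≤ 2 * ε := by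
      nlinarith [hu.1, hu.2, norm_nonneg u]
    have hs := inv_nonneg.2 (norm_nonneg (u - bdryPt s))
    have ht := inv_nonneg.2 (norm_nonneg (u - bdryPt t))
    rw [hform, abs_neg, abs_mul, abs_mul, abs_of_pos (show 0 < 2 / ε by positivity)]
    calc _ ≤ M * (2 / ε) *
          (K * C * (1 - ‖u‖) * (‖u - bdryPt s‖⁻¹ + ‖u - bdryPt t‖⁻¹)) := by
          gcongr
          · exact hM _
          · exact hprod u hu'
      _ ≤ M * (2 / ε) * (K * C * (2 * ε) * (‖u - bdryPt s‖⁻¹ + ‖u - bdryPt t‖⁻¹)) := by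
          gcongr
      _ = _ := by field_simp; ring

/-- The regularised functions converge pointwise and their derivatives converge to `tau` uniformly
on the open set where the moving point stays at distance more than `2 * δ` from `bdryPt t`, so the
limit may be differentiated. -/
theorem IsPropagator.hasDerivAt_zetaHat (hζ : IsPropagator m ζ) (hm : IsNormalisedTopForm m)
    {s t : ℝ} (hst : bdryPt s ≠ bdryPt t) :
    HasDerivAt (fun s => zetaHat ζ s t) (tau m ζ s) s := by
  set δ : ℝ := ‖bdryPt s - bdryPt t‖ / 4 with hδ
  have h0 : 0 < ‖bdryPt s - bdryPt t‖ := norm_pos_iff.2 (sub_ne_zero.2 hst)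
  have hδ0 : 0 < δ := by positivity
  obtain ⟨A, hA⟩ := hζ.exists_abs_cutError_le hδ0
  obtain ⟨A', hA'⟩ := hζ.exists_abs_tauCut_sub_le hm
  have hU : IsOpen {r : ℝ | 2 * δ < ‖bdryPt r - bdryPt t‖} :=
    isOpen_lt continuous_const (continuous_bdryPt.sub continuous_const).norm
  refine hasDerivAt_of_tendstoUniformlyOn (l := atTop) hU
    (f := fun n r => zetaHatCut ζ (width n) r t)
    (f' := fun n r => tauCut m ζ (width n) r - cutError ζ (width n) r t) ?_
    (Eventually.of_forall fun n r _ => hζ.hasDerivAt_zetaHatCut hm (width_pos n) r t)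
    (fun r hr => hζ.tendsto_zetaHatCut fun he => ?_) (show 2 * δ < _ by linarith)
  · rw [Metric.tendstoUniformlyOn_iff]
    intro η hη
    have hlim : Tendsto (fun n => (A' + A) * annulusMass (width n)) atTop (𝓝 0) := by
      simpa using tendsto_annulusMass.const_mul (A' + A)
    filter_upwards [hlim.eventually_lt_const hη] with n hn r hr
    rw [dist_comm, Real.dist_eq]
    have h1 := hA' _ (width_pos n) r
    have h2 := hA _ (width_pos n) r t (le_of_lt hr)
    calc |tauCut m ζ (width n) r - cutError ζ (width n) r t - tau m ζ r|
        = |(tauCut m ζ (width n) r - tau m ζ r) - cutError ζ (width n) r t| := by ring_nf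
      _ ≤ |tauCut m ζ (width n) r - tau m ζ r| + |cutError ζ (width n) r t| := abs_sub _ _
      _ < η := by linarith
  · have hr' : 2 * δ < ‖bdryPt r - bdryPt t‖ := hr
    rw [he, sub_self, norm_zero] at hr'
    linarith

theorem IsPropagator.continuous_tauCut (hζ : IsPropagator m ζ) (hm : IsNormalisedTopForm m)
    (hε : 0 < ε) : Continuous (tauCut m ζ ε) := by
  obtain ⟨C, hC0, hC⟩ := hζ.exists_bound
  obtain ⟨M, hM0, hM⟩ := hm.exists_bound
  refine continuous_of_dominated (bound := fun _ => M * (C * (ε / 2)⁻¹)) (fun s => ?_)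
    (fun s => ?_) (integrableOn_const (by simp)) ?_
  · exact (integrable_cutoff_mul hε (hm.continuousOn_ball.mul
      (hζ.continuousOn_vForm s))).integrableOn.aestronglyMeasurable
  · filter_upwards [ae_restrict_mem measurableSet_ball] with u hu
    rcases le_or_gt (1 - ε) (‖u‖ ^ 2) with h | h
    · rw [cutoff_eq_zero hε h, zero_mul, norm_zero]
      positivity
    rw [norm_mul, norm_mul, Real.norm_eq_abs, abs_of_nonneg (cutoff_nonneg _ _)]
    refine (mul_le_of_le_one_left (by positivity) (cutoff_le_one _ _)).trans ?_
    gcongr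
    · exact hM u (ball_subset_disk hu)
    · refine (abs_vForm_le hC s hu).trans ?_
      gcongr
      exact one_sub_norm_of_cutoff h.le s
  · filter_upwards [ae_restrict_mem measurableSet_ball] with u hu
    have h : Continuous fun s => vForm ζ s u := by
      refine Continuous.clm_apply (hζ.smooth.continuousOn.comp_continuous
        (continuous_const.prodMk continuous_bdryPt) fun s => mem_conf_bdryPt hu s) ?_
      exact continuous_const.prodMk (continuous_const.mul continuous_bdryPt)
    exact continuous_const.mul (continuous_const.mul h)

/-- The regularisations are continuous and converge uniformly, because the mass of the annulus does
not depend on the boundary point. -/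
theorem IsPropagator.continuous_tau (hζ : IsPropagator m ζ) (hm : IsNormalisedTopForm m) :
    Continuous (tau m ζ) := by
  obtain ⟨A', hA'⟩ := hζ.exists_abs_tauCut_sub_le hm
  refine TendstoUniformly.continuous (p := atTop) (F := fun n => tauCut m ζ (width n)) ?_
    (Eventually.of_forall fun n => hζ.continuous_tauCut hm (width_pos n)).frequently
  rw [Metric.tendstoUniformly_iff]
  intro η hη
  have hlim : Tendsto (fun n => A' * annulusMass (width n)) atTop (𝓝 0) := by
    simpa using tendsto_annulusMass.const_mul A'
  filter_upwards [hlim.eventually_lt_const hη] with n hn r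
  rw [dist_comm, Real.dist_eq]
  exact (hA' _ (width_pos n) r).trans_lt hn

end BoundaryFunction

/-! ### Circulation of the propagator and the explicit boundary function -/

section Normalisation

variable {m : ℂ → ℝ} {ζ : ℂ × ℂ → (ℂ × ℂ →L[ℝ] ℝ)}

/-- Stokes' theorem for the pullback of the propagator to a rectangle. -/
theorem IsPropagator.stokes_rectangle (hζ : IsPropagator m ζ) (hm : IsNormalisedTopForm m)
    {Γ : ℝ × ℝ → ℂ × ℂ} (hΓ : ContDiff ℝ ∞ Γ) {a b : ℝ × ℝ} (hab : a ≤ b)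
    (hmem : ∀ x ∈ Set.Icc a b, Γ x ∈ conf) :
    ∫ x in Set.Icc a b,
        -(m (Γ x).1 * area (fderiv ℝ Γ x (1, 0)).1 (fderiv ℝ Γ x (0, 1)).1) =
      (((∫ l in a.1..b.1, -ζ (Γ (l, b.2)) (fderiv ℝ Γ (l, b.2) (1, 0))) -
          ∫ l in a.1..b.1, -ζ (Γ (l, a.2)) (fderiv ℝ Γ (l, a.2) (1, 0))) +
        ∫ θ in a.2..b.2, ζ (Γ (b.1, θ)) (fderiv ℝ Γ (b.1, θ) (0, 1))) -
      ∫ θ in a.2..b.2, ζ (Γ (a.1, θ)) (fderiv ℝ Γ (a.1, θ) (0, 1)) := by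
  have hΓ' : ContDiff ℝ ∞ (fderiv ℝ Γ) := hΓ.fderiv_right (by simp)
  have hform : ∀ e : ℝ × ℝ, ContinuousOn (fun x => ζ (Γ x) (fderiv ℝ Γ x e)) (Set.Icc a b) :=
    fun e => (hζ.smooth.continuousOn.comp hΓ.continuous.continuousOn hmem).clm_apply
      (hΓ'.continuous.clm_apply continuous_const).continuousOn
  set f' : ℝ × ℝ → ℝ × ℝ → (ℝ × ℝ →L[ℝ] ℝ) := fun e x =>
    (ζ (Γ x)).comp ((fderiv ℝ (fderiv ℝ Γ) x).flip e) +
      ((fderivWithin ℝ ζ conf (Γ x)).comp (fderiv ℝ Γ x)).flip (fderiv ℝ Γ x e)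
  have hderiv : ∀ e, ∀ x ∈ (Set.Ioo a.1 b.1 ×ˢ Set.Ioo a.2 b.2) \ (∅ : Set (ℝ × ℝ)),
      HasFDerivAt (fun x => ζ (Γ x) (fderiv ℝ Γ x e)) (f' e x) x := by
    intro e x hx
    have hsub : Set.Ioo a.1 b.1 ×ˢ Set.Ioo a.2 b.2 ⊆ Set.Icc a b := fun y hy =>
      ⟨⟨hy.1.1.le, hy.2.1.le⟩, ⟨hy.1.2.le, hy.2.2.le⟩⟩
    have h1 : HasFDerivAt (fun x => ζ (Γ x))
        ((fderivWithin ℝ ζ conf (Γ x)).comp (fderiv ℝ Γ x)) x :=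
      (hζ.hasFDerivWithinAt (hmem x (hsub hx.1))).comp_hasFDerivAt x
        (hΓ.differentiable (by simp) x).hasFDerivAt (by
          filter_upwards [(isOpen_Ioo.prod isOpen_Ioo).mem_nhds hx.1] with y hy
          exact hmem y (hsub hy))
    have h2 : HasFDerivAt (fun x => fderiv ℝ Γ x e) ((fderiv ℝ (fderiv ℝ Γ) x).flip e) x := by
      have := (hΓ'.differentiable (by simp) x).hasFDerivAt.clm_apply (hasFDerivAt_const e x)
      simpa using this
    exact h1.clm_apply h2
  -- The second derivatives of `Γ` cancel by symmetry, so the divergence is the pullback of `dζ`,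
  -- that is, of `-π₁^*μ`.
  have hsum : ∀ x ∈ Set.Icc a b, f' (0, 1) x (1, 0) + (-(f' (1, 0) x)) (0, 1) =
      -(m (Γ x).1 * area (fderiv ℝ Γ x (1, 0)).1 (fderiv ℝ Γ x (0, 1)).1) := by
    intro x hx
    have hsymm : IsSymmSndFDerivAt ℝ Γ x := hΓ.contDiffAt.isSymmSndFDerivAt
      (by simpa using WithTop.coe_le_coe.2 (le_top : (2 : ℕ∞) ≤ ⊤))
    rw [← hζ.ext_deriv _ (hmem x hx)]
    simp only [f', add_apply, ContinuousLinearMap.comp_apply,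
      ContinuousLinearMap.flip_apply, neg_apply]
    rw [hsymm.eq (1, 0) (0, 1)]
    ring
  have hcont : ContinuousOn
      (fun x => -(m (Γ x).1 * area (fderiv ℝ Γ x (1, 0)).1 (fderiv ℝ Γ x (0, 1)).1))
      (Set.Icc a b) := by
    have h1 : ContinuousOn (fun x => m (Γ x).1) (Set.Icc a b) :=
      hm.smooth.continuousOn.comp hΓ.continuous.fst.continuousOn fun x hx => (hmem x hx).1
    have h2 : ∀ e : ℝ × ℝ, Continuous fun x => (fderiv ℝ Γ x e).1 := fun e =>
      (hΓ'.continuous.clm_apply continuous_const).fst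
    have h3 := h2 (1, 0)
    have h4 := h2 (0, 1)
    refine (h1.mul (Continuous.continuousOn ?_)).neg
    unfold area
    exact ((Complex.continuous_re.comp h3).mul (Complex.continuous_im.comp h4)).sub
      ((Complex.continuous_im.comp h3).mul (Complex.continuous_re.comp h4))
  rw [← integral_divergence_prod_Icc_of_hasFDerivAt_off_countable_of_le
    (fun x => ζ (Γ x) (fderiv ℝ Γ x (0, 1))) (fun x => -ζ (Γ x) (fderiv ℝ Γ x (1, 0)))
    (f' (0, 1)) (fun x => -(f' (1, 0) x)) a b hab ∅ Set.countable_empty (hform _) (hform _).neg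
    (hderiv _) (fun x hx => (hderiv _ x hx).neg)
    ((hcont.integrableOn_compact isCompact_Icc).congr_fun (fun x hx => (hsum x hx).symm)
      measurableSet_Icc)]
  exact setIntegral_congr_fun measurableSet_Icc fun x hx => (hsum x hx).symm

/-- The homotopy from `v` moving around the boundary of the disk to `u` moving around `v`. -/
def homotopy (u : ℂ) (ρ : ℝ) (x : ℝ × ℝ) : ℂ × ℂ :=
  (u - (x.1 * ρ) • bdryPt x.2, (1 - x.1) • bdryPt x.2 + x.1 • u)

theorem contDiff_homotopy (u : ℂ) (ρ : ℝ) : ContDiff ℝ ∞ (homotopy u ρ) := by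
  have hb : ContDiff ℝ ∞ fun x : ℝ × ℝ => bdryPt x.2 :=
    (contDiff_circleMap 0 1).comp contDiff_snd
  unfold homotopy
  fun_prop

theorem fderiv_homotopy_fst (u : ℂ) (ρ l θ : ℝ) :
    fderiv ℝ (homotopy u ρ) (l, θ) (1, 0) = (-(ρ • bdryPt θ), u - bdryPt θ) := by
  have h1 := ((contDiff_homotopy u ρ).differentiable (by simp) (l, θ)).hasFDerivAt.comp_hasDerivAt l
    ((hasDerivAt_id l).prodMk (hasDerivAt_const l θ))
  refine h1.unique ?_
  have h2 : HasDerivAt (fun r : ℝ => u - (r * ρ) • bdryPt θ) (-(ρ • bdryPt θ)) l := by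
    simpa using (((hasDerivAt_id l).mul_const ρ).smul_const (bdryPt θ)).const_sub u
  have h3 : HasDerivAt (fun r : ℝ => (1 - r) • bdryPt θ + r • u) (u - bdryPt θ) l := by
    have := (((hasDerivAt_id l).const_sub 1).smul_const (bdryPt θ)).add
      ((hasDerivAt_id l).smul_const u)
    exact this.congr_deriv (by rw [neg_smul, one_smul, one_smul]; abel)
  exact h2.prodMk h3

theorem fderiv_homotopy_snd (u : ℂ) (ρ l θ : ℝ) :
    fderiv ℝ (homotopy u ρ) (l, θ) (0, 1) =
      (-((l * ρ) • (Complex.I * bdryPt θ)), (1 - l) • (Complex.I * bdryPt θ)) := by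
  have h1 := ((contDiff_homotopy u ρ).differentiable (by simp) (l, θ)).hasFDerivAt.comp_hasDerivAt θ
    ((hasDerivAt_const θ l).prodMk (hasDerivAt_id θ))
  refine h1.unique ?_
  have h2 : HasDerivAt (fun x => (1 - l) • bdryPt x + l • u) ((1 - l) • (Complex.I * bdryPt θ)) θ :=
    ((hasDerivAt_bdryPt θ).const_smul (1 - l)).add_const (l • u)
  exact (((hasDerivAt_bdryPt θ).const_smul (l * ρ)).const_sub u).prodMk h2

/-- A coincidence of the two points would give `(1 - l) ‖u‖ = 1 - l + l ρ`. For `l = 0` this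
contradicts `‖u‖ < 1`, and for `l > 0` the right side is strictly larger. -/
theorem homotopy_mem_conf {u : ℂ} {ρ : ℝ} (hρ : 0 < ρ) (hu : ‖u‖ < 1) (huρ : ‖u‖ + ρ ≤ 1)
    {l : ℝ} (hl0 : 0 ≤ l) (hl1 : l ≤ 1) (θ : ℝ) : homotopy u ρ (l, θ) ∈ conf := by
  have hlρ : 0 ≤ l * ρ := by positivity
  have h1l : 0 ≤ 1 - l := by linarith
  refine ⟨?_, ?_, fun he => ?_⟩
  · rw [disk, mem_closedBall_zero_iff]
    refine (norm_sub_le _ _).trans ?_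
    rw [norm_smul, norm_bdryPt, mul_one, Real.norm_eq_abs, abs_of_nonneg hlρ]
    nlinarith
  · rw [disk, mem_closedBall_zero_iff]
    refine (norm_add_le _ _).trans ?_
    rw [norm_smul, norm_smul, norm_bdryPt, mul_one, Real.norm_eq_abs, abs_of_nonneg h1l,
      Real.norm_eq_abs, abs_of_nonneg hl0]
    nlinarith
  · have h : (1 - l) • u = (1 - l + l * ρ) • bdryPt θ := by
      simp only [homotopy] at he
      have := sub_eq_zero.2 he
      rw [← sub_eq_zero, ← this]
      module
    have hn := congrArg norm h
    rw [norm_smul, norm_smul, norm_bdryPt, mul_one, Real.norm_eq_abs, abs_of_nonneg h1l,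
      Real.norm_eq_abs, abs_of_nonneg (by linarith)] at hn
    rcases hl0.eq_or_lt with rfl | hl0
    · linarith
    · have : 0 < l * ρ := by positivity
      nlinarith

/-- The circulation of the boundary vertex around a bulk vertex is `1`. -/
theorem IsPropagator.integral_vForm (hζ : IsPropagator m ζ) (hm : IsNormalisedTopForm m) {u : ℂ}
    (hu : u ∈ ball (0 : ℂ) 1) : ∫ θ in (0 : ℝ)..(2 * Real.pi), vForm ζ θ u = 1 := by
  obtain ⟨M, hM0, hM⟩ := hm.exists_bound
  have hu1 : ‖u‖ < 1 := by simpa using hu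
  set J : ℝ → ℝ := fun ρ => ∫ θ in (0 : ℝ)..(2 * Real.pi),
    ζ (circleMap u ρ θ, u) (deriv (circleMap u ρ) θ, 0)
  -- The two circulations differ by the integral of `μ` over the small disk swept by the bulk
  -- vertex, hence by `O(ρ²)`.
  have hJ : ∀ ρ, 0 < ρ → ‖u‖ + ρ ≤ 1 →
      |J ρ - ∫ θ in (0 : ℝ)..(2 * Real.pi), vForm ζ θ u| ≤ M * ρ ^ 2 * (2 * Real.pi) := by
    intro ρ hρ huρ
    have hle : ((0 : ℝ), (0 : ℝ)) ≤ (1, 2 * Real.pi) := ⟨zero_le_one, Real.two_pi_pos.le⟩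
    have hmem : ∀ x ∈ Set.Icc ((0 : ℝ), (0 : ℝ)) (1, 2 * Real.pi), homotopy u ρ x ∈ conf :=
      fun x hx => homotopy_mem_conf hρ hu1 huρ hx.1.1 hx.2.1 x.2
    have hst := hζ.stokes_rectangle hm (contDiff_homotopy u ρ) hle hmem
    simp only [fderiv_homotopy_fst, fderiv_homotopy_snd] at hst
    have hper : bdryPt (2 * Real.pi) = bdryPt 0 := by simpa using bdryPt_periodic 0
    -- The sides `θ = 0` and `θ = 2π` of the rectangle have the same image and cancel in Stokes'
    -- theorem.
    have hcancel : ∀ l : ℝ, homotopy u ρ (l, 2 * Real.pi) = homotopy u ρ (l, 0) := fun l => by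
      simp [homotopy, hper]
    simp only [hcancel, hper, sub_self, zero_add] at hst
    -- At the end of the homotopy the bulk vertex is at `u - ρ e^{iθ}`, half a turn ahead of the
    -- standard parametrisation of the circle; periodicity absorbs the shift by `π`.
    have hJ1 : J ρ = ∫ θ in (0 : ℝ)..(2 * Real.pi), ζ (homotopy u ρ (1, θ))
        (-((1 * ρ) • (Complex.I * bdryPt θ)), (0 : ℝ) • (Complex.I * bdryPt θ)) := by
      have hp : Function.Periodic
          (fun θ => ζ (circleMap u ρ θ, u) (deriv (circleMap u ρ) θ, 0)) (2 * Real.pi) := by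
        intro θ
        simp only [deriv_circleMap, periodic_circleMap _ _ θ]
      have h1 := hp.intervalIntegral_add_eq 0 Real.pi
      rw [zero_add] at h1
      have h2 := intervalIntegral.integral_comp_add_right (a := 0) (b := 2 * Real.pi)
        (fun θ => ζ (circleMap u ρ θ, u) (deriv (circleMap u ρ) θ, 0)) Real.pi
      rw [zero_add, add_comm (2 * Real.pi)] at h2
      refine h1.trans (h2.symm.trans ?_)
      refine intervalIntegral.integral_congr fun θ _ => ?_
      have hc : circleMap 0 ρ (θ + Real.pi) = -(ρ • bdryPt θ) := by
        simp [circleMap, bdryPt, add_mul, Complex.exp_add]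
      have hc' : circleMap u ρ (θ + Real.pi) = u - ρ • bdryPt θ := by
        have := circleMap_sub_center u ρ (θ + Real.pi)
        rw [hc] at this
        rw [eq_add_of_sub_eq this]
        abel
      simp only [deriv_circleMap, hc, hc', homotopy]
      simp [mul_comm]
      rw [mul_left_comm]
    have hJ0 : ∫ θ in (0 : ℝ)..(2 * Real.pi), vForm ζ θ u =
        ∫ θ in (0 : ℝ)..(2 * Real.pi), ζ (homotopy u ρ (0, θ))
        (-((0 * ρ) • (Complex.I * bdryPt θ)), (1 - 0 : ℝ) • (Complex.I * bdryPt θ)) := by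
      refine intervalIntegral.integral_congr fun θ _ => ?_
      simp [vForm, homotopy]
    rw [hJ1, hJ0, ← hst]
    have hvol : volume.real (Set.Icc ((0 : ℝ), (0 : ℝ)) (1, 2 * Real.pi)) = 2 * Real.pi := by
      rw [← Set.Icc_prod_Icc, Measure.volume_eq_prod, measureReal_prod_prod]
      simp [Real.two_pi_pos.le]
    have hfin : volume (Set.Icc ((0 : ℝ), (0 : ℝ)) (1, 2 * Real.pi)) < ⊤ :=
      isCompact_Icc.measure_lt_top
    have hbd : ∀ x ∈ Set.Icc ((0 : ℝ), (0 : ℝ)) (1, 2 * Real.pi),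
        ‖-(m (homotopy u ρ x).1 * area (fderiv ℝ (homotopy u ρ) x (1, 0)).1
          (fderiv ℝ (homotopy u ρ) x (0, 1)).1)‖ ≤ M * ρ ^ 2 := ?_
    · have h := norm_setIntegral_le_of_norm_le_const hfin hbd
      rwa [hvol, Real.norm_eq_abs] at h
    intro x hx
    have harea : area (-(ρ • bdryPt x.2)) (-((x.1 * ρ) • (Complex.I * bdryPt x.2))) =
        x.1 * ρ ^ 2 := by
      have h1 : (bdryPt x.2).re ^ 2 + (bdryPt x.2).im ^ 2 = 1 := by
        have := Complex.sq_norm (bdryPt x.2)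
        rw [norm_bdryPt, Complex.normSq_apply] at this
        linarith
      simp only [area, Complex.neg_re, Complex.neg_im, Complex.smul_re, Complex.smul_im,
        Complex.mul_re, Complex.mul_im, Complex.I_re, Complex.I_im, smul_eq_mul]
      linear_combination (x.1 * ρ ^ 2) * h1
    have hfst := fderiv_homotopy_fst u ρ x.1 x.2
    have hsnd := fderiv_homotopy_snd u ρ x.1 x.2
    rw [Prod.mk.eta] at hfst hsnd
    have hx0 : 0 ≤ x.1 := hx.1.1
    have hx1 : x.1 ≤ 1 := hx.2.1
    rw [hfst, hsnd, harea, norm_neg, norm_mul, Real.norm_eq_abs, Real.norm_eq_abs,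
      abs_of_nonneg (by positivity : 0 ≤ x.1 * ρ ^ 2)]
    gcongr
    · exact hM _ (hmem x hx).1
    · exact mul_le_of_le_one_left (by positivity) hx1
  have h1 := hζ.normalised u hu1
  have h2 : Tendsto (fun ρ : ℝ => M * ρ ^ 2 * (2 * Real.pi)) (𝓝[>] 0) (𝓝 0) := by
    have : Continuous fun ρ : ℝ => M * ρ ^ 2 * (2 * Real.pi) := by fun_prop
    simpa using (this.tendsto 0).mono_left nhdsWithin_le_nhds
  have h3 : Tendsto J (𝓝[>] 0) (𝓝 (∫ θ in (0 : ℝ)..(2 * Real.pi), vForm ζ θ u)) := by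
    rw [tendsto_iff_dist_tendsto_zero]
    refine squeeze_zero' (Eventually.of_forall fun _ => dist_nonneg) ?_ h2
    filter_upwards [Ioo_mem_nhdsGT (show (0 : ℝ) < 1 - ‖u‖ by linarith)] with ρ hρ
    exact hJ ρ hρ.1 (by linarith [hρ.2])
  exact tendsto_nhds_unique h3 h1

/-- By Fubini the integral is that of `m` against the circulation of `ζ(u, ·)`, which is `1` for
every interior `u`. Integrability of the double integrand follows from the pole bound, whose
integral over the disk is the same for all boundary vertices. -/
theorem IsPropagator.integral_tau (hζ : IsPropagator m ζ) (hm : IsNormalisedTopForm m) :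
    ∫ s in (0 : ℝ)..(2 * Real.pi), tau m ζ s = 1 := by
  obtain ⟨C, hC0, hC⟩ := hζ.exists_bound
  obtain ⟨M, hM0, hM⟩ := hm.exists_bound
  set μs := (volume : Measure ℝ).restrict (Set.Ioc 0 (2 * Real.pi))
  set μu := (volume : Measure ℂ).restrict (ball 0 1)
  have hmeas : AEStronglyMeasurable
      (fun q : ℝ × ℂ => m q.2 * vForm ζ q.1 q.2) (μs.prod μu) := by
    rw [Measure.prod_restrict]
    refine ContinuousOn.aestronglyMeasurable ?_ (measurableSet_Ioc.prod measurableSet_ball)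
    have h1 : ContinuousOn (fun q : ℝ × ℂ => m q.2) (Set.Ioc 0 (2 * Real.pi) ×ˢ ball 0 1) :=
      hm.continuousOn_ball.comp continuousOn_snd fun q hq => hq.2
    refine h1.mul (ContinuousOn.clm_apply ?_ ?_)
    · exact hζ.smooth.continuousOn.comp (continuous_snd.prodMk
        (continuous_bdryPt.comp continuous_fst)).continuousOn
        fun q hq => mem_conf_bdryPt hq.2 q.1
    · exact (continuous_const.prodMk (continuous_const.mul
        (continuous_bdryPt.comp continuous_fst))).continuousOn
  have hint : Integrable (fun q : ℝ × ℂ => m q.2 * vForm ζ q.1 q.2) (μs.prod μu) := by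
    rw [integrable_prod_iff hmeas]
    refine ⟨Eventually.of_forall fun s => hζ.integrableOn_tau hm s, ?_⟩
    refine Integrable.mono'
      (g := fun _ => M * (C * ∫ u in ball (0 : ℂ) 1, ‖u - bdryPt 0‖⁻¹))
      (integrableOn_const (by rw [Real.volume_Ioc]; exact ENNReal.ofReal_ne_top)) hmeas.norm.integral_prod_right' ?_
    refine Eventually.of_forall fun s => ?_
    rw [Real.norm_eq_abs, abs_of_nonneg (integral_nonneg fun _ => norm_nonneg _),
      ← setIntegral_ball_inv_norm_sub s, ← integral_const_mul, ← integral_const_mul]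
    refine setIntegral_mono_on (hζ.integrableOn_tau hm s).norm
      (((integrableOn_inv_norm_sub _).const_mul _).const_mul _) measurableSet_ball fun u hu => ?_
    rw [norm_mul]
    exact mul_le_mul (hM u (ball_subset_disk hu)) (abs_vForm_le hC s hu) (norm_nonneg _) hM0
  have hswap := integral_integral_swap (μ := μs) (ν := μu)
    (f := fun s u => m u * vForm ζ s u) hint
  rw [intervalIntegral.integral_of_le Real.two_pi_pos.le]
  simp only [tau_eq]
  rw [hswap, ← hm.integral_eq_one, setIntegral_congr_set disk_ae_eq_ball]
  refine setIntegral_congr_fun measurableSet_ball fun u hu => ?_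
  simp only [μs]
  rw [integral_const_mul, ← intervalIntegral.integral_of_le Real.two_pi_pos.le,
    hζ.integral_vForm hm hu, mul_one]

theorem zetaHat_swap (ζ : ℂ × ℂ → (ℂ × ℂ →L[ℝ] ℝ)) (s t : ℝ) :
    zetaHat ζ t s = -zetaHat ζ s t := by
  rw [zetaHat, zetaHat, ← integral_neg]
  congr 1
  funext u
  ring

theorem zetaHat_add_two_pi (ζ : ℂ × ℂ → (ℂ × ℂ →L[ℝ] ℝ)) (s t : ℝ) :
    zetaHat ζ (s + 2 * Real.pi) t = zetaHat ζ s t := by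
  simp only [zetaHat, bdryPt_periodic s]

theorem tau_periodic (m : ℂ → ℝ) (ζ : ℂ × ℂ → (ℂ × ℂ →L[ℝ] ℝ)) :
    Function.Periodic (tau m ζ) (2 * Real.pi) := fun s => by
  simp only [tau, deriv_bdryPt, bdryPt_periodic s]

theorem IsPropagator.zetaHat_sub (hζ : IsPropagator m ζ) (hm : IsNormalisedTopForm m)
    {s₀ s₁ t : ℝ} (h : ∀ r ∈ Set.uIcc s₀ s₁, r ≠ t ∧ |r - t| < 2 * Real.pi) :
    zetaHat ζ s₁ t - zetaHat ζ s₀ t = ∫ s in s₀..s₁, tau m ζ s :=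
  (intervalIntegral.integral_eq_sub_of_hasDerivAt
    (fun r hr => hζ.hasDerivAt_zetaHat hm (bdryPt_ne (h r hr).1 (h r hr).2))
    ((hζ.continuous_tau hm).intervalIntegrable _ _)).symm

/-- The boundary function is determined by `τ`; its jump across the diagonal is the normalisation
of the propagator. -/
theorem IsPropagator.zetaHat_eq_of_lt (hζ : IsPropagator m ζ) (hm : IsNormalisedTopForm m)
    {s t : ℝ} (hst : t < s) (hts : s < t + 2 * Real.pi) :
    zetaHat ζ s t = (∫ r in t..s, tau m ζ r) - 1 / 2 := by
  -- A third point, on the arc from `s` back to `t`. Moving along each of the three arcs with the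
  -- opposite point fixed never crosses the diagonal. With antisymmetry, periodicity and total mass
  -- `1` of `τ`, the three increments are linear equations for the three pairwise values of the
  -- boundary function, and they determine them.
  set r : ℝ := (s + (t + 2 * Real.pi)) / 2 with hr
  have hI : ∀ x y, IntervalIntegrable (tau m ζ) volume x y := fun x y =>
    (hζ.continuous_tau hm).intervalIntegrable x y
  have h1 : zetaHat ζ r t - zetaHat ζ s t = ∫ x in s..r, tau m ζ x :=
    hζ.zetaHat_sub hm fun x hx => by
      rw [Set.uIcc_of_le (by linarith)] at hx
      have ha := hx.1
      have hb := hx.2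
      exact ⟨by linarith, by rw [abs_lt]; constructor <;> linarith⟩
  have h2 : zetaHat ζ s r - zetaHat ζ t r = ∫ x in t..s, tau m ζ x :=
    hζ.zetaHat_sub hm fun x hx => by
      rw [Set.uIcc_of_le (by linarith)] at hx
      have ha := hx.1
      have hb := hx.2
      exact ⟨by linarith, by rw [abs_lt]; constructor <;> linarith⟩
  have h3 : zetaHat ζ (t + 2 * Real.pi) s - zetaHat ζ r s =
      ∫ x in r..(t + 2 * Real.pi), tau m ζ x :=
    hζ.zetaHat_sub hm fun x hx => by
      rw [Set.uIcc_of_le (by linarith)] at hx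
      have ha := hx.1
      have hb := hx.2
      exact ⟨by linarith, by rw [abs_lt]; constructor <;> linarith⟩
  have h4 : ∫ x in t..(t + 2 * Real.pi), tau m ζ x = 1 := by
    rw [(tau_periodic m ζ).intervalIntegral_add_eq t 0, zero_add, hζ.integral_tau hm]
  rw [zetaHat_swap ζ r s, zetaHat_swap ζ r t] at h2
  rw [zetaHat_add_two_pi, zetaHat_swap ζ s t] at h3
  have h5 := intervalIntegral.integral_add_adjacent_intervals (hI t s) (hI s r)
  have h6 := intervalIntegral.integral_add_adjacent_intervals (hI t r) (hI r (t + 2 * Real.pi))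
  linarith

theorem IsPropagator.hasDerivAt_integral_tau (hζ : IsPropagator m ζ)
    (hm : IsNormalisedTopForm m) (a s : ℝ) :
    HasDerivAt (fun s => ∫ r in a..s, tau m ζ r) (tau m ζ s) s :=
  (hζ.continuous_tau hm).integral_hasStrictDerivAt a s |>.hasDerivAt

/-- The explicit formula is a difference of primitives of `τ` in each variable, so joint
differentiability needs no further estimate. -/
theorem IsPropagator.hasFDerivAt_zetaHat_of_lt (hζ : IsPropagator m ζ)
    (hm : IsNormalisedTopForm m) {s t : ℝ} (hst : t < s) (hts : s < t + 2 * Real.pi) :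
    HasFDerivAt (fun q : ℝ × ℝ => zetaHat ζ q.1 q.2)
      (tau m ζ s • ContinuousLinearMap.fst ℝ ℝ ℝ - tau m ζ t • ContinuousLinearMap.snd ℝ ℝ ℝ)
      (s, t) := by
  have h1 := (hζ.hasDerivAt_integral_tau hm 0 s).comp_hasFDerivAt (f := Prod.fst) (s, t)
    (_root_.hasFDerivAt_fst (𝕜 := ℝ) (p := (s, t)))
  have h2 := (hζ.hasDerivAt_integral_tau hm 0 t).comp_hasFDerivAt (f := Prod.snd) (s, t)
    (hasFDerivAt_snd (𝕜 := ℝ) (p := (s, t)))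
  refine ((h1.sub h2).sub_const (1 / 2)).congr_of_eventuallyEq ?_
  have hU : IsOpen {q : ℝ × ℝ | q.2 < q.1 ∧ q.1 < q.2 + 2 * Real.pi} :=
    (isOpen_lt continuous_snd continuous_fst).inter
      (isOpen_lt continuous_fst (continuous_snd.add continuous_const))
  filter_upwards [hU.mem_nhds (show (s, t) ∈ _ from ⟨hst, hts⟩)] with q hq
  have hI : ∀ x y, IntervalIntegrable (tau m ζ) volume x y := fun x y =>
    (hζ.continuous_tau hm).intervalIntegrable x y
  have := intervalIntegral.integral_add_adjacent_intervals (hI 0 q.2) (hI q.2 q.1)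
  rw [hζ.zetaHat_eq_of_lt hm hq.1 hq.2]
  simp only [Function.comp, Pi.sub_apply]
  linarith

theorem IsPropagator.hasFDerivAt_zetaHat (hζ : IsPropagator m ζ)
    (hm : IsNormalisedTopForm m) {s t : ℝ} (hst : s ≠ t) (h : |s - t| < 2 * Real.pi) :
    HasFDerivAt (fun q : ℝ × ℝ => zetaHat ζ q.1 q.2)
      (tau m ζ s • ContinuousLinearMap.fst ℝ ℝ ℝ - tau m ζ t • ContinuousLinearMap.snd ℝ ℝ ℝ)
      (s, t) := by
  obtain ⟨ha, hb⟩ := abs_lt.1 h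
  rcases lt_or_gt_of_ne hst with h1 | h1
  · have h2 := (hζ.hasFDerivAt_zetaHat_of_lt hm h1 (by linarith)).comp (s, t)
      ((hasFDerivAt_snd (𝕜 := ℝ) (p := (s, t))).prodMk (_root_.hasFDerivAt_fst (𝕜 := ℝ) (p := (s, t))))
    refine (h2.neg.congr_of_eventuallyEq
      (Eventually.of_forall fun q => zetaHat_swap ζ q.2 q.1)).congr_fderiv ?_
    ext <;> simp
  · exact hζ.hasFDerivAt_zetaHat_of_lt hm h1 (by linarith)

end Normalisation

/-! ### The integral operator with kernel `zetaHat` on the arc -/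

section Interval

variable {m : ℂ → ℝ} {ζ : ℂ × ℂ → (ℂ × ℂ →L[ℝ] ℝ)} {a b : ℝ}

theorem intervalIntegrable_of_Icc {f : ℝ → ℝ} (hab : a ≤ b) (hf : ContinuousOn f (Set.Icc a b)) :
    IntervalIntegrable f volume a b := hf.intervalIntegrable_of_Icc hab

theorem intervalIntegrable_mul {f g : ℝ → ℝ} (hab : a ≤ b) (hf : ContinuousOn f (Set.Icc a b))
    (hg : ContinuousOn g (Set.Icc a b)) : IntervalIntegrable (fun t => f t * g t) volume a b :=
  intervalIntegrable_of_Icc hab (hf.mul hg)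

theorem hasDerivAt_integral_of_mem_Ioo {f : ℝ → ℝ} (hf : ContinuousOn f (Set.Icc a b)) {s : ℝ}
    (hs : s ∈ Set.Ioo a b) : HasDerivAt (fun s => ∫ t in a..s, f t) (f s) s := by
  have hn : Set.Icc a b ∈ 𝓝 s := Icc_mem_nhds hs.1 hs.2
  refine intervalIntegral.integral_hasDerivAt_right
    ((hf.mono (Set.Icc_subset_Icc_right hs.2.le)).intervalIntegrable_of_Icc hs.1.le)
    ⟨Set.Icc a b, hn, hf.aestronglyMeasurable measurableSet_Icc⟩ (hf.continuousAt hn)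

theorem continuousOn_integral {f : ℝ → ℝ} (hab : a ≤ b) (hf : ContinuousOn f (Set.Icc a b)) :
    ContinuousOn (fun s => ∫ t in a..s, f t) (Set.Icc a b) := by
  have := intervalIntegral.continuousOn_primitive_interval (f := f) (a := a) (b := b)
    (μ := volume) (by rw [Set.uIcc_of_le hab]; exact hf.integrableOn_Icc)
  rwa [Set.uIcc_of_le hab] at this

/-- Integration by parts for functions that vanish at the end points. -/
theorem integral_deriv_mul_eq_neg {E E' K K' : ℝ → ℝ} (hab : a ≤ b)
    (hE : ContinuousOn E (Set.Icc a b)) (hE' : ContinuousOn E' (Set.Icc a b))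
    (hK : ContinuousOn K (Set.Icc a b)) (hK' : ContinuousOn K' (Set.Icc a b))
    (hd : ∀ t ∈ Set.Ioo a b, HasDerivAt E (E' t) t)
    (hdK : ∀ t ∈ Set.Ioo a b, HasDerivAt K (K' t) t) (ha : E a = 0) (hb : E b = 0) :
    ∫ t in a..b, E' t * K t = -∫ t in a..b, E t * K' t := by
  have h1 := intervalIntegrable_of_Icc hab (hE'.mul hK)
  have h2 := intervalIntegrable_of_Icc hab (hE.mul hK')
  have h3 := intervalIntegral.integral_eq_sub_of_hasDerivAt_of_le hab (hE.mul hK)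
    (fun t ht => (hd t ht).mul (hdK t ht)) (h1.add h2)
  have h4 := intervalIntegral.integral_add h1 h2
  simp only [Pi.mul_apply, ha, hb, zero_mul, sub_zero] at h3 h4
  linarith

/-- The integral operator on `[a, b]` with kernel `zetaHat`, in terms of `τ`. -/
def kernelOp (σ : ℝ → ℝ) (a b : ℝ) (g : ℝ → ℝ) (s : ℝ) : ℝ :=
  (∫ r in a..s, σ r) * (∫ t in a..b, g t) - (∫ t in a..b, (∫ r in a..t, σ r) * g t) -
    ((∫ t in a..s, g t) - 1 / 2 * ∫ t in a..b, g t)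

/-- The kernel is `F s - F t - 1 / 2` to the left of `s` and `F s - F t + 1 / 2` to the right; the
diagonal point has measure zero. This uses that the arc is shorter than a full turn. -/
theorem IsPropagator.integral_zetaHat_mul (hζ : IsPropagator m ζ) (hm : IsNormalisedTopForm m)
    (hba : b < a + 2 * Real.pi) {g : ℝ → ℝ} (hg : ContinuousOn g (Set.Icc a b)) {s : ℝ}
    (hs : s ∈ Set.Icc a b) :
    ∫ t in a..b, zetaHat ζ s t * g t = kernelOp (tau m ζ) a b g s := by
  have hτ := hζ.continuous_tau hm
  have hI : ∀ x y, IntervalIntegrable (tau m ζ) volume x y := fun x y => hτ.intervalIntegrable x y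
  set F : ℝ → ℝ := fun s => ∫ r in a..s, tau m ζ r with hF
  have hFc : Continuous F := intervalIntegral.continuous_primitive hI a
  have hFsub : ∀ x y, ∫ r in x..y, tau m ζ r = F y - F x := fun x y =>
    (intervalIntegral.integral_interval_sub_left (hI a y) (hI a x)).symm
  have hne : ∀ᵐ t : ℝ, t ≠ s := by simp [ae_iff, measure_singleton]
  have hc1 : ∀ c : ℝ, ContinuousOn (fun t => (F s - F t + c) * g t) (Set.Icc a b) := fun c =>
    (((continuous_const.sub hFc).add continuous_const).continuousOn).mul hg
  have hl : ∀ᵐ t : ℝ, t ∈ Set.uIoc a s →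
      zetaHat ζ s t * g t = (F s - F t + (-(1 / 2))) * g t := by
    filter_upwards [hne] with t ht hts
    rw [Set.uIoc_of_le hs.1] at hts
    rw [hζ.zetaHat_eq_of_lt hm (lt_of_le_of_ne hts.2 ht) (by linarith [hs.2, hts.1]), hFsub]
    ring
  have hr : ∀ᵐ t : ℝ, t ∈ Set.uIoc s b →
      zetaHat ζ s t * g t = (F s - F t + 1 / 2) * g t := by
    filter_upwards with t hts
    rw [Set.uIoc_of_le hs.2] at hts
    rw [zetaHat_swap, hζ.zetaHat_eq_of_lt hm hts.1 (by linarith [hs.1, hts.2]), hFsub]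
    ring
  have il : ∀ c, IntervalIntegrable (fun t => (F s - F t + c) * g t) volume a s := fun c =>
    intervalIntegrable_of_Icc hs.1 ((hc1 c).mono (Set.Icc_subset_Icc_right hs.2))
  have ir : ∀ c, IntervalIntegrable (fun t => (F s - F t + c) * g t) volume s b := fun c =>
    intervalIntegrable_of_Icc hs.2 ((hc1 c).mono (Set.Icc_subset_Icc_left hs.1))
  have gl : IntervalIntegrable g volume a s :=
    intervalIntegrable_of_Icc hs.1 (hg.mono (Set.Icc_subset_Icc_right hs.2))
  have gr : IntervalIntegrable g volume s b :=
    intervalIntegrable_of_Icc hs.2 (hg.mono (Set.Icc_subset_Icc_left hs.1))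
  have il' : IntervalIntegrable (fun t => zetaHat ζ s t * g t) volume a s :=
    (il _).congr_ae (by
      rw [Filter.EventuallyEq, ae_restrict_iff' measurableSet_uIoc]
      filter_upwards [hl] with t ht h using (ht h).symm)
  have ir' : IntervalIntegrable (fun t => zetaHat ζ s t * g t) volume s b :=
    (ir _).congr_ae (by
      rw [Filter.EventuallyEq, ae_restrict_iff' measurableSet_uIoc]
      filter_upwards [hr] with t ht h using (ht h).symm)
  have hab : a ≤ b := hs.1.trans hs.2
  have el : ∫ t in a..s, (F s - F t + (-(1 / 2))) * g t =
      (∫ t in a..s, (F s - F t + 0) * g t) + (-(1 / 2)) * ∫ t in a..s, g t := by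
    rw [← intervalIntegral.integral_const_mul, ← intervalIntegral.integral_add (il 0)
      (gl.const_mul _)]
    exact intervalIntegral.integral_congr fun t _ => by ring
  have er : ∫ t in s..b, (F s - F t + 1 / 2) * g t =
      (∫ t in s..b, (F s - F t + 0) * g t) + (1 / 2) * ∫ t in s..b, g t := by
    rw [← intervalIntegral.integral_const_mul, ← intervalIntegral.integral_add (ir 0)
      (gr.const_mul _)]
    exact intervalIntegral.integral_congr fun t _ => by ring
  have e0 := intervalIntegral.integral_add_adjacent_intervals (il 0) (ir 0)
  have eg := intervalIntegral.integral_add_adjacent_intervals gl gr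
  have hFg : IntervalIntegrable (fun t => F t * g t) volume a b :=
    intervalIntegrable_of_Icc hab (hFc.continuousOn.mul hg)
  have e1 : ∫ t in a..b, (F s - F t + 0) * g t =
      F s * (∫ t in a..b, g t) - ∫ t in a..b, F t * g t := by
    rw [← intervalIntegral.integral_const_mul, ← intervalIntegral.integral_sub
      ((gl.trans gr).const_mul _) hFg]
    exact intervalIntegral.integral_congr fun t _ => by ring
  rw [← intervalIntegral.integral_add_adjacent_intervals il' ir',
    intervalIntegral.integral_congr_ae hl, intervalIntegral.integral_congr_ae hr, el, er, kernelOp]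
  linarith

variable {σ : ℝ → ℝ}

theorem continuousOn_kernelOp (hσ : Continuous σ) (hab : a ≤ b) {g : ℝ → ℝ}
    (hg : ContinuousOn g (Set.Icc a b)) : ContinuousOn (kernelOp σ a b g) (Set.Icc a b) := by
  have h1 := continuousOn_integral hab hσ.continuousOn
  have h2 := continuousOn_integral hab hg
  exact ((h1.mul continuousOn_const).sub continuousOn_const).sub (h2.sub continuousOn_const)

/-- The local term `-g s` is the contribution of the jump of the kernel across the diagonal. -/
theorem hasDerivAt_kernelOp (hσ : Continuous σ) {g : ℝ → ℝ}
    (hg : ContinuousOn g (Set.Icc a b)) {s : ℝ} (hs : s ∈ Set.Ioo a b) :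
    HasDerivAt (kernelOp σ a b g) (σ s * (∫ t in a..b, g t) - g s) s :=
  (((hasDerivAt_integral_of_mem_Ioo hσ.continuousOn hs).mul_const _).sub_const _).sub
    ((hasDerivAt_integral_of_mem_Ioo hg hs).sub_const _)

theorem kernelOp_add (hσ : Continuous σ) (hab : a ≤ b) {g g' : ℝ → ℝ}
    (hg : ContinuousOn g (Set.Icc a b)) (hg' : ContinuousOn g' (Set.Icc a b)) {s : ℝ}
    (hs : s ∈ Set.Icc a b) :
    kernelOp σ a b (fun t => g t + g' t) s = kernelOp σ a b g s + kernelOp σ a b g' s := by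
  have hF := continuousOn_integral hab hσ.continuousOn
  have hsub : Set.Icc a s ⊆ Set.Icc a b := Set.Icc_subset_Icc_right hs.2
  simp only [kernelOp, mul_add]
  rw [intervalIntegral.integral_add (intervalIntegrable_of_Icc hab hg)
      (intervalIntegrable_of_Icc hab hg'),
    intervalIntegral.integral_add (intervalIntegrable_of_Icc hs.1 (hg.mono hsub))
      (intervalIntegrable_of_Icc hs.1 (hg'.mono hsub)),
    intervalIntegral.integral_add (intervalIntegrable_mul hab hF hg)
      (intervalIntegrable_mul hab hF hg')]
  ring

theorem kernelOp_smul (c : ℝ) (g : ℝ → ℝ) (s : ℝ) :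
    kernelOp σ a b (fun t => c * g t) s = c * kernelOp σ a b g s := by
  simp only [kernelOp, mul_left_comm _ c, intervalIntegral.integral_const_mul]
  ring

theorem integral_eq_of_vanish {E E' : ℝ → ℝ} (hE : ContinuousOn E (Set.Icc a b))
    (hE' : ContinuousOn E' (Set.Icc a b)) (hd : ∀ t ∈ Set.Ioo a b, HasDerivAt E (E' t) t)
    (ha : E a = 0) {s : ℝ} (hs : s ∈ Set.Icc a b) : ∫ t in a..s, E' t = E s := by
  have hsub : Set.Icc a s ⊆ Set.Icc a b := Set.Icc_subset_Icc_right hs.2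
  rw [intervalIntegral.integral_eq_sub_of_hasDerivAt_of_le hs.1 (hE.mono hsub)
    (fun t ht => hd t ⟨ht.1, ht.2.trans_le hs.2⟩)
    (intervalIntegrable_of_Icc hs.1 (hE'.mono hsub)), ha, sub_zero]

/-- Integration by parts moves the derivative from `E` to the primitive of `σ`. As `E` vanishes at
both ends, the total integral of `E'` drops out and the jump leaves `-E s`. -/
theorem kernelOp_deriv (hσ : Continuous σ) (hab : a ≤ b) {E E' : ℝ → ℝ}
    (hE : ContinuousOn E (Set.Icc a b)) (hE' : ContinuousOn E' (Set.Icc a b))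
    (hd : ∀ t ∈ Set.Ioo a b, HasDerivAt E (E' t) t) (ha : E a = 0) (hb : E b = 0) {s : ℝ}
    (hs : s ∈ Set.Icc a b) :
    kernelOp σ a b E' s = (∫ t in a..b, E t * σ t) - E s := by
  have h1 := integral_deriv_mul_eq_neg hab hE hE' (continuousOn_integral hab hσ.continuousOn)
    hσ.continuousOn hd (fun t ht => hasDerivAt_integral_of_mem_Ioo hσ.continuousOn ht) ha hb
  rw [kernelOp, integral_eq_of_vanish hE hE' hd ha hs,
    integral_eq_of_vanish hE hE' hd ha (Set.right_mem_Icc.2 hab), hb]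
  simp only [mul_comm (E' _)] at h1
  rw [h1]
  ring

theorem integral_mul_kernelOp_deriv (hσ : Continuous σ) (hab : a ≤ b) {e E E' : ℝ → ℝ}
    (he : ContinuousOn e (Set.Icc a b))
    (hE : ContinuousOn E (Set.Icc a b)) (hE' : ContinuousOn E' (Set.Icc a b))
    (hd : ∀ t ∈ Set.Ioo a b, HasDerivAt E (E' t) t) (ha : E a = 0) (hb : E b = 0) :
    ∫ s in a..b, e s * kernelOp σ a b E' s =
      (∫ s in a..b, e s) * (∫ t in a..b, E t * σ t) - ∫ s in a..b, e s * E s := by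
  rw [← intervalIntegral.integral_mul_const, ← intervalIntegral.integral_sub
    ((intervalIntegrable_of_Icc hab he).mul_const _) (intervalIntegrable_mul hab he hE)]
  refine intervalIntegral.integral_congr fun s hs => ?_
  rw [Set.uIcc_of_le hab] at hs
  rw [kernelOp_deriv hσ hab hE hE' hd ha hb hs]
  ring

/-- The derivative is moved to the output of the operator, whose derivative is known. This is the
counterpart of `integral_mul_kernelOp_deriv` for a variation of the first field. -/
theorem integral_deriv_mul_kernelOp (hσ : Continuous σ) (hab : a ≤ b) {e E E' : ℝ → ℝ}
    (he : ContinuousOn e (Set.Icc a b))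
    (hE : ContinuousOn E (Set.Icc a b)) (hE' : ContinuousOn E' (Set.Icc a b))
    (hd : ∀ t ∈ Set.Ioo a b, HasDerivAt E (E' t) t) (ha : E a = 0) (hb : E b = 0) :
    ∫ s in a..b, E' s * kernelOp σ a b e s =
      (∫ s in a..b, E s * e s) - (∫ s in a..b, E s * σ s) * ∫ t in a..b, e t := by
  rw [integral_deriv_mul_eq_neg hab hE hE' (continuousOn_kernelOp hσ hab he)
    ((hσ.continuousOn.mul continuousOn_const).sub he) hd
    (fun t ht => hasDerivAt_kernelOp hσ he ht) ha hb, ← intervalIntegral.integral_mul_const,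
    ← intervalIntegral.integral_sub (intervalIntegrable_mul hab hE he)
      ((intervalIntegrable_mul hab hE hσ.continuousOn).mul_const _),
    ← intervalIntegral.integral_neg]
  exact intervalIntegral.integral_congr fun s _ => by simp only [Pi.sub_apply, Pi.mul_apply]; ring

end Interval

theorem mulEven_mulOdd {V₀ V₁ : Type*} (f : V₀ → ℂ) (l : V₀ → V₁ → ℂ) (ψ : SFun V₀ V₁) :
    mulEven f (mulOdd l ψ) = mulOdd (fun p ξ => f p * l p ξ) ψ := by
  funext k p ξ
  cases k with
  | zero => simp [mulEven_apply, mulOdd_apply_zero]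
  | succ k =>
    rw [mulEven_apply, mulOdd_apply_succ, mulOdd_apply_succ, Finset.mul_sum]
    exact Finset.sum_congr rfl fun j _ => by ring

/-! ### Derivatives of Gaussian factors -/

section QuadraticExp

variable {V₀ V₁ : Type*} [AddCommGroup V₀] [Module ℝ V₀]

/-- The exponential of a multiple of a quadratic form. -/
def quadExp (c : ℂ) (Q : V₀ →ₗ[ℝ] V₀ →ₗ[ℝ] ℝ) (p : V₀) : ℂ := Complex.exp (c * (Q p p : ℝ))

variable (c : ℂ) (Q : V₀ →ₗ[ℝ] V₀ →ₗ[ℝ] ℝ)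

/-- Along a line `Q` is a polynomial of degree two. It is not assumed symmetric, so the linear
coefficient has two terms. -/
theorem dirDeriv_quadExp_mul (w : ℂ) (p η : V₀) :
    dirDeriv (fun q => quadExp c Q q * w) p η =
      c * ((Q p η + Q η p : ℝ) : ℂ) * (quadExp c Q p * w) := by
  have h1 : ∀ t : ℝ, Q (p + t • η) (p + t • η) =
      Q p p + t * (Q p η + Q η p) + t ^ 2 * Q η η := by
    intro t
    simp only [map_add, map_smul, LinearMap.add_apply, LinearMap.smul_apply, smul_eq_mul]
    ring
  have h2 : HasDerivAt (fun t : ℝ => Q (p + t • η) (p + t • η)) (Q p η + Q η p) 0 := by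
    simp only [h1]
    have h := (((hasDerivAt_id (0 : ℝ)).mul_const (Q p η + Q η p)).const_add (Q p p)).add
      (((hasDerivAt_id (0 : ℝ)).pow 2).mul_const (Q η η))
    simpa using! h
  have h3 := ((h2.ofReal_comp.const_mul c).cexp).mul_const w
  rw [dirDeriv]
  refine h3.deriv.trans ?_
  simp only [quadExp, zero_smul, add_zero]
  ring

theorem gateauxSmooth_quadExp_mul (w : ℂ) : GateauxSmooth fun p => quadExp c Q p * w := by
  intro n p η
  have h1 : ∀ y : Fin n → ℝ, Q (p + ∑ i, y i • η i) (p + ∑ i, y i • η i) =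
      Q p p + ∑ i, y i * (Q p (η i) + Q (η i) p) + ∑ i, ∑ j, y i * (y j * Q (η i) (η j)) := by
    intro y
    simp only [map_add, map_sum, map_smul, LinearMap.add_apply, LinearMap.smul_apply,
      LinearMap.sum_apply, smul_eq_mul, mul_add, Finset.sum_add_distrib, Finset.mul_sum]
    have h3 : ∑ i, ∑ j, y i * (y j * Q (η j) (η i)) = ∑ i, ∑ j, y i * (y j * Q (η i) (η j)) := by
      rw [Finset.sum_comm]
      exact Finset.sum_congr rfl fun i _ => Finset.sum_congr rfl fun j _ => mul_left_comm _ _ _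
    linarith
  have h2 : ContDiff ℝ ∞ fun y : Fin n → ℝ => Q (p + ∑ i, y i • η i) (p + ∑ i, y i • η i) := by
    simp only [h1]
    fun_prop
  exact ((contDiff_const.mul (Complex.ofRealCLM.contDiff.comp h2)).cexp).mul contDiff_const

variable [AddCommGroup V₁] [Module ℝ V₁] {G : SFun V₀ V₁}

theorem isSuperfunction_quadExp (hG : IsConstAlternating G) :
    IsSuperfunction (mulEven (quadExp c Q) G) := by
  intro k
  obtain ⟨A, hA⟩ := hG k
  refine ⟨fun p => ⟨quadExp c Q p • A, fun ξ => ?_⟩, fun ξ => ?_⟩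
  · simp [mulEven_apply, hA]
  · simp only [mulEven_apply, hA]
    exact gateauxSmooth_quadExp_mul c Q _

theorem dirDeriv_mulEven_quadExp (hG : IsConstAlternating G) (k : ℕ) (ξ : Fin k → V₁)
    (p η : V₀) :
    dirDeriv (fun q => mulEven (quadExp c Q) G k q ξ) p η =
      c * ((Q p η + Q η p : ℝ) : ℂ) * mulEven (quadExp c Q) G k p ξ := by
  obtain ⟨A, hA⟩ := hG k
  simp only [mulEven_apply, hA]
  exact dirDeriv_quadExp_mul c Q _ p η

theorem evenDeriv_quadExp (hG : IsConstAlternating G) (η : V₀) :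
    evenDeriv η (mulEven (quadExp c Q) G) =
      mulEven (fun p => c * ((Q p η + Q η p : ℝ) : ℂ)) (mulEven (quadExp c Q) G) := by
  funext k p ξ
  exact dirDeriv_mulEven_quadExp c Q hG k ξ p η

/-- The odd factor is constant in the even fields, so an odd vector field acts on the product as
multiplication by its value on the exponent, an odd linear functional. -/
theorem oddField_quadExp (hG : IsConstAlternating G) (A : V₁ → V₀) :
    oddField A (mulEven (quadExp c Q) G) =
      mulOdd (fun p ξ => c * ((Q p (A ξ) + Q (A ξ) p : ℝ) : ℂ)) (mulEven (quadExp c Q) G) := by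
  funext k p ξ
  cases k with
  | zero => rfl
  | succ k =>
    rw [mulOdd_apply_succ]
    refine Finset.sum_congr rfl fun j _ => ?_
    rw [dirDeriv_mulEven_quadExp c Q hG]
    ring

end QuadraticExp

/-! ### The action as a bilinear form and an odd quadratic form -/

section Forms

variable {d : ℕ} {a b : ℝ} {σ : ℝ → ℝ}

theorem form1_continuousOn (e : Form1 d a b) (i : Fin d) :
    ContinuousOn (fun t => e.1 t i) (Set.Icc a b) := continuousOn_pi.1 e.2.1.continuousOn i

theorem form0_continuousOn (E : Form0 d a b) (i : Fin d) :
    ContinuousOn (fun t => E.1 t i) (Set.Icc a b) := continuousOn_pi.1 E.2.1.continuousOn i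

theorem form0_apply_left (E : Form0 d a b) (i : Fin d) : E.1 a i = 0 := by rw [E.2.2.2.1]; rfl

theorem form0_apply_right (E : Form0 d a b) (i : Fin d) : E.1 b i = 0 := by rw [E.2.2.2.2]; rfl

theorem hasDerivAt_dInterval (E : Form0 d a b) (i : Fin d) {t : ℝ} (ht : t ∈ Set.Ioo a b) :
    HasDerivAt (fun t => E.1 t i) ((dInterval d a b E).1 t i) t := by
  have h1 := (E.2.1.differentiableOn (by simp) t (Set.Ioo_subset_Icc_self ht)).hasDerivWithinAt
  exact hasDerivAt_pi.1 (h1.hasDerivAt (Icc_mem_nhds ht.1 ht.2)) i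

/-- The integral of a component of a `1`-form. -/
def totalIntegral (hab : a ≤ b) (i : Fin d) : Form1 d a b →ₗ[ℝ] ℝ where
  toFun e := ∫ t in a..b, e.1 t i
  map_add' e e' := intervalIntegral.integral_add
    (intervalIntegrable_of_Icc hab (form1_continuousOn e i))
    (intervalIntegrable_of_Icc hab (form1_continuousOn e' i))
  map_smul' c _ := intervalIntegral.integral_const_mul c _

/-- The pairing of two components with the integral kernel. -/
def kernelPairing (hσ : Continuous σ) (hab : a ≤ b) (i j : Fin d) :
    Form1 d a b →ₗ[ℝ] Form1 d a b →ₗ[ℝ] ℝ :=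
  LinearMap.mk₂ ℝ (fun e e' => ∫ s in a..b, e.1 s i * kernelOp σ a b (fun t => e'.1 t j) s)
    (fun e₁ e₂ e' => by
      have hK := continuousOn_kernelOp hσ hab (form1_continuousOn e' j)
      rw [← intervalIntegral.integral_add (intervalIntegrable_mul hab (form1_continuousOn e₁ i) hK)
        (intervalIntegrable_mul hab (form1_continuousOn e₂ i) hK)]
      exact intervalIntegral.integral_congr fun s _ => add_mul _ _ _)
    (fun c e e' => by
      rw [smul_eq_mul, ← intervalIntegral.integral_const_mul]
      exact intervalIntegral.integral_congr fun s _ => mul_assoc _ _ _)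
    (fun e e₁ e₂ => by
      rw [← intervalIntegral.integral_add
        (intervalIntegrable_mul hab (form1_continuousOn e i)
          (continuousOn_kernelOp hσ hab (form1_continuousOn e₁ j)))
        (intervalIntegrable_mul hab (form1_continuousOn e i)
          (continuousOn_kernelOp hσ hab (form1_continuousOn e₂ j)))]
      refine intervalIntegral.integral_congr fun s hs => ?_
      rw [Set.uIcc_of_le hab] at hs
      rw [← mul_add, ← kernelOp_add hσ hab (form1_continuousOn e₁ j) (form1_continuousOn e₂ j) hs]
      rfl)
    (fun c e e' => by
      rw [smul_eq_mul, ← intervalIntegral.integral_const_mul]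
      refine intervalIntegral.integral_congr fun s _ => ?_
      change _ = c * (e.1 s i * kernelOp σ a b (fun t => e'.1 t j) s)
      rw [mul_left_comm, ← kernelOp_smul c]
      rfl)

/-- The bilinear form whose quadratic form is the part of the action that does not involve odd
fields. -/
def actionForm (α : Matrix (Fin d) (Fin d) ℝ) (hσ : Continuous σ) (hab : a ≤ b) :
    EvenFields d a b →ₗ[ℝ] EvenFields d a b →ₗ[ℝ] ℝ :=
  LinearMap.mk₂ ℝ (fun p q => 1 / 2 * ∑ i, ∑ j, α i j * kernelPairing hσ hab i j p.1 q.1 +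
      ∑ i, p.2.1 i * totalIntegral hab i q.1)
    (fun p p' q => by
      simp only [Prod.fst_add, Prod.snd_add, Pi.add_apply, map_add, LinearMap.add_apply, mul_add,
        add_mul, Finset.sum_add_distrib]
      ring)
    (fun c p q => by
      simp only [Prod.smul_fst, Prod.smul_snd, Pi.smul_apply, map_smul, LinearMap.smul_apply,
        smul_eq_mul, mul_add, Finset.mul_sum]
      congr 1
      · exact Finset.sum_congr rfl fun i _ => Finset.sum_congr rfl fun j _ => by ring
      · exact Finset.sum_congr rfl fun i _ => by ring)
    (fun p q q' => by
      simp only [Prod.fst_add, map_add, mul_add, Finset.sum_add_distrib]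
      ring)
    (fun c p q => by
      simp only [Prod.smul_fst, map_smul, smul_eq_mul, mul_add, Finset.mul_sum]
      congr 1
      · exact Finset.sum_congr rfl fun i _ => Finset.sum_congr rfl fun j _ => by ring
      · exact Finset.sum_congr rfl fun i _ => by ring)

theorem actionForm_apply (α : Matrix (Fin d) (Fin d) ℝ) (hσ : Continuous σ) (hab : a ≤ b)
    (p q : EvenFields d a b) :
    actionForm α hσ hab p q = 1 / 2 * ∑ i, ∑ j, α i j *
      (∫ s in a..b, p.1.1 s i * kernelOp σ a b (fun t => q.1.1 t j) s) +
        ∑ i, p.2.1 i * ∫ t in a..b, q.1.1 t i := rfl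

/-- The odd coordinate `z†ᵢ` as a linear functional. -/
def zDaggerₗ (i : Fin d) : OddFields d a b →ₗ[ℝ] ℂ where
  toFun ξ := (ξ.2.1 i : ℝ)
  map_add' _ _ := Complex.ofReal_add _ _
  map_smul' _ _ := (Complex.ofReal_mul _ _).trans (Complex.real_smul).symm

/-- The integral of a component of the odd boundary field against a function. -/
def oddIntegral (hσ : Continuous σ) (hab : a ≤ b) (i : Fin d) : OddFields d a b →ₗ[ℝ] ℝ where
  toFun ξ := ∫ t in a..b, ξ.1.1 t i * σ t
  map_add' ξ ξ' := by
    rw [← intervalIntegral.integral_add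
      (intervalIntegrable_mul hab (form0_continuousOn ξ.1 i) hσ.continuousOn)
      (intervalIntegrable_mul hab (form0_continuousOn ξ'.1 i) hσ.continuousOn)]
    exact intervalIntegral.integral_congr fun s _ => add_mul _ _ _
  map_smul' c ξ := by
    rw [RingHom.id_apply, smul_eq_mul, ← intervalIntegral.integral_const_mul]
    exact intervalIntegral.integral_congr fun s _ => mul_assoc _ _ _

/-- The odd functional that multiplies `z†ᵢ` in the exponent. -/
def oddCoeff (α : Matrix (Fin d) (Fin d) ℝ) (hσ : Continuous σ) (hab : a ≤ b) (c : ℂ)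
    (i : Fin d) : OddFields d a b →ₗ[ℝ] ℂ where
  toFun ξ := c * ((ξ.2.2 i + ∑ j, α i j * oddIntegral hσ hab j ξ : ℝ) : ℂ)
  map_add' ξ ξ' := by
    simp only [map_add, mul_add, Finset.sum_add_distrib, Prod.snd_add, Pi.add_apply]
    push_cast
    ring
  map_smul' r ξ := by
    simp only [map_smul, Prod.smul_snd, Pi.smul_apply, smul_eq_mul, mul_left_comm _ r,
      ← Finset.mul_sum, ← mul_add, RingHom.id_apply, Complex.real_smul]
    push_cast
    ring

/-- The part of the exponent that involves the odd fields. -/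
def oddExponent (α : Matrix (Fin d) (Fin d) ℝ) (hσ : Continuous σ) (hab : a ≤ b) (c : ℂ) :
    Module.End ℂ (SFun (EvenFields d a b) (OddFields d a b)) :=
  ∑ i, mulOdd (fun _ => zDaggerₗ i) * mulOdd (fun _ => oddCoeff α hσ hab c i)

end Forms

/-! ### Factorisation of the state and the master equation -/

section State

variable {d : ℕ} {a b : ℝ} {α : Matrix (Fin d) (Fin d) ℝ} {m : ℂ → ℝ}
  {ζ : ℂ × ℂ → (ℂ × ℂ →L[ℝ] ℝ)} {σ : ℝ → ℝ}

theorem smul_mulEven {V₀ V₁ : Type*} (c : ℂ) (f : V₀ → ℂ) :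
    c • (mulEven f : Module.End ℂ (SFun V₀ V₁)) = mulEven fun p => c * f p := by
  ext ψ k p ξ
  exact (mul_assoc _ _ _).symm

theorem mulEven_add {V₀ V₁ : Type*} (f g : V₀ → ℂ) :
    (mulEven f + mulEven g : Module.End ℂ (SFun V₀ V₁)) = mulEven fun p => f p + g p := by
  ext ψ k p ξ
  exact (add_mul _ _ _).symm

theorem IsPropagator.integral_integral_zetaHat (hζ : IsPropagator m ζ)
    (hm : IsNormalisedTopForm m) (hab : a ≤ b) (hba : b < a + 2 * Real.pi) (e : Form1 d a b)
    (i j : Fin d) :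
    ∫ s in a..b, ∫ t in a..b, e.1 s i * zetaHat ζ s t * e.1 t j =
      ∫ s in a..b, e.1 s i * kernelOp (tau m ζ) a b (fun t => e.1 t j) s := by
  refine intervalIntegral.integral_congr fun s hs => ?_
  rw [Set.uIcc_of_le hab] at hs
  simp only [mul_assoc]
  rw [intervalIntegral.integral_const_mul,
    hζ.integral_zetaHat_mul hm hba (form1_continuousOn e j) hs]

theorem IsPropagator.actionPert_add (hζ : IsPropagator m ζ) (hm : IsNormalisedTopForm m)
    (hab : a ≤ b) (hba : b < a + 2 * Real.pi) :
    (actionPert α ζ + mulEven (fun p => ((∑ i, ∫ t in a..b, p.2.1 i * p.1.1 t i : ℝ) : ℂ)) :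
        Module.End ℂ (SFun (EvenFields d a b) (OddFields d a b))) =
      mulEven fun p => (actionForm α (hζ.continuous_tau hm) hab p p : ℝ) := by
  rw [actionPert, mulEven_add]
  congr 1
  funext p
  rw [← Complex.ofReal_add, actionForm_apply]
  simp only [hζ.integral_integral_zetaHat hm hab hba, intervalIntegral.integral_const_mul]

/-- The terms `z†ᵢ dxⁱ` and `αⁱʲ z†ᵢ ∫ Eⱼ τ` share their left factor. Collecting them, with the
scalar absorbed on the right, gives a sum over `i` of products of two odd functionals. -/
theorem smul_odd_action_eq (hτ : Continuous (tau m ζ)) (hab : a ≤ b) (c : ℂ) :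
    c • (∑ i, mulOdd (zDagger i) * mulOdd (dxCoord i) + actionResidual α m ζ) =
      oddExponent (d := d) α hτ hab c := by
  rw [actionResidual, ← Finset.sum_add_distrib, Finset.smul_sum, oddExponent]
  refine Finset.sum_congr rfl fun i _ => ?_
  have h : (fun _ => oddCoeff α hτ hab c i :
      EvenFields d a b → OddFields d a b → ℂ) = c • (dxCoord i + ∑ j, (α i j : ℂ) •
        fun _ ξ => ((∫ t in a..b, ξ.1.1 t j * tau m ζ t : ℝ) : ℂ)) := by
    funext p ξ
    simp [oddCoeff, oddIntegral, dxCoord]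
  rw [h, mulOdd_smul, mulOdd_add, mulOdd_sum]
  simp only [mulOdd_smul, mul_smul_comm, mul_add, Finset.mul_sum]
  rfl

theorem IsPropagator.stateExponent_eq (hζ : IsPropagator m ζ) (hm : IsNormalisedTopForm m)
    (hab : a ≤ b) (hba : b < a + 2 * Real.pi) (ħ : ℂ) :
    stateExponent (d := d) (a := a) (b := b) α m ζ ħ =
      mulEven (fun p => Complex.I / ħ * (actionForm α (hζ.continuous_tau hm) hab p p : ℝ)) +
        oddExponent α (hζ.continuous_tau hm) hab (Complex.I / ħ) := by
  rw [stateExponent, actionFree, ← add_assoc, hζ.actionPert_add hm hab hba, add_assoc, smul_add,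
    smul_mulEven, smul_odd_action_eq (hζ.continuous_tau hm) hab]

theorem IsPropagator.hasSum_state (hζ : IsPropagator m ζ) (hm : IsNormalisedTopForm m)
    (hab : a ≤ b) (hba : b < a + 2 * Real.pi) (ħ : ℂ) (k : ℕ) (p : EvenFields d a b)
    (ξ : Fin k → OddFields d a b) :
    HasSum (fun n => expTerm (stateExponent α m ζ ħ) n k p ξ) (state a b α m ζ ħ k p ξ) := by
  refine Summable.hasSum ?_
  rw [hζ.stateExponent_eq hm hab hba]
  exact (hasSum_expTerm_mulEven_add (raisesDegree_quadratic _ _)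
    (mulEven_commute_quadratic _ _ _) k p ξ).summable

theorem IsPropagator.state_eq (hζ : IsPropagator m ζ) (hm : IsNormalisedTopForm m)
    (hab : a ≤ b) (hba : b < a + 2 * Real.pi) (ħ : ℂ) :
    state a b α m ζ ħ =
      mulEven (quadExp (Complex.I / ħ) (actionForm α (hζ.continuous_tau hm) hab))
        (expSF (oddExponent α (hζ.continuous_tau hm) hab (Complex.I / ħ))) := by
  rw [state, hζ.stateExponent_eq hm hab hba]
  exact expSF_mulEven_add (raisesDegree_quadratic _ _) (mulEven_commute_quadratic _ _ _)

theorem isConstAlternating_expSF_oddExponent (hσ : Continuous σ) (hab : a ≤ b) (c : ℂ) :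
    IsConstAlternating (expSF (oddExponent α hσ hab c)) :=
  isConstAlternating_expSF_quadratic _ _

/-- The variation of the action along `e ↦ e - dE`. Integration by parts in each slot gives a local
term from the jump of the kernel and a product of integrals from `σ`; the former assemble to the
`𝔼𝔼` term and the latter to the boundary term. The source term `z · ∫ dE` vanishes because `E` does
at the end points. -/
theorem actionForm_left_form (hσ : Continuous σ) (hab : a ≤ b) (p : EvenFields d a b)
    (E : Form0 d a b) :
    actionForm α hσ hab p (-dInterval d a b E, 0, 0) +
        actionForm α hσ hab (-dInterval d a b E, 0, 0) p =
      1 / 2 * ∑ i, ∑ j, α i j *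
          (∫ t in a..b, (p.1.1 t i * E.1 t j - E.1 t i * p.1.1 t j)) -
        -(1 / 2) * ∑ i, ∑ j, α i j *
          ((∫ s in a..b, ∫ t in a..b, E.1 s i * σ s * p.1.1 t j) -
            ∫ s in a..b, ∫ t in a..b, p.1.1 s i * σ t * E.1 t j) := by
  have hE := form0_continuousOn E
  have hD := form1_continuousOn (dInterval d a b E)
  have he := form1_continuousOn p.1
  have hd : ∀ i, ∀ t ∈ Set.Ioo a b, HasDerivAt (fun t => E.1 t i) ((dInterval d a b E).1 t i) t :=
    fun i t ht => hasDerivAt_dInterval E i ht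
  have h0 : (-dInterval d a b E, 0, 0) = -((dInterval d a b E, 0, 0) : EvenFields d a b) := by
    simp
  have h1 : ∀ i j, ∫ t in a..b, (p.1.1 t i * E.1 t j - E.1 t i * p.1.1 t j) =
      (∫ t in a..b, p.1.1 t i * E.1 t j) - ∫ t in a..b, E.1 t i * p.1.1 t j := fun i j =>
    intervalIntegral.integral_sub (intervalIntegrable_mul hab (he i) (hE j))
      (intervalIntegrable_mul hab (hE i) (he j))
  have h2 : ∀ i j, ∫ s in a..b, ∫ t in a..b, E.1 s i * σ s * p.1.1 t j =
      (∫ s in a..b, E.1 s i * σ s) * ∫ t in a..b, p.1.1 t j := fun i j => by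
    simp only [intervalIntegral.integral_const_mul, intervalIntegral.integral_mul_const]
  have h3 : ∀ i j, ∫ s in a..b, ∫ t in a..b, p.1.1 s i * σ t * E.1 t j =
      (∫ s in a..b, p.1.1 s i) * ∫ t in a..b, E.1 t j * σ t := fun i j => by
    simp only [mul_assoc, mul_comm (σ _), intervalIntegral.integral_const_mul,
      intervalIntegral.integral_mul_const]
  have h4 : ∀ i, ∫ t in a..b, (dInterval d a b E).1 t i = 0 := fun i => by
    rw [integral_eq_of_vanish (hE i) (hD i) (hd i) (form0_apply_left E i) (Set.right_mem_Icc.2 hab),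
      form0_apply_right]
  rw [h0, map_neg, map_neg, LinearMap.neg_apply, actionForm_apply, actionForm_apply]
  simp only [h1, h2, h3, h4, mul_zero, Finset.sum_const_zero, Pi.zero_apply, zero_mul, add_zero,
    integral_mul_kernelOp_deriv hσ hab (he _) (hE _) (hD _) (hd _) (form0_apply_left E _)
      (form0_apply_right E _),
    integral_deriv_mul_kernelOp hσ hab (he _) (hE _) (hD _) (hd _) (form0_apply_left E _)
      (form0_apply_right E _)]
  simp only [mul_sub, Finset.sum_sub_distrib]
  ring

theorem I_mul_mul_I_div {ħ : ℂ} (hħ : ħ ≠ 0) (x : ℂ) :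
    Complex.I * ħ * (Complex.I / ħ * x) = -x := by
  field_simp
  rw [Complex.I_sq]
  ring

theorem IsPropagator.smul_boundaryDiff_state (hζ : IsPropagator m ζ)
    (hm : IsNormalisedTopForm m) (hab : a ≤ b) (hba : b < a + 2 * Real.pi) {ħ : ℂ}
    (hħ : ħ ≠ 0) :
    (Complex.I * ħ) • boundaryDiff (state a b α m ζ ħ) =
      -mulEE α (state a b α m ζ ħ) + mulBoundaryTerm α m ζ (state a b α m ζ ħ) := by
  rw [hζ.state_eq hm hab hba, boundaryDiff,
    oddField_quadExp _ _ (isConstAlternating_expSF_oddExponent _ hab _), mulEE, mulBoundaryTerm,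
    ← LinearMap.smul_apply, ← mulOdd_smul, ← neg_one_smul ℂ (mulOdd _ _), ← LinearMap.smul_apply,
    ← mulOdd_smul, ← LinearMap.add_apply, ← mulOdd_add]
  congr 2
  funext p ξ
  simp only [Pi.smul_apply, Pi.add_apply, smul_eq_mul]
  rw [I_mul_mul_I_div hħ, actionForm_left_form]
  push_cast
  ring

theorem mulOdd_zero {V₀ V₁ : Type*} : (mulOdd 0 : Module.End ℂ (SFun V₀ V₁)) = 0 := by
  simpa using mulOdd_smul (V₀ := V₀) (V₁ := V₁) 0 0

theorem actionForm_right_of_fst_eq_zero (hσ : Continuous σ) (hab : a ≤ b) (p : EvenFields d a b)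
    (y : (Fin d → ℝ) × (Fin d → ℝ)) : actionForm α hσ hab p (0, y) = 0 := by
  change 1 / 2 * ∑ i, ∑ j, α i j * kernelPairing hσ hab i j p.1 0 +
    ∑ i, p.2.1 i * totalIntegral hab i 0 = 0
  simp

theorem actionForm_left_of_fst_eq_zero (hσ : Continuous σ) (hab : a ≤ b) (p : EvenFields d a b)
    (y : (Fin d → ℝ) × (Fin d → ℝ)) :
    actionForm α hσ hab (0, y) p = ∑ i, y.1 i * totalIntegral hab i p.1 := by
  change 1 / 2 * ∑ i, ∑ j, α i j * kernelPairing hσ hab i j 0 p.1 +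
    ∑ i, y.1 i * totalIntegral hab i p.1 = _
  simp

/-- Neither the quadratic form nor the odd exponent depends on the point `x` of the target. -/
theorem IsPropagator.dTarget_state (hζ : IsPropagator m ζ) (hm : IsNormalisedTopForm m)
    (hab : a ≤ b) (hba : b < a + 2 * Real.pi) (ħ : ℂ) : dTarget (state a b α m ζ ħ) = 0 := by
  rw [hζ.state_eq hm hab hba, dTarget,
    oddField_quadExp _ _ (isConstAlternating_expSF_oddExponent _ hab _)]
  simp only [actionForm_right_of_fst_eq_zero, actionForm_left_of_fst_eq_zero, Pi.zero_apply,
    zero_mul, Finset.sum_const_zero, add_zero, Complex.ofReal_zero, mul_zero]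
  exact LinearMap.congr_fun mulOdd_zero _

theorem oddDeriv_expSF_oddExponent (hσ : Continuous σ) (hab : a ≤ b) (c : ℂ) (i : Fin d) :
    oddDeriv (0, Pi.single i 1, 0) (expSF (oddExponent α hσ hab c)) =
      mulOdd (fun _ => oddCoeff α hσ hab c i) (expSF (oddExponent α hσ hab c)) := by
  refine oddDeriv_expSF_quadratic (fun j _ => ?_) fun j _ => ?_
  · simp [zDaggerₗ, Pi.single_apply, apply_ite]
  · simp [oddCoeff, oddIntegral]

/-- `∂/∂z†ᵢ` brings down the odd functional that multiplies `z†ᵢ`, and `∂/∂zⁱ` brings down the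
integral of `eᵢ` from the source term; the functional itself is independent of `z`. -/
theorem bvLaplacian_quadExp (hσ : Continuous σ) (hab : a ≤ b) (c : ℂ) :
    bvLaplacian (mulEven (quadExp c (actionForm α hσ hab)) (expSF (oddExponent α hσ hab c))) =
      mulOdd (∑ i, fun p ξ => c * (totalIntegral hab i p.1 : ℝ) * oddCoeff α hσ hab c i ξ)
        (mulEven (quadExp c (actionForm α hσ hab)) (expSF (oddExponent α hσ hab c))) := by
  rw [bvLaplacian, mulOdd_sum, LinearMap.sum_apply]
  refine Finset.sum_congr rfl fun i _ => ?_
  have hc := fun ψ => LinearMap.congr_fun (mulEven_commute_mulOdd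
    (quadExp c (actionForm α hσ hab)) fun _ => oddCoeff α hσ hab c i).eq ψ
  simp only [Module.End.mul_apply] at hc
  rw [oddDeriv_mulEven, oddDeriv_expSF_oddExponent,
    evenDeriv_quadExp _ _ ((isConstAlternating_expSF_oddExponent hσ hab c).mulOdd _), hc,
    mulEven_mulOdd]
  congr 2
  funext p ξ
  rw [actionForm_right_of_fst_eq_zero, actionForm_left_of_fst_eq_zero]
  simp [Pi.single_apply]

theorem sum_mul_antisymm (hα : α.transpose = -α) (x y : Fin d → ℝ) :
    ∑ i, ∑ j, α i j * (x i * y j) = -∑ i, ∑ j, α i j * (y i * x j) := by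
  rw [Finset.sum_comm, ← Finset.sum_neg_distrib]
  refine Finset.sum_congr rfl fun i _ => ?_
  rw [← Finset.sum_neg_distrib]
  refine Finset.sum_congr rfl fun j _ => ?_
  have h : α j i = -α i j := congr_fun₂ hα i j
  rw [h]
  ring

/-- Each double integral in the boundary term factors into a product of single integrals. By
antisymmetry of `α` its two halves agree up to sign, so their difference, with the factor `-1/2`, is
the single product `αⁱʲ ∫ eᵢ ∫ Eⱼ τ`. -/
theorem sum_totalIntegral_mul_oddCoeff (hα : α.transpose = -α) (hσ : Continuous σ) (hab : a ≤ b)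
    (p : EvenFields d a b) (ξ : OddFields d a b) :
    ∑ i, totalIntegral hab i p.1 * (ξ.2.2 i + ∑ j, α i j * oddIntegral hσ hab j ξ) =
      (∑ i, ∫ t in a..b, p.1.1 t i * ξ.2.2 i) +
        -(1 / 2) * ∑ i, ∑ j, α i j *
          ((∫ s in a..b, ∫ t in a..b, ξ.1.1 s i * σ s * p.1.1 t j) -
            ∫ s in a..b, ∫ t in a..b, p.1.1 s i * σ t * ξ.1.1 t j) := by
  have h2 : ∀ i j, ∫ s in a..b, ∫ t in a..b, ξ.1.1 s i * σ s * p.1.1 t j =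
      oddIntegral hσ hab i ξ * totalIntegral hab j p.1 := fun i j => by
    simp only [intervalIntegral.integral_const_mul, intervalIntegral.integral_mul_const]
    rfl
  have h3 : ∀ i j, ∫ s in a..b, ∫ t in a..b, p.1.1 s i * σ t * ξ.1.1 t j =
      totalIntegral hab i p.1 * oddIntegral hσ hab j ξ := fun i j => by
    simp only [mul_assoc, mul_comm (σ _), intervalIntegral.integral_const_mul,
      intervalIntegral.integral_mul_const]
    rfl
  have h4 : ∀ i, ∫ t in a..b, p.1.1 t i * ξ.2.2 i = totalIntegral hab i p.1 * ξ.2.2 i := fun i =>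
    intervalIntegral.integral_mul_const _ _
  have h5 := sum_mul_antisymm hα (fun i => oddIntegral hσ hab i ξ)
    fun j => totalIntegral hab j p.1
  simp only [h2, h3, h4, mul_sub, mul_add, Finset.sum_sub_distrib, Finset.sum_add_distrib,
    Finset.mul_sum, mul_left_comm (totalIntegral hab _ p.1)] at h5 ⊢
  simp only [← Finset.mul_sum]
  rw [h5]
  ring

theorem IsPropagator.smul_bvLaplacian_state (hα : α.transpose = -α) (hζ : IsPropagator m ζ)
    (hm : IsNormalisedTopForm m) (hab : a ≤ b) (hba : b < a + 2 * Real.pi) {ħ : ℂ}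
    (hħ : ħ ≠ 0) :
    ħ ^ 2 • bvLaplacian (state a b α m ζ ħ) =
      -mulEdx (state a b α m ζ ħ) - mulBoundaryTerm α m ζ (state a b α m ζ ħ) := by
  rw [hζ.state_eq hm hab hba, bvLaplacian_quadExp, ← neg_add', mulEdx, mulBoundaryTerm,
    ← LinearMap.smul_apply, ← mulOdd_smul, ← LinearMap.add_apply, ← mulOdd_add,
    ← neg_one_smul ℂ (mulOdd _ _), ← LinearMap.smul_apply, ← mulOdd_smul]
  congr 2
  funext p ξ
  simp only [Pi.smul_apply, Pi.add_apply, smul_eq_mul]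
  rw [← Complex.ofReal_add,
    ← sum_totalIntegral_mul_oddCoeff hα (hζ.continuous_tau hm) hab p ξ, Complex.ofReal_sum,
    Finset.sum_apply, Finset.sum_apply, Finset.mul_sum, Finset.mul_sum]
  refine Finset.sum_congr rfl fun i _ => ?_
  rw [Complex.ofReal_mul]
  -- One factor `i/ħ` comes from each derivative, so the prefactor is `ħ² (i/ħ)² = -1`.
  change ħ ^ 2 * (Complex.I / ħ * _ * (Complex.I / ħ * _)) = _
  field_simp
  rw [Complex.I_sq]
  ring

theorem IsPropagator.quantumGrothendieck_state (hα : α.transpose = -α) (hζ : IsPropagator m ζ)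
    (hm : IsNormalisedTopForm m) (hab : a ≤ b) (hba : b < a + 2 * Real.pi) {ħ : ℂ}
    (hħ : ħ ≠ 0) : quantumGrothendieck α ħ (state a b α m ζ ħ) = 0 := by
  -- This extracts the common factor `i/ħ`; the bracket is then `-B - 𝔼dx` from the Laplacian plus
  -- `-𝔼𝔼 + B + 𝔼dx + 𝔼𝔼` from the boundary operator.
  have h : Complex.I * ħ = Complex.I / ħ * ħ ^ 2 := by field_simp
  rw [quantumGrothendieck, bfvOperator, hζ.dTarget_state hm hab hba,
    hζ.smul_boundaryDiff_state hm hab hba hħ, h, mul_smul,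
    hζ.smul_bvLaplacian_state hα hm hab hba hħ, zero_add, ← smul_add]
  convert smul_zero (Complex.I / ħ) using 2
  abel

end State

end PSMDisk

end

theorem mainTheorem2 (d : ℕ) (α : Matrix (Fin d) (Fin d) ℝ) (hα : α.transpose = -α)
    (a b : ℝ) (hab : a < b) (hba : b < a + 2 * Real.pi) (ħ : ℂ) (hħ : ħ ≠ 0)
    (m : ℂ → ℝ) (hm : PSMDisk.IsNormalisedTopForm m)
    (ζ : ℂ × ℂ → (ℂ × ℂ →L[ℝ] ℝ)) (hζ : PSMDisk.IsPropagator m ζ) :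
    -- the differential of the boundary function is `π₁^*τ - π₂^*τ`
    (∀ s ∈ Set.Icc a b, ∀ t ∈ Set.Icc a b, s ≠ t →
      HasFDerivAt (fun q : ℝ × ℝ => PSMDisk.zetaHat ζ q.1 q.2)
        (PSMDisk.tau m ζ s • ContinuousLinearMap.fst ℝ ℝ ℝ -
          PSMDisk.tau m ζ t • ContinuousLinearMap.snd ℝ ℝ ℝ) (s, t)) ∧
    -- the exponential series that defines the state converges, and the state is a superfunction
    (∀ k p ξ, HasSum
      (fun n => PSMDisk.expTerm (PSMDisk.stateExponent (a := a) (b := b) α m ζ ħ) n k p ξ)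
      (PSMDisk.state a b α m ζ ħ k p ξ)) ∧
    PSMDisk.IsSuperfunction (PSMDisk.state a b α m ζ ħ) ∧
    -- integration by parts produces the boundary term
    (Complex.I * ħ) • PSMDisk.boundaryDiff (PSMDisk.state a b α m ζ ħ) =
      -PSMDisk.mulEE α (PSMDisk.state a b α m ζ ħ) +
        PSMDisk.mulBoundaryTerm α m ζ (PSMDisk.state a b α m ζ ħ) ∧
    -- the BV Laplacian cancels it
    ħ ^ 2 • PSMDisk.bvLaplacian (PSMDisk.state a b α m ζ ħ) =
      -PSMDisk.mulEdx (PSMDisk.state a b α m ζ ħ) -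
        PSMDisk.mulBoundaryTerm α m ζ (PSMDisk.state a b α m ζ ħ) ∧
    -- the modified differential quantum master equation
    PSMDisk.quantumGrothendieck α ħ (PSMDisk.state a b α m ζ ħ) = 0 := by
  refine ⟨fun s hs t ht hst => hζ.hasFDerivAt_zetaHat hm hst ?_, hζ.hasSum_state hm hab.le hba ħ,
    ?_, hζ.smul_boundaryDiff_state hm hab.le hba hħ,
    hζ.smul_bvLaplacian_state hα hm hab.le hba hħ,
    hζ.quantumGrothendieck_state hα hm hab.le hba hħ⟩
  · rw [abs_lt]
    constructor <;> linarith [hs.1, hs.2, ht.1, ht.2]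
  · rw [hζ.state_eq hm hab.le hba]
    exact PSMDisk.isSuperfunction_quadExp _ _ (PSMDisk.isConstAlternating_expSF_oddExponent _ _ _)
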